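/- A *portalgon* $\mathcal P=(\mathcal F,P)$ consists of a finite collection $\mathcal F$ of simple polygons in the plane (closed regions, called *fragments*) and a collection $P$ of *portals*, which are unordered pairs of directed, distinct edges of equal length of the fragments, each edge being used by at most one portal. Its surface $\Sigma$ is the quotient of the disjoint union of the fragments by the equivalence relation generated by identifying corresponding points of the two edges of each portal. The length of a path in $\Sigma$ that splits into finitely many consecutive subpaths, each contained in a single fragment, is the sum of the Euclidean lengths of these subpaths (a path with no such splitting has infinite length), and a shortest path between two points is a path of minimum (finite) length between them. For a fragment $F$ and a path $\pi$, let $c(F\cap\pi)$ be the number of connected components of the set of points of the polygon $F$ (before gluing) whose image in $\Sigma$ lies on $\pi$. The happiness of $F$ is the maximum of $c(F\cap \pi)$ over all shortest paths $\pi$ between any two points of $\Sigma$, and $\mathcal P$ is *$h$-happy* if every fragment of $\mathcal P$ has happiness at most $h$. A *triangulation* of $\mathcal P$ is a portalgon $\mathcal P'$ obtained as follows: every fragment of $\mathcal P$ is cut into non-degenerate triangles with pairwise disjoint interiors, such that every side of a triangle is either an edge of the fragment or a chord of it (a segment between two vertices of the fragment whose relative interior lies in the interior of the fragment). The fragments of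 $\mathcal P'$ are these triangles; its portals are the portals of $\mathcal P$, together with one portal for each chord, gluing the sides of the two triangles at that chord. **Lemma.** Let $h$ be a natural number, let $\mathcal P$ be an $h$-happy portalgon and let $\mathcal P'$ be a triangulation of $\mathcal P$. Then the happiness of $\mathcal P'$ is at most $h$; that is, $\mathcal P'$ is an $h$-happy portalgon. -/

import Mathlib

open Set
open scoped ENNReal unitInterval

noncomputable section

/-- The Euclidean plane. -/
abbrev Plane : Type := EuclideanSpace ℝ (Fin 2)

/-- A simple polygon: a closed polygonal chain on at least three pairwise distinct vertices, two
different edges of which can meet only in a common endpoint. Vertices with a straight angle are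
allowed. -/
structure SimplePolygon where
  /-- the number of vertices -/
  n : ℕ
  three_le : 3 ≤ n
  poly : Polygon Plane n
  injective_vertices : Function.Injective poly.vertices
  edges_meet : ∀ k l : Fin n, k ≠ l → poly.edgeSet ℝ k ∩ poly.edgeSet ℝ l ⊆
    {poly k, poly (finRotate n k)} ∩ {poly l, poly (finRotate n l)}

namespace SimplePolygon

/-- The closed region of the plane bounded by the polygon: its boundary, together with the points
off the boundary that the boundary separates from infinity. -/
def region (Q : SimplePolygon) : Set Plane :=
  Q.poly.boundary ℝ ∪ {x | x ∉ Q.poly.boundary ℝ ∧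
    Bornology.IsBounded (connectedComponentIn (Q.poly.boundary ℝ)ᶜ x)}

/-- The segment from `a` to `b` is a chord (diagonal) of the polygon: it joins two vertices and
its relative interior lies in the interior of the polygon. -/
def IsChord (Q : SimplePolygon) (a b : Plane) : Prop :=
  a ∈ range Q.poly.vertices ∧ b ∈ range Q.poly.vertices ∧
    openSegment ℝ a b ⊆ interior Q.region

end SimplePolygon

/-- An edge of one of the polygons of a finite family, with one of its two directions;
`reversed = false` is the direction of increasing vertex index. -/
structure DirectedEdge {N : ℕ} (F : Fin N → SimplePolygon) where
  /-- the polygon that the edge belongs to -/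
  frag : Fin N
  /-- the index of the edge, which joins the vertices `index` and `finRotate _ index` -/
  index : Fin (F frag).n
  reversed : Bool

namespace DirectedEdge

variable {N : ℕ} {F : Fin N → SimplePolygon}

/-- The underlying undirected edge. -/
def edge (d : DirectedEdge F) : Σ i : Fin N, Fin (F i).n := ⟨d.frag, d.index⟩

/-- The initial vertex. -/
def src (d : DirectedEdge F) : Plane :=
  if d.reversed then (F d.frag).poly (finRotate _ d.index) else (F d.frag).poly d.index

/-- The final vertex. -/
def tgt (d : DirectedEdge F) : Plane :=
  if d.reversed then (F d.frag).poly d.index else (F d.frag).poly (finRotate _ d.index)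

/-- The same edge with the opposite direction. -/
def reverse (d : DirectedEdge F) : DirectedEdge F := ⟨d.frag, d.index, !d.reversed⟩

end DirectedEdge

/-- A portalgon: a finite collection of simple polygons (the fragments) and a collection of
portals, which are unordered pairs of directed, distinct, equally long edges of fragments, such
that each edge is used by at most one portal, and only once. -/
structure Portalgon where
  /-- the number of fragments -/
  N : ℕ
  fragment : Fin N → SimplePolygon
  portals : Set (Sym2 (DirectedEdge fragment))
  portal_distinct : ∀ d e, s(d, e) ∈ portals → d.edge ≠ e.edge
  portal_length : ∀ d e, s(d, e) ∈ portals → dist d.src d.tgt = dist e.src e.tgt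
  portal_unique : ∀ z ∈ portals, ∀ w ∈ portals, ∀ d ∈ z, ∀ e ∈ w, d.edge = e.edge → z = w

namespace Portalgon

/-- Directed edges of the fragments of a portalgon. -/
abbrev DEdge (P : Portalgon) : Type := DirectedEdge P.fragment

/-- The disjoint union of the fragments. -/
abbrev Points (P : Portalgon) : Type := Σ i : Fin P.N, (P.fragment i).region

/-- Corresponding points on the two edges of a portal. -/
def Corresponding (P : Portalgon) (x y : P.Points) : Prop :=
  ∃ d e : P.DEdge, s(d, e) ∈ P.portals ∧ ∃ t ∈ Icc (0 : ℝ) 1,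
    (x.1 = d.frag ∧ (x.2 : Plane) = AffineMap.lineMap d.src d.tgt t) ∧
    (y.1 = e.frag ∧ (y.2 : Plane) = AffineMap.lineMap e.src e.tgt t)

/-- The surface of a portalgon: the quotient of the disjoint union of its fragments by the
equivalence relation generated by identifying corresponding points on portal edges. -/
def Surface (P : Portalgon) : Type := Quot P.Corresponding

/-- The quotient topology. -/
instance (P : Portalgon) : TopologicalSpace P.Surface :=
  inferInstanceAs (TopologicalSpace (Quot P.Corresponding))

/-- The quotient map from the disjoint union of the fragments to the surface. -/
def proj (P : Portalgon) (x : P.Points) : P.Surface := Quot.mk _ x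

/-- A splitting of a path on the surface into finitely many consecutive subpaths, each of which
is contained in a single fragment. -/
structure Splitting (P : Portalgon) {s t : P.Surface} (π : Path s t) where
  /-- the number of subpaths -/
  size : ℕ
  time : Fin (size + 1) → I
  monotone_time : Monotone time
  time_zero : time 0 = 0
  time_last : time (Fin.last size) = 1
  /-- the fragment containing the `j`-th subpath -/
  frag : Fin size → Fin P.N
  /-- the `j`-th subpath inside its fragment; only its values between `time j.castSucc` and
  `time j.succ` matter -/
  piece : Fin size → I → Plane
  continuousOn_piece : ∀ j, ContinuousOn (piece j) (Icc (time j.castSucc) (time j.succ))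
  proj_piece : ∀ j, ∀ u ∈ Icc (time j.castSucc) (time j.succ),
    ∃ h : piece j u ∈ (P.fragment (frag j)).region, P.proj ⟨frag j, piece j u, h⟩ = π u

/-- The sum of the Euclidean lengths of the subpaths of a splitting. -/
def Splitting.length {P : Portalgon} {s t : P.Surface} {π : Path s t} (S : P.Splitting π) :
    ℝ≥0∞ :=
  ∑ j, eVariationOn (S.piece j) (Icc (S.time j.castSucc) (S.time j.succ))

/-- The length of a path: the sum of the lengths of its subpaths. The sum is the same for all
splittings, so taking the infimum only serves to give paths without a splitting length `⊤`. -/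
def length (P : Portalgon) {s t : P.Surface} (π : Path s t) : ℝ≥0∞ :=
  ⨅ S : P.Splitting π, S.length

/-- The distance on the surface: the infimum of the lengths of the paths from `s` to `t`
(`⊤` if there are none). -/
def distance (P : Portalgon) (s t : P.Surface) : ℝ≥0∞ := ⨅ π : Path s t, P.length π

/-- Shortest paths. -/
def IsShortest (P : Portalgon) {s t : P.Surface} (π : Path s t) : Prop :=
  P.length π ≠ ⊤ ∧ P.length π = P.distance s t

/-- The part of a fragment covered by a path: the points of the fragment (as a polygon in the
plane, before gluing) that represent a point of the image of the path. -/
def trace (P : Portalgon) (i : Fin P.N) {s t : P.Surface} (π : Path s t) :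
    Set (P.fragment i).region :=
  {x | P.proj ⟨i, x⟩ ∈ range π}

/-- The happiness of a fragment: the maximal number of connected components of the intersection
of the fragment with a shortest path, over all shortest paths on the surface. -/
def fragmentHappiness (P : Portalgon) (i : Fin P.N) : ℕ∞ :=
  ⨆ (s : P.Surface) (t : P.Surface) (π : Path s t) (_ : P.IsShortest π),
    ENat.card (ConnectedComponents (P.trace i π))

/-- The happiness of a portalgon: the maximal happiness of its fragments. -/
def happiness (P : Portalgon) : ℕ∞ := ⨆ i, P.fragmentHappiness i

/-- `h`-happy portalgons. -/
def IsHappy (P : Portalgon) (h : ℕ) : Prop := P.happiness ≤ h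

/-- Two directed edges are glued by a portal. Reversing both edges of a portal does not change
which points it identifies. -/
def Glued (P : Portalgon) (d e : P.DEdge) : Prop :=
  s(d, e) ∈ P.portals ∨ s(d.reverse, e.reverse) ∈ P.portals

/-- `P'` arises from `P` by cutting each fragment of `P` along chords into triangles, where the
fragment `j` of `P'` is a triangle cut out of the fragment `parent j` of `P`, and turning these
chords into portals. -/
structure IsTriangulationVia (P P' : Portalgon) (parent : Fin P'.N → Fin P.N) : Prop where
  triangle : ∀ j, (P'.fragment j).n = 3
  cover : ∀ i, (⋃ j ∈ {j | parent j = i}, (P'.fragment j).region) = (P.fragment i).region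
  disjoint : ∀ j k, j ≠ k → parent j = parent k →
    Disjoint (interior (P'.fragment j).region) (interior (P'.fragment k).region)
  /-- every side of a triangle is an edge or a chord of the fragment it was cut out of -/
  edge_or_chord : ∀ d : P'.DEdge,
    (∃ D : P.DEdge, parent d.frag = D.frag ∧ d.src = D.src ∧ d.tgt = D.tgt) ∨
      (P.fragment (parent d.frag)).IsChord d.src d.tgt
  /-- the portals of `P'` glue the two sides of each chord back together, and glue the edges
  inherited from `P` in the same way as in `P`; there are no other portals -/
  glued_iff : ∀ d e : P'.DEdge, P'.Glued d e ↔
    (parent d.frag = parent e.frag ∧ d.edge ≠ e.edge ∧ d.src = e.src ∧ d.tgt = e.tgt ∧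
      (P.fragment (parent d.frag)).IsChord d.src d.tgt) ∨
    (∃ D E : P.DEdge, P.Glued D E ∧
      (parent d.frag = D.frag ∧ d.src = D.src ∧ d.tgt = D.tgt) ∧
      (parent e.frag = E.frag ∧ e.src = E.src ∧ e.tgt = E.tgt))

/-- `P'` is a triangulation of `P`. -/
def IsTriangulation (P P' : Portalgon) : Prop := ∃ parent, P.IsTriangulationVia P' parent

end Portalgon

end

noncomputable section

/-! ### Segments and rays -/

section Segments

variable {E : Type*} [NormedAddCommGroup E] [NormedSpace ℝ E]

/-! Let T be a triangle cut out of a fragment F, and let π be a shortest path on the surface of P'.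
The surfaces of P and P' are in bijection (`incl`, `cut`). A curve inside F can be rerouted so that
it visits each triangle at most once without getting longer, so distances on P' are at most those on
P, and subpaths of π are shortest on P too (`isShortest_map_subpath`). It therefore suffices to find
a subpath ρ of π and to inject any finite set of components of T ∩ π into the components of F ∩ ρ.

Let A be the set of points of F that lie on π, and let φ be the distance on P' from the start of π.
Near each of its points, A is a union of segments on which φ is isometric (`locallyStraight`).
Suppose that φ is also injective near each point of A. Then points p, q of T in one component of A
are joined by a curve in A that is parametrized by φ (`LocallyStraight.hasLift_of_isPreconnected`),
of length |φ p - φ q|. The segment pq lies in the convex set T and π is shortest, so |φ p - φ q| ≤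
|p - q|. Hence the curve is the segment pq (`HasLift.segment_subset`), which lies in T ∩ π, and p
and q are in one component of T ∩ π. In this case ρ = π works.

Local injectivity fails at folds: vertices z of F whose two edges are glued to each other, with π
running to z along this common edge. Then F ∩ π contains both copies of the edge, joined at z, while
T may touch both copies away from z, so that ρ = π is a bad choice. If π continued beyond z, one of
the two copies would offer a shortcut; hence π folds only where it starts or ends
(`level_of_isFold`). Cutting off short pieces at the ends of π removes the folds, and
representatives of components that are lost can be moved along π to the new ends
(`LocallyStraight.exists_truncation`).

The local analysis of paths takes place on P', whose fragments are convex, while F need not be. The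
plane topology serves to show that the boundary of a simple polygon is disjoint from the interior of
its region, and that the interior is connected near each point of the polygon. The latter is why the
copies of a point in different triangles of F are identified in P' (`pt_eq`). -/

theorem mem_segment_iff_mem_ray {a b y : E} (hab : a ≠ b) (hy : dist y a < dist b a) :
    y ∈ segment ℝ a b ↔ ∃ s : ℝ, 0 ≤ s ∧ y = a + s • (b - a) := by
  rw [segment_eq_image']
  constructor
  · rintro ⟨s, hs, rfl⟩
    exact ⟨s, hs.1, rfl⟩
  · rintro ⟨s, hs, rfl⟩
    refine ⟨s, ⟨hs, ?_⟩, rfl⟩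
    have hpos : 0 < dist b a := dist_pos.2 hab.symm
    have h : dist (a + s • (b - a)) a = s * dist b a := by
      simp [dist_eq_norm, norm_smul, abs_of_nonneg hs]
    rw [h] at hy
    nlinarith

theorem segment_eq_union_of_mem {a b x : E} (hx : x ∈ segment ℝ a b) :
    segment ℝ a b = segment ℝ x a ∪ segment ℝ x b := by
  apply Subset.antisymm
  · intro y hy
    rw [segment_eq_image_lineMap] at hx hy
    obtain ⟨r, hr, rfl⟩ := hx
    obtain ⟨t, ht, rfl⟩ := hy
    have key : ∀ c d : ℝ, AffineMap.lineMap a b t ∈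
        segment ℝ (AffineMap.lineMap a b c) (AffineMap.lineMap a b d) ↔
        AffineMap.lineMap a b t ∈ (AffineMap.lineMap a b : ℝ →ᵃ[ℝ] E) '' segment ℝ c d := by
      intro c d
      rw [image_segment]
    rcases le_total t r with h | h
    · left
      have := key r 0
      rw [AffineMap.lineMap_apply_zero] at this
      rw [this]
      exact ⟨t, by rw [segment_symm, segment_eq_Icc hr.1]; exact ⟨ht.1, h⟩, rfl⟩
    · right
      have := key r 1
      rw [AffineMap.lineMap_apply_one] at this
      rw [this]
      exact ⟨t, by rw [segment_eq_Icc hr.2]; exact ⟨h, ht.2⟩, rfl⟩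
  · exact union_subset ((convex_segment a b).segment_subset hx (left_mem_segment ℝ a b))
      ((convex_segment a b).segment_subset hx (right_mem_segment ℝ a b))

end Segments

/-- The source of most small radii below: a ball around `x` that meets only those edges, triangles
or vertices that contain `x`. -/
theorem exists_ball_disjoint_of_finite {X ι : Type*} [PseudoMetricSpace X] [Finite ι]
    (S : ι → Set X) (hS : ∀ i, IsClosed (S i)) (x : X) :
    ∃ ε > 0, ∀ i, x ∉ S i → ∀ y, dist y x < ε → y ∉ S i := by
  have h : ∀ᶠ y in nhds x, ∀ i, x ∉ S i → y ∉ S i := by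
    rw [Filter.eventually_all]
    intro i
    by_cases hi : x ∈ S i
    · simp [hi]
    · filter_upwards [(hS i).isOpen_compl.mem_nhds hi] with y hy _ using hy
  obtain ⟨ε, hε, h⟩ := Metric.eventually_nhds_iff.1 h
  exact ⟨ε, hε, fun i hi y hy => h hy i hi⟩

theorem finRotate_ne_self {n : ℕ} (hn : 2 ≤ n) (k : Fin n) : finRotate n k ≠ k := by
  obtain ⟨m, rfl⟩ := Nat.exists_eq_add_of_le' (show 1 ≤ n by omega)
  have : NeZero m := ⟨by omega⟩
  rw [finRotate_apply]
  intro h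
  rw [Fin.ext_iff, Fin.val_add_one] at h
  split_ifs at h with h1
  · subst h1; simp at h; omega
  · omega

theorem finRotate_finRotate_ne_self {n : ℕ} (hn : 3 ≤ n) (k : Fin n) :
    finRotate n (finRotate n k) ≠ k := by
  obtain ⟨m, rfl⟩ := Nat.exists_eq_add_of_le' (show 1 ≤ n by omega)
  rw [finRotate_apply, finRotate_apply]
  intro h
  rw [Fin.ext_iff, Fin.val_add_one, Fin.val_add_one] at h
  have hk := k.2
  simp only [Fin.ext_iff, Fin.val_add_one, Fin.val_last] at h
  split_ifs at h <;> omega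

/-! ### Edges and vertices of simple polygons -/

namespace SimplePolygon

variable (Q : SimplePolygon)

/-- The boundary of a simple polygon. -/
abbrev bd : Set Plane := Q.poly.boundary ℝ

theorem edgeSet_eq_segment (k : Fin Q.n) :
    Q.poly.edgeSet ℝ k = segment ℝ (Q.poly k) (Q.poly (finRotate Q.n k)) :=
  affineSegment_eq_segment _ _ _

theorem vertex_ne_next (k : Fin Q.n) : Q.poly k ≠ Q.poly (finRotate Q.n k) := fun h =>
  finRotate_ne_self (by have := Q.three_le; omega) k (Q.injective_vertices h).symm

theorem isClosed_edgeSet (k : Fin Q.n) : IsClosed (Q.poly.edgeSet ℝ k) := by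
  rw [edgeSet_eq_segment, ← convexHull_pair]
  exact (Set.Finite.isCompact_convexHull ℝ (by simp)).isClosed

theorem isCompact_bd : IsCompact Q.bd :=
  isCompact_iUnion fun k => by
    rw [edgeSet_eq_segment, ← convexHull_pair]
    exact Set.Finite.isCompact_convexHull ℝ (by simp)

theorem edgeSet_subset_bd (k : Fin Q.n) : Q.poly.edgeSet ℝ k ⊆ Q.bd :=
  subset_iUnion (fun k => Q.poly.edgeSet ℝ k) k

theorem bd_subset_region : Q.bd ⊆ Q.region := subset_union_left

theorem left_mem_edgeSet (k : Fin Q.n) : Q.poly k ∈ Q.poly.edgeSet ℝ k := by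
  rw [edgeSet_eq_segment]; exact left_mem_segment ℝ _ _

theorem right_mem_edgeSet (k : Fin Q.n) : Q.poly (finRotate Q.n k) ∈ Q.poly.edgeSet ℝ k := by
  rw [edgeSet_eq_segment]; exact right_mem_segment ℝ _ _

theorem vertex_mem_bd (k : Fin Q.n) : Q.poly k ∈ Q.bd :=
  Q.edgeSet_subset_bd k (Q.left_mem_edgeSet k)

theorem vertex_mem_edgeSet {m k : Fin Q.n} (h : Q.poly m ∈ Q.poly.edgeSet ℝ k) :
    m = k ∨ m = finRotate Q.n k := by
  by_contra! hc
  have := (Q.edges_meet m k hc.1 ⟨Q.left_mem_edgeSet m, h⟩).2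
  rcases this with h1 | h1
  · exact hc.1 (Q.injective_vertices h1)
  · exact hc.2 (Q.injective_vertices h1)

theorem mem_range_of_mem_edgeSet {k l : Fin Q.n} (hkl : k ≠ l) {x : Plane}
    (hk : x ∈ Q.poly.edgeSet ℝ k) (hl : x ∈ Q.poly.edgeSet ℝ l) :
    x ∈ range Q.poly.vertices := by
  rcases (Q.edges_meet k l hkl ⟨hk, hl⟩).1 with h | h
  · exact ⟨k, h.symm⟩
  · exact ⟨_, h.symm⟩

theorem eq_or_of_vertex_mem_edgeSet {m k : Fin Q.n} (h : Q.poly m ∈ Q.poly.edgeSet ℝ k) :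
    k = m ∨ k = (finRotate Q.n).symm m := by
  rcases Q.vertex_mem_edgeSet h with h | h
  · exact Or.inl h.symm
  · exact Or.inr (by rw [h, Equiv.symm_apply_apply])

theorem isOpen_compl_bd : IsOpen Q.bdᶜ := Q.isCompact_bd.isClosed.isOpen_compl

/-- If the two edges at a vertex had the same direction, the far end of the shorter one would lie on
the other edge, although the edges share only this vertex. They cannot share their far ends because
there are at least three vertices. -/
theorem not_sameRay_of_vertex (k : Fin Q.n) :
    ¬ SameRay ℝ (Q.poly (finRotate Q.n k) - Q.poly k)
      (Q.poly ((finRotate Q.n).symm k) - Q.poly k) := by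
  set l := (finRotate Q.n).symm k with hl
  have hlk : finRotate Q.n l = k := Equiv.apply_symm_apply _ _
  have h1 := Q.vertex_ne_next k
  have h2 : Q.poly l ≠ Q.poly k := by have := Q.vertex_ne_next l; rwa [hlk] at this
  have hne : l ≠ k := fun h => h2 (by rw [h])
  intro h
  have key : ∀ x, x ∈ Q.poly.edgeSet ℝ k → x ∈ Q.poly.edgeSet ℝ l → x = Q.poly k := by
    intro x hx hx'
    have := Q.edges_meet k l hne.symm ⟨hx, hx'⟩
    rw [hlk] at this
    rcases this with ⟨h3 | h3, h4 | h4⟩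
    · exact h3
    · exact h3
    · exfalso
      have : finRotate Q.n k = l := Q.injective_vertices (h3.symm.trans h4)
      exact finRotate_finRotate_ne_self Q.three_le k (by rw [this, hlk])
    · exact h4
  have hmid : ∀ x : Plane, ∀ a b : Plane, ∀ s : ℝ, 0 ≤ s → s ≤ 1 → x = a + s • (b - a) →
      x ∈ segment ℝ a b := by
    intro x a b s hs hs' hx
    rw [segment_eq_image']; exact ⟨s, ⟨hs, hs'⟩, hx.symm⟩
  obtain ⟨r1, r2, hr1, hr2, hr⟩ := h.exists_pos (sub_ne_zero.2 h1.symm) (sub_ne_zero.2 h2)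
  have hseg : Q.poly.edgeSet ℝ l = segment ℝ (Q.poly k) (Q.poly l) := by
    rw [edgeSet_eq_segment, hlk, segment_symm]
  rcases le_total r1 r2 with h12 | h12
  · have := key (Q.poly l) (by
      rw [edgeSet_eq_segment]
      refine hmid _ _ _ (r1 / r2) (by positivity) ((div_le_one hr2).2 h12) ?_
      rw [div_eq_inv_mul, mul_smul, hr, smul_smul, inv_mul_cancel₀ hr2.ne']; simp) (Q.left_mem_edgeSet l)
    exact h2 this
  · have := key (Q.poly (finRotate Q.n k)) (Q.right_mem_edgeSet k) (by
      rw [hseg]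
      refine hmid _ _ _ (r2 / r1) (by positivity) ((div_le_one hr1).2 h12) ?_
      rw [div_eq_inv_mul, mul_smul, ← hr, smul_smul, inv_mul_cancel₀ hr1.ne']; simp)
    exact h1 this.symm

/-- Near each of its points, the boundary of a simple polygon consists of two rays. -/
theorem exists_rays {x : Plane} (hx : x ∈ Q.bd) : ∃ u₁ u₂ : Plane, u₁ ≠ 0 ∧ u₂ ≠ 0 ∧
    ¬ SameRay ℝ u₁ u₂ ∧ ∃ ε > 0, ∀ y, dist y x < ε →
      (y ∈ Q.bd ↔ (∃ s : ℝ, 0 ≤ s ∧ y = x + s • u₁) ∨ ∃ s : ℝ, 0 ≤ s ∧ y = x + s • u₂) := by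
  obtain ⟨ε, hε, hball⟩ := exists_ball_disjoint_of_finite (fun k => Q.poly.edgeSet ℝ k)
    Q.isClosed_edgeSet x
  have hmem : ∀ y, dist y x < ε → (y ∈ Q.bd ↔ ∃ k, x ∈ Q.poly.edgeSet ℝ k ∧
      y ∈ Q.poly.edgeSet ℝ k) := by
    intro y hy
    simp only [Polygon.boundary, mem_iUnion]
    constructor
    · rintro ⟨k, hk⟩
      exact ⟨k, by_contra fun h => hball k h y hy hk, hk⟩
    · rintro ⟨k, -, hk⟩
      exact ⟨k, hk⟩
  by_cases hv : x ∈ range Q.poly.vertices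
  · obtain ⟨k, rfl⟩ := hv
    set l := (finRotate Q.n).symm k with hl
    have hlk : finRotate Q.n l = k := Equiv.apply_symm_apply _ _
    have h1 := Q.vertex_ne_next k
    have h2 : Q.poly l ≠ Q.poly k := by have := Q.vertex_ne_next l; rwa [hlk] at this
    have hseg : Q.poly.edgeSet ℝ l = segment ℝ (Q.poly k) (Q.poly l) := by
      rw [edgeSet_eq_segment, hlk, segment_symm]
    refine ⟨_, _, sub_ne_zero.2 h1.symm, sub_ne_zero.2 h2, Q.not_sameRay_of_vertex k,
      min ε (min (dist (Q.poly (finRotate Q.n k)) (Q.poly k)) (dist (Q.poly l) (Q.poly k))),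
      lt_min hε (lt_min (dist_pos.2 h1.symm) (dist_pos.2 h2)), fun y hy => ?_⟩
    rw [lt_min_iff, lt_min_iff] at hy
    rw [hmem y hy.1, ← mem_segment_iff_mem_ray h1 hy.2.1, ← mem_segment_iff_mem_ray h2.symm hy.2.2,
      ← hseg, ← edgeSet_eq_segment]
    constructor
    · rintro ⟨m, hm, hym⟩
      rcases Q.eq_or_of_vertex_mem_edgeSet hm with rfl | rfl
      · exact Or.inl hym
      · exact Or.inr hym
    · rintro (h | h)
      · exact ⟨k, Q.left_mem_edgeSet k, h⟩
      · exact ⟨l, by rw [hseg]; exact left_mem_segment ℝ _ _, h⟩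
  · obtain ⟨k, hk⟩ := mem_iUnion.1 hx
    have ha : x ≠ Q.poly k := fun h => hv ⟨k, h.symm⟩
    have hb : x ≠ Q.poly (finRotate Q.n k) := fun h => hv ⟨_, h.symm⟩
    have hk' := hk
    rw [edgeSet_eq_segment] at hk'
    refine ⟨_, _, sub_ne_zero.2 ha.symm, sub_ne_zero.2 hb.symm, ?_,
      min ε (min (dist (Q.poly k) x) (dist (Q.poly (finRotate Q.n k)) x)),
      lt_min hε (lt_min (dist_pos.2 ha.symm) (dist_pos.2 hb.symm)), fun y hy => ?_⟩
    · intro h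
      have h3 := (mem_segment_iff_sameRay.1 hk').symm
      rw [← neg_sub] at h
      have h4 : SameRay ℝ (Q.poly (finRotate Q.n k) - x) (-(Q.poly (finRotate Q.n k) - x)) :=
        h3.trans (by have := h.neg; rwa [neg_neg] at this) fun h0 => absurd (sub_eq_zero.1 h0) ha
      exact hb (sub_eq_zero.1 (eq_zero_of_sameRay_self_neg h4)).symm
    · rw [lt_min_iff, lt_min_iff] at hy
      rw [hmem y hy.1, ← mem_segment_iff_mem_ray ha hy.2.1, ← mem_segment_iff_mem_ray hb hy.2.2,
        ← mem_union, ← segment_eq_union_of_mem hk', ← edgeSet_eq_segment]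
      constructor
      · rintro ⟨m, hm, hym⟩
        by_contra h
        have hmk : m ≠ k := by rintro rfl; exact h hym
        exact hv (Q.mem_range_of_mem_edgeSet hmk hm hk)
      · exact fun h => ⟨k, hk, h⟩

end SimplePolygon

/-! ### The two sectors between two rays -/

/-- The planeCross product with a fixed vector of the plane. -/
def planeCross (u : Plane) : Plane →L[ℝ] ℝ :=
  u 0 • EuclideanSpace.proj 1 - u 1 • EuclideanSpace.proj 0

theorem planeCross_apply (u y : Plane) : planeCross u y = u 0 * y 1 - u 1 * y 0 := by
  simp [planeCross]

theorem planeCross_self (u : Plane) : planeCross u u = 0 := by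
  rw [planeCross_apply]; ring

theorem planeCross_comm (u v : Plane) : planeCross v u = -planeCross u v := by
  rw [planeCross_apply, planeCross_apply]; ring

theorem exists_smul_of_planeCross_eq_zero {u y : Plane} (hu : u ≠ 0) (h : planeCross u y = 0) :
    ∃ c : ℝ, y = c • u := by
  rw [planeCross_apply] at h
  by_cases h0 : u 0 = 0
  · have h1 : u 1 ≠ 0 := by
      intro h1
      apply hu
      ext i; fin_cases i <;> simpa
    refine ⟨y 1 / u 1, ?_⟩
    have : y 0 = 0 := by
      rw [h0] at h
      have : u 1 * y 0 = 0 := by linarith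
      exact (mul_eq_zero.1 this).resolve_left h1
    ext i; fin_cases i
    · simp [h0, this]
    · simp [h1]
  · refine ⟨y 0 / u 0, ?_⟩
    ext i; fin_cases i
    · simp [h0]
    · simp; field_simp; linarith

theorem exists_planeCross_pos {u : Plane} (hu : u ≠ 0) : ∃ m, 0 < planeCross u m := by
  by_contra! h
  have h1 := h (EuclideanSpace.single 1 (u 0))
  have h2 := h (-EuclideanSpace.single 0 (u 1))
  rw [planeCross_apply] at h1 h2
  simp at h1 h2
  apply hu
  ext i; fin_cases i
  · simp; nlinarith
  · simp; nlinarith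

/-- The union of the rays from `x` with directions `u₁` and `u₂`. -/
def twoRays (x u₁ u₂ : Plane) : Set Plane :=
  {y | (∃ s : ℝ, 0 ≤ s ∧ y = x + s • u₁) ∨ ∃ s : ℝ, 0 ≤ s ∧ y = x + s • u₂}

theorem twoRays_comm (x u₁ u₂ : Plane) : twoRays x u₁ u₂ = twoRays x u₂ u₁ := by
  ext y; exact or_comm

theorem mem_closure_of_forall_add_smul {S : Set Plane} {x y m : Plane} {ε : ℝ} (hy : dist y x < ε)
    (h : ∀ τ : ℝ, 0 < τ → dist (y + τ • m) x < ε → y + τ • m ∈ S) : y ∈ closure S := by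
  have ht : Filter.Tendsto (fun τ : ℝ => y + τ • m) (nhdsWithin 0 (Ioi 0)) (nhds y) := by
    have : ContinuousAt (fun τ : ℝ => y + τ • m) 0 := by fun_prop
    have := this.tendsto
    simp only [zero_smul, add_zero] at this
    exact this.mono_left nhdsWithin_le_nhds
  refine mem_closure_of_tendsto ht ?_
  have h1 : ∀ᶠ z in nhds y, dist z x < ε := Metric.isOpen_ball.mem_nhds hy
  filter_upwards [ht.eventually h1, self_mem_nhdsWithin] with τ hτ hpos using h τ hpos hτ

/-- After a swap, `u₂` is reached from `u₁` by a counterclockwise turn of at most π. Then `S₁` is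
the convex sector between the rays, an intersection of two half-planes with the ball, and `S₂` is
the union of the two complementary half-discs, which overlap. Moving a point of a ray slightly in
the direction `m` leads into `S₁`, and in the direction `-m` into `S₂`. -/
theorem exists_sectors {u₁ u₂ : Plane} (h₁ : u₁ ≠ 0) (h₂ : u₂ ≠ 0) (h : ¬ SameRay ℝ u₁ u₂)
    (x : Plane) {ε : ℝ} (hε : 0 < ε) : ∃ S₁ S₂ : Set Plane, IsPreconnected S₁ ∧
    IsPreconnected S₂ ∧ S₁ ∪ S₂ = Metric.ball x ε \ twoRays x u₁ u₂ ∧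
    ∀ y ∈ Metric.ball x ε, y ∈ twoRays x u₁ u₂ → y ∈ closure S₁ ∧ y ∈ closure S₂ := by
  wlog hc : 0 ≤ planeCross u₁ u₂ generalizing u₁ u₂
  · rw [twoRays_comm]
    exact this h₂ h₁ (fun h' => h h'.symm) (by rw [planeCross_comm]; linarith)
  have hanti : planeCross u₁ u₂ = 0 → ∃ κ : ℝ, 0 < κ ∧ u₂ = -(κ • u₁) := by
    intro h0
    obtain ⟨c, rfl⟩ := exists_smul_of_planeCross_eq_zero h₁ h0
    refine ⟨-c, ?_, by simp⟩
    by_contra! hc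
    exact h (SameRay.sameRay_nonneg_smul_right u₁ (by linarith))
  -- `m` points into the sector: `u₁ + u₂` in general, and any vector to the left of `u₁` if the
  -- rays are opposite.
  obtain ⟨m, hm1, hm2⟩ : ∃ m, 0 < planeCross u₁ m ∧ planeCross u₂ m < 0 := by
    rcases hc.eq_or_lt with h0 | h0
    · obtain ⟨κ, hκ, h2⟩ := hanti h0.symm
      obtain ⟨m, hm⟩ := exists_planeCross_pos h₁
      refine ⟨m, hm, ?_⟩
      have : planeCross u₂ m = -(κ * planeCross u₁ m) := by rw [h2]; simp [planeCross_apply]; ring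
      rw [this]; simpa using mul_pos hκ hm
    · refine ⟨u₁ + u₂, ?_, ?_⟩
      · rw [map_add, planeCross_self]; linarith
      · rw [map_add, planeCross_self, planeCross_comm]; linarith
  set S₁ : Set Plane := Metric.ball x ε ∩ ({y | planeCross u₁ x < planeCross u₁ y} ∩
    {y | planeCross u₂ y < planeCross u₂ x}) with hS₁
  set S₂ : Set Plane := (Metric.ball x ε ∩ {y | planeCross u₁ y < planeCross u₁ x}) ∪
    (Metric.ball x ε ∩ {y | planeCross u₂ x < planeCross u₂ y}) with hS₂
  have hp1 : IsPreconnected S₁ := ((convex_ball x ε).inter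
    ((convex_halfSpace_gt (planeCross u₁).toLinearMap.isLinear _).inter
      (convex_halfSpace_lt (planeCross u₂).toLinearMap.isLinear _))).isPreconnected
  have hp2 : IsPreconnected S₂ := by
    obtain ⟨z, hz⟩ : ∃ z, z ∈ Metric.ball x ε ∩ ({y | planeCross u₁ y < planeCross u₁ x} ∩
        {y | planeCross u₂ x < planeCross u₂ y}) := by
      by_contra! hne
      have : x ∈ closure (∅ : Set Plane) := by
        refine mem_closure_of_forall_add_smul (x := x) (m := -m) (by simpa using hε)
          fun τ hτ hd => ?_
        refine absurd ⟨hd, ?_, ?_⟩ (hne (x + τ • -m))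
        · simp only [mem_ofPred_eq, map_add, map_smul, map_neg, smul_eq_mul]
          nlinarith [mul_pos hτ hm1]
        · simp only [mem_ofPred_eq, map_add, map_smul, map_neg, smul_eq_mul]
          nlinarith [mul_pos_of_neg_of_neg (neg_lt_zero.2 hτ) hm2]
      simp at this
    exact IsPreconnected.union z ⟨hz.1, hz.2.1⟩ ⟨hz.1, hz.2.2⟩
      ((convex_ball x ε).inter (convex_halfSpace_lt (planeCross u₁).toLinearMap.isLinear _)).isPreconnected
      ((convex_ball x ε).inter (convex_halfSpace_gt (planeCross u₂).toLinearMap.isLinear _)).isPreconnected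
  have hr1 : ∀ s : ℝ, 0 ≤ s → planeCross u₁ (x + s • u₁) = planeCross u₁ x ∧
      planeCross u₂ (x + s • u₁) ≤ planeCross u₂ x := by
    intro s hs
    simp only [map_add, map_smul, planeCross_self, planeCross_comm u₁ u₂, smul_eq_mul]
    exact ⟨by ring, by nlinarith [mul_nonneg hs hc]⟩
  have hr2 : ∀ s : ℝ, 0 ≤ s → planeCross u₂ (x + s • u₂) = planeCross u₂ x ∧
      planeCross u₁ x ≤ planeCross u₁ (x + s • u₂) := by
    intro s hs
    simp only [map_add, map_smul, planeCross_self, smul_eq_mul]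
    exact ⟨by ring, by nlinarith [mul_nonneg hs hc]⟩
  have hr : ∀ y ∈ twoRays x u₁ u₂, planeCross u₁ x ≤ planeCross u₁ y ∧ planeCross u₂ y ≤ planeCross u₂ x ∧
      (planeCross u₁ y = planeCross u₁ x ∨ planeCross u₂ y = planeCross u₂ x) := by
    rintro y (⟨s, hs, rfl⟩ | ⟨s, hs, rfl⟩)
    · exact ⟨(hr1 s hs).1.ge, (hr1 s hs).2, Or.inl (hr1 s hs).1⟩
    · exact ⟨(hr2 s hs).2, (hr2 s hs).1.le, Or.inr (hr2 s hs).1⟩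
  refine ⟨S₁, S₂, hp1, hp2, ?_, fun y hy hray => ⟨?_, ?_⟩⟩
  · ext y
    constructor
    · rintro (⟨hb, h1, h2⟩ | ⟨hb, h1⟩ | ⟨hb, h1⟩)
      all_goals refine ⟨hb, fun hray => ?_⟩
      all_goals obtain ⟨q1, q2, q3⟩ := hr y hray
      all_goals simp only [mem_ofPred_eq] at h1
      · simp only [mem_ofPred_eq] at h2
        rcases q3 with q3 | q3 <;> linarith
      · linarith
      · linarith
    · rintro ⟨hb, hray⟩
      by_contra hcon
      apply hray
      simp only [hS₁, hS₂, mem_union, mem_inter_iff, mem_ofPred_eq, not_or, not_and, not_lt] at hcon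
      obtain ⟨c1, c2, c3⟩ := hcon
      replace c1 := c1 hb
      replace c2 := c2 hb
      replace c3 := c3 hb
      have hxy : y = x + (y - x) := by abel
      rcases c2.eq_or_lt with c | c
      · obtain ⟨t, ht⟩ := exists_smul_of_planeCross_eq_zero h₁
          (show planeCross u₁ (y - x) = 0 by rw [map_sub]; linarith)
        rcases hc.eq_or_lt with h0 | h0
        · obtain ⟨κ, hκ, h2⟩ := hanti h0.symm
          rcases le_total 0 t with h' | h'
          · exact Or.inl ⟨t, h', by rw [← ht]; exact hxy⟩
          · refine Or.inr ⟨-t / κ, div_nonneg (by linarith) hκ.le, ?_⟩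
            have : (-t / κ) • u₂ = t • u₁ := by
              rw [h2, smul_neg, smul_smul, div_mul_cancel₀ _ hκ.ne', neg_smul, neg_neg]
            rw [this, ← ht]; exact hxy
        · refine Or.inl ⟨t, ?_, by rw [← ht]; exact hxy⟩
          have h3 : planeCross u₂ (y - x) ≤ 0 := by rw [map_sub]; linarith
          rw [ht, map_smul, planeCross_comm, smul_eq_mul] at h3
          by_contra! hneg
          nlinarith [mul_pos_of_neg_of_neg hneg (neg_lt_zero.2 h0)]
      · have c4 := c1 c
        obtain ⟨t, ht⟩ := exists_smul_of_planeCross_eq_zero h₂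
          (show planeCross u₂ (y - x) = 0 by rw [map_sub]; linarith)
        refine Or.inr ⟨t, ?_, by rw [← ht]; exact hxy⟩
        have h3 : 0 < planeCross u₁ (y - x) := by rw [map_sub]; linarith
        rw [ht, map_smul, smul_eq_mul] at h3
        by_contra! hneg
        nlinarith [mul_nonneg_of_nonpos_of_nonpos hneg.le (neg_nonpos.2 hc)]
  · obtain ⟨q1, q2, -⟩ := hr y hray
    refine mem_closure_of_forall_add_smul (m := m) hy fun τ hτ hd => ⟨hd, ?_, ?_⟩
    · simp only [mem_ofPred_eq, map_add, map_smul, smul_eq_mul]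
      nlinarith [mul_pos hτ hm1]
    · simp only [mem_ofPred_eq, map_add, map_smul, smul_eq_mul]
      nlinarith [mul_pos hτ (neg_pos.2 hm2)]
  · obtain ⟨q1, q2, q3 | q3⟩ := hr y hray
    · refine mem_closure_of_forall_add_smul (m := -m) hy fun τ hτ hd => Or.inl ⟨hd, ?_⟩
      simp only [mem_ofPred_eq, map_add, map_smul, smul_eq_mul, map_neg]
      nlinarith [mul_pos hτ hm1]
    · refine mem_closure_of_forall_add_smul (m := -m) hy fun τ hτ hd => Or.inr ⟨hd, ?_⟩
      simp only [mem_ofPred_eq, map_add, map_smul, smul_eq_mul, map_neg]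
      nlinarith [mul_pos hτ (neg_pos.2 hm2)]

/-- A line through `x` cuts the ball into two half-discs. Each stays connected when the punctured
line `R` in its closure is added, and the two enlarged sets share `R`. -/
theorem isPreconnected_ball_diff_singleton (x : Plane) {ε : ℝ} (hε : 0 < ε) :
    IsPreconnected (Metric.ball x ε \ {x}) := by
  obtain ⟨u, hu⟩ : ∃ u : Plane, u ≠ 0 := exists_ne 0
  have hns : ¬ SameRay ℝ u (-u) := fun h => hu (eq_zero_of_sameRay_self_neg h)
  obtain ⟨S₁, S₂, h1, h2, hS, hcl⟩ := exists_sectors hu (neg_ne_zero.2 hu) hns x hε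
  set R : Set Plane := (Metric.ball x ε ∩ twoRays x u (-u)) \ {x} with hR
  have hx : x ∈ twoRays x u (-u) := Or.inl ⟨0, le_rfl, by simp⟩
  have hxS : x ∉ S₁ ∪ S₂ := by rw [hS]; exact fun h => h.2 hx
  have hW1 : IsPreconnected (S₁ ∪ R) := h1.subset_closure subset_union_left
    (union_subset subset_closure fun y hy => (hcl y hy.1.1 hy.1.2).1)
  have hW2 : IsPreconnected (S₂ ∪ R) := h2.subset_closure subset_union_left
    (union_subset subset_closure fun y hy => (hcl y hy.1.1 hy.1.2).2)
  have hpos : 0 < ε / 2 / ‖u‖ := by have := norm_pos_iff.2 hu; positivity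
  have hz : x + (ε / 2 / ‖u‖) • u ∈ R := by
    refine ⟨⟨?_, Or.inl ⟨_, hpos.le, rfl⟩⟩, ?_⟩
    · rw [Metric.mem_ball, dist_eq_norm, add_sub_cancel_left, norm_smul, Real.norm_of_nonneg hpos.le,
        div_mul_cancel₀ _ (norm_ne_zero_iff.2 hu)]
      linarith
    · rw [mem_singleton_iff, add_eq_left, smul_eq_zero, not_or]
      exact ⟨hpos.ne', hu⟩
  have hU : Metric.ball x ε \ {x} = (S₁ ∪ R) ∪ (S₂ ∪ R) := by
    ext y
    constructor
    · rintro ⟨hy, hyx⟩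
      by_cases hray : y ∈ twoRays x u (-u)
      · exact Or.inl (Or.inr ⟨⟨hy, hray⟩, hyx⟩)
      · have : y ∈ S₁ ∪ S₂ := by rw [hS]; exact ⟨hy, hray⟩
        exact this.imp Or.inl Or.inl
    · intro hy
      have hsub : S₁ ∪ S₂ ⊆ Metric.ball x ε := by rw [hS]; exact sdiff_subset
      rcases hy with (hy | hy) | (hy | hy)
      · exact ⟨hsub (Or.inl hy), fun h => hxS (Or.inl (h ▸ hy))⟩
      · exact ⟨hy.1.1, hy.2⟩
      · exact ⟨hsub (Or.inr hy), fun h => hxS (Or.inr (h ▸ hy))⟩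
      · exact ⟨hy.1.1, hy.2⟩
  rw [hU]
  exact IsPreconnected.union _ (Or.inr hz) (Or.inr hz) hW1 hW2

/-! ### The region of a simple polygon -/

namespace SimplePolygon

variable (Q : SimplePolygon)

theorem subset_region_of_isPreconnected {S : Set Plane} (hS : IsPreconnected S)
    (hd : Disjoint S Q.bd) {x : Plane} (hx : x ∈ S) (hxr : x ∈ Q.region) : S ⊆ Q.region := by
  intro y hy
  have hSc : S ⊆ Q.bdᶜ := disjoint_left.1 hd
  rcases hxr with h | h
  · exact absurd h (hSc hx)
  · right
    refine ⟨hSc hy, ?_⟩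
    have : y ∈ connectedComponentIn Q.bdᶜ x := hS.subset_connectedComponentIn hx hSc hy
    rw [← connectedComponentIn_eq this]
    exact h.2

theorem mem_interior_region {x : Plane} (hx : x ∈ Q.region) (hxb : x ∉ Q.bd) :
    x ∈ interior Q.region := by
  have hop : IsOpen (connectedComponentIn Q.bdᶜ x) := Q.isOpen_compl_bd.connectedComponentIn
  refine mem_interior.2 ⟨_, ?_, hop, mem_connectedComponentIn hxb⟩
  exact Q.subset_region_of_isPreconnected isPreconnected_connectedComponentIn
    (disjoint_left.2 fun y hy => connectedComponentIn_subset _ _ hy)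
    (mem_connectedComponentIn hxb) hx

theorem isClosed_region : IsClosed Q.region := by
  rw [← isOpen_compl_iff, isOpen_iff_forall_mem_open]
  intro x hx
  have hxb : x ∉ Q.bd := fun h => hx (Q.bd_subset_region h)
  refine ⟨connectedComponentIn Q.bdᶜ x, fun y hy hyr => hx ?_,
    Q.isOpen_compl_bd.connectedComponentIn, mem_connectedComponentIn hxb⟩
  exact Q.subset_region_of_isPreconnected isPreconnected_connectedComponentIn
    (disjoint_left.2 fun y hy => connectedComponentIn_subset _ _ hy) hy hyr
    (mem_connectedComponentIn hxb)

/-- Points that a half-plane separates from the boundary lie outside the region. -/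
theorem notMem_region_of_halfSpace (f : Plane →L[ℝ] ℝ) {c : ℝ} (hf : ∀ y ∈ Q.bd, f y ≤ c)
    {x : Plane} (hx : c < f x) : x ∉ Q.region := by
  have hxb : x ∉ Q.bd := fun h => absurd (hf x h) (not_le.2 hx)
  rintro (h | h)
  · exact hxb h
  · have hH : IsPreconnected {y | c < f y} :=
      (convex_halfSpace_gt f.toLinearMap.isLinear c).isPreconnected
    have hsub := hH.subset_connectedComponentIn (F := Q.bdᶜ) hx
      fun y hy hyb => absurd (hf y hyb) (not_le.2 hy)
    have hb := h.2.subset hsub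
    obtain ⟨k⟩ : Nonempty (Fin Q.n) := ⟨⟨0, by have := Q.three_le; omega⟩⟩
    set w := x - Q.poly k with hw
    have hfw : 0 < f w := by
      have := hf _ (Q.vertex_mem_bd k)
      rw [hw, map_sub]; linarith
    have hw0 : 0 < ‖w‖ := norm_pos_iff.2 (by intro h0; rw [h0] at hfw; simp at hfw)
    obtain ⟨R, hR⟩ := hb.exists_norm_le
    -- A translation by a vector of length |R| + 1 + ‖x‖ takes `x` out of the ball of radius `R`
    -- that should contain the half-plane.
    have hmem : x + ((|R| + 1 + ‖x‖) / ‖w‖) • w ∈ {y | c < f y} := by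
      simp only [mem_ofPred_eq, map_add, map_smul, smul_eq_mul]
      have : 0 < (|R| + 1 + ‖x‖) / ‖w‖ * f w := by positivity
      linarith
    have h1 := hR _ hmem
    have h2 : ‖((|R| + 1 + ‖x‖) / ‖w‖) • w‖ = |R| + 1 + ‖x‖ := by
      rw [norm_smul, Real.norm_of_nonneg (by positivity), div_mul_cancel₀ _ hw0.ne']
    have h3 := norm_sub_le (x + ((|R| + 1 + ‖x‖) / ‖w‖) • w) x
    rw [add_sub_cancel_left, h2] at h3
    have := le_abs_self R
    linarith

theorem isPreconnected_bd : IsPreconnected Q.bd := by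
  have hn : NeZero Q.n := ⟨by have := Q.three_le; omega⟩
  refine IsPreconnected.iUnion_of_reflTransGen (fun k => ?_) ?_
  · rw [edgeSet_eq_segment]; exact (convex_segment _ _).isPreconnected
  · have hstep : ∀ k : Fin Q.n, (Q.poly.edgeSet ℝ k ∩ Q.poly.edgeSet ℝ (finRotate Q.n k)).Nonempty :=
      fun k => ⟨_, Q.right_mem_edgeSet k, Q.left_mem_edgeSet _⟩
    have hs : Std.Symm (fun i j : Fin Q.n => (Q.poly.edgeSet ℝ i ∩ Q.poly.edgeSet ℝ j).Nonempty) :=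
      ⟨fun i j h => by rwa [inter_comm]⟩
    have h0 : ∀ m : ℕ, ∀ hm : m < Q.n, Relation.ReflTransGen
        (fun i j : Fin Q.n => (Q.poly.edgeSet ℝ i ∩ Q.poly.edgeSet ℝ j).Nonempty) 0 ⟨m, hm⟩ := by
      intro m
      induction m with
      | zero => intro hm; exact Relation.ReflTransGen.refl
      | succ m ih =>
        intro hm
        refine (ih (by omega)).tail ?_
        have := hstep ⟨m, by omega⟩
        convert this using 2
        rw [finRotate_apply]
        congr 1
        rw [Fin.ext_iff, Fin.val_add, Fin.val_one', Nat.add_mod_mod, Nat.mod_eq_of_lt hm]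
    intro i j
    refine Relation.ReflTransGen.trans ?_ (h0 j.1 j.2)
    have := h0 i.1 i.2
    exact Std.Symm.symm _ _ this

/-- Every boundary point of a simple polygon is a limit of exterior points. -/
theorem bd_subset_closure_compl_region : Q.bd ⊆ closure Q.regionᶜ := by
  have hne : (Q.regionᶜ).Nonempty := by
    obtain ⟨u, hu⟩ : ∃ u : Plane, u ≠ 0 := exists_ne 0
    obtain ⟨m, hm⟩ := exists_planeCross_pos hu
    obtain ⟨c, hc⟩ := (Q.isCompact_bd.image (planeCross u).continuous).bddAbove
    refine ⟨((c + 1) / planeCross u m) • m, Q.notMem_region_of_halfSpace (planeCross u) (c := c)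
      (fun y hy => hc (mem_image_of_mem _ hy)) ?_⟩
    rw [map_smul, smul_eq_mul, div_mul_cancel₀ _ hm.ne']
    linarith
  have hU : IsOpen Q.regionᶜ := Q.isClosed_region.isOpen_compl
  have hcl : ∀ y ∈ closure Q.regionᶜ, y ∉ Q.bd → y ∈ Q.regionᶜ := by
    intro y hy hyb hyr
    rw [closure_compl] at hy
    exact hy (Q.mem_interior_region hyr hyb)
  -- Otherwise the exterior would be clopen and nonempty, hence the whole plane.
  obtain ⟨x₀, hx₀, hx₀b⟩ : ∃ x, x ∈ closure Q.regionᶜ ∧ x ∈ Q.bd := by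
    by_contra! h
    have hclopen : IsClopen Q.regionᶜ :=
      ⟨closure_subset_iff_isClosed.1 fun y hy => hcl y hy (h y hy), hU⟩
    have := hclopen.eq_univ hne
    have h0 := Q.bd_subset_region (Q.vertex_mem_bd ⟨0, by have := Q.three_le; omega⟩)
    exact (this ▸ mem_univ _ : Q.poly _ ∈ Q.regionᶜ) h0
  -- Each of the two sectors at `x` lies inside the region or outside it. One that lies outside has
  -- all boundary points near `x` in its closure. So being a limit of exterior points is locally
  -- constant on the boundary, which is connected.
  have hloc : ∀ x ∈ Q.bd, x ∈ closure Q.regionᶜ → ∀ᶠ y in nhdsWithin x Q.bd, y ∈ closure Q.regionᶜ := by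
    intro x hx hxc
    obtain ⟨u₁, u₂, h1, h2, hns, ε, hε, hray⟩ := Q.exists_rays hx
    obtain ⟨S₁, S₂, hp1, hp2, hS, hcl⟩ := exists_sectors h1 h2 hns x hε
    have hdis : ∀ z ∈ S₁ ∪ S₂, z ∈ Metric.ball x ε ∧ z ∉ Q.bd := by
      intro z hz
      rw [hS] at hz
      exact ⟨hz.1, fun h => hz.2 ((hray z hz.1).1 h)⟩
    obtain ⟨z, hzb, hzU⟩ := mem_closure_iff.1 hxc _ Metric.isOpen_ball (Metric.mem_ball_self hε)
    have hzS : z ∈ S₁ ∪ S₂ := by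
      rw [hS]
      exact ⟨hzb, fun h => hzU (Q.bd_subset_region ((hray z hzb).2 h))⟩
    have hsub : S₁ ⊆ Q.regionᶜ ∨ S₂ ⊆ Q.regionᶜ := by
      rcases hzS with hz | hz
      · exact Or.inl fun w hw hwr => hzU (Q.subset_region_of_isPreconnected hp1
          (disjoint_left.2 fun v hv => (hdis v (Or.inl hv)).2) hw hwr hz)
      · exact Or.inr fun w hw hwr => hzU (Q.subset_region_of_isPreconnected hp2
          (disjoint_left.2 fun v hv => (hdis v (Or.inr hv)).2) hw hwr hz)
    filter_upwards [mem_nhdsWithin_of_mem_nhds (Metric.ball_mem_nhds x hε), self_mem_nhdsWithin]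
      with y hy hyb
    have := hcl y hy ((hray y hy).1 hyb)
    exact hsub.elim (fun h => closure_mono h this.1) (fun h => closure_mono h this.2)
  intro x hx
  refine (Q.isPreconnected_bd.induction₂'
    (fun x y => x ∈ closure Q.regionᶜ ↔ y ∈ closure Q.regionᶜ) ?_ ?_ hx₀b hx).1 hx₀
  · intro x hx
    by_cases hxc : x ∈ closure Q.regionᶜ
    · filter_upwards [hloc x hx hxc] with y hy using ⟨iff_of_true hxc hy, iff_of_true hy hxc⟩
    · filter_upwards [mem_nhdsWithin_of_mem_nhds (isClosed_closure.isOpen_compl.mem_nhds hxc)]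
        with y (hy : y ∉ closure _) using ⟨iff_of_false hxc hy, iff_of_false hy hxc⟩
  · intro x y z _ _ _ h1 h2
    exact h1.trans h2

theorem notMem_interior_region_of_mem_bd {x : Plane} (hx : x ∈ Q.bd) : x ∉ interior Q.region := by
  have := Q.bd_subset_closure_compl_region hx
  rwa [closure_compl] at this

theorem mem_interior_region_iff {x : Plane} : x ∈ interior Q.region ↔ x ∈ Q.region ∧ x ∉ Q.bd :=
  ⟨fun h => ⟨interior_subset h, fun hb => Q.notMem_interior_region_of_mem_bd hb h⟩,
    fun h => Q.mem_interior_region h.1 h.2⟩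

/-- Near each point of a simple polygon, the interior, with this point removed, is connected. -/
theorem exists_isPreconnected_interior {x : Plane} (hx : x ∈ Q.region) :
    ∃ ε₀ > 0, ∀ ε, 0 < ε → ε ≤ ε₀ →
      IsPreconnected ((interior Q.region ∩ Metric.ball x ε) \ {x}) := by
  by_cases hxb : x ∈ Q.bd
  · obtain ⟨u₁, u₂, h1, h2, hns, ε₀, hε₀, hray⟩ := Q.exists_rays hxb
    refine ⟨ε₀, hε₀, fun ε hε hle => ?_⟩
    obtain ⟨S₁, S₂, hp1, hp2, hS, hcl⟩ := exists_sectors h1 h2 hns x hε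
    have hdis : ∀ z ∈ S₁ ∪ S₂, z ∈ Metric.ball x ε ∧ z ∉ Q.bd := by
      intro z hz
      rw [hS] at hz
      exact ⟨hz.1, fun h => hz.2 ((hray z (lt_of_lt_of_le hz.1 hle)).1 h)⟩
    have hxr : x ∈ twoRays x u₁ u₂ := Or.inl ⟨0, le_rfl, by simp⟩
    have hxS : x ∉ S₁ ∪ S₂ := by rw [hS]; exact fun h => h.2 hxr
    have heq : (interior Q.region ∩ Metric.ball x ε) \ {x} = (S₁ ∪ S₂) ∩ Q.region := by
      ext y
      constructor
      · rintro ⟨⟨hy, hyb⟩, -⟩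
        rw [mem_interior_region_iff] at hy
        refine ⟨?_, hy.1⟩
        rw [hS]
        exact ⟨hyb, fun h => hy.2 ((hray y (lt_of_lt_of_le hyb hle)).2 h)⟩
      · rintro ⟨hy, hyr⟩
        exact ⟨⟨Q.mem_interior_region hyr (hdis y hy).2, (hdis y hy).1⟩,
          fun h => hxS ((h : y = x) ▸ hy)⟩
    have hd1 : Disjoint S₁ Q.bd := disjoint_left.2 fun v hv => (hdis v (Or.inl hv)).2
    have hd2 : Disjoint S₂ Q.bd := disjoint_left.2 fun v hv => (hdis v (Or.inr hv)).2
    -- Each sector lies inside or outside the region as a whole. They are not both inside, because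
    -- `x` is a limit of exterior points; hence at most one sector remains.
    have hone : ∀ S, IsPreconnected S → Disjoint S Q.bd → S ∩ Q.region = S ∨ S ∩ Q.region = ∅ := by
      intro S hS hd
      by_cases h : (S ∩ Q.region).Nonempty
      · obtain ⟨z, hz, hzr⟩ := h
        exact Or.inl (inter_eq_left.2 (Q.subset_region_of_isPreconnected hS hd hz hzr))
      · exact Or.inr (not_nonempty_iff_eq_empty.1 h)
    rw [heq, union_inter_distrib_right]
    rcases hone S₁ hp1 hd1 with e1 | e1
    · rcases hone S₂ hp2 hd2 with e2 | e2
      · exfalso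
        obtain ⟨z, hzb, hzU⟩ := mem_closure_iff.1 (Q.bd_subset_closure_compl_region hxb) _
          Metric.isOpen_ball (Metric.mem_ball_self hε)
        have hzS : z ∈ S₁ ∪ S₂ := by
          rw [hS]
          exact ⟨hzb, fun h => hzU (Q.bd_subset_region ((hray z (lt_of_lt_of_le hzb hle)).2 h))⟩
        exact hzU (hzS.elim (fun h => inter_eq_left.1 e1 h) (fun h => inter_eq_left.1 e2 h))
      · rwa [e1, e2, union_empty]
    · rcases hone S₂ hp2 hd2 with e2 | e2
      · rwa [e1, e2, empty_union]
      · rw [e1, e2, empty_union]; exact isPreconnected_empty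
  · have hint := Q.mem_interior_region hx hxb
    obtain ⟨ε₀, hε₀, hsub⟩ := Metric.isOpen_iff.1 isOpen_interior x hint
    refine ⟨ε₀, hε₀, fun ε hε hle => ?_⟩
    rw [inter_eq_right.2 ((Metric.ball_subset_ball hle).trans hsub)]
    exact isPreconnected_ball_diff_singleton x hε

end SimplePolygon

/-! ### Triangles -/

namespace SimplePolygon

variable (Q : SimplePolygon)

/-- Of three collinear points one lies between the other two, which here puts a vertex on the edge
opposite to it. -/
theorem not_collinear_of_three (poly : Polygon Plane 3)
    (h : ∀ m k : Fin 3, poly m ∈ poly.edgeSet ℝ k → m = k ∨ m = finRotate 3 k) :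
    ¬ Collinear ℝ (range poly.vertices) := by
  intro hc
  have hr : range poly.vertices = {poly 0, poly 1, poly 2} := by
    ext x; simp [Fin.exists_fin_succ, eq_comm]
  rw [hr] at hc
  rcases hc.wbtw_or_wbtw_or_wbtw with hw | hw | hw
  · have := h 1 2 hw.symm
    revert this; decide
  · have := h 2 0 hw.symm
    revert this; decide
  · have := h 0 1 hw.symm
    revert this; decide

/-- The region is the convex hull `H` of the vertices. A point outside `H` lies in a half-plane that
avoids the boundary and is unbounded. A point of `H` off the boundary has positive barycentric
coordinates, so it is interior to `H`, and its component in the complement of the boundary cannot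
leave the bounded set `interior H`. -/
theorem convex_region_of_triangle (h3 : Q.n = 3) :
    Convex ℝ Q.region ∧ (interior Q.region).Nonempty := by
  have key : ∃ H : Set Plane, Convex ℝ H ∧ IsCompact H ∧ (interior H).Nonempty ∧ Q.bd ⊆ H ∧
      ∀ x ∈ H, x ∉ Q.bd → x ∈ interior H := by
    have hv := fun m k => Q.vertex_mem_edgeSet (m := m) (k := k)
    revert hv
    unfold bd
    generalize Q.poly = poly
    revert poly
    rw [h3]
    intro poly hv
    have hind : AffineIndependent ℝ poly.vertices :=
      affineIndependent_iff_not_collinear.2 (not_collinear_of_three poly hv)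
    have htop : affineSpan ℝ (range poly.vertices) = ⊤ := by
      rw [hind.affineSpan_eq_top_iff_card_eq_finrank_add_one]; simp
    let b : AffineBasis (Fin 3) ℝ Plane := ⟨poly.vertices, hind, htop⟩
    have hb : ∀ i, b i = poly i := fun i => rfl
    have hrange : range b = range poly.vertices := rfl
    refine ⟨convexHull ℝ (range b), convex_convexHull ℝ _,
      (finite_range _).isCompact_convexHull ℝ, ⟨_, b.centroid_mem_interior_convexHull⟩, ?_, ?_⟩
    · refine iUnion_subset fun k => ?_
      rw [Polygon.edgeSet, affineSegment_eq_segment]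
      exact segment_subset_convexHull ⟨k, rfl⟩ ⟨_, rfl⟩
    · intro x hx hxb
      rw [b.interior_convexHull]
      rw [b.convexHull_eq_nonneg_coord] at hx
      intro i
      refine lt_of_le_of_ne (hx i) fun h0 => hxb ?_
      have hs := b.linear_combination_coord_eq_self x
      have h1 := b.sum_coord_apply_eq_one x
      rw [Fin.sum_univ_three] at hs h1
      simp only [hb] at hs
      -- If the coordinate with index `i` vanishes, the point is on the edge opposite to the vertex
      -- `i`, which is the edge that starts at the next vertex.
      refine mem_iUnion.2 ⟨finRotate 3 i, ?_⟩
      rw [Polygon.edgeSet, affineSegment_eq_segment]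
      have hc := fun i => (hx i)
      fin_cases i
      · refine ⟨b.coord 1 x, b.coord 2 x, hc 1, hc 2, ?_, ?_⟩
        · simp at h0; linarith
        · simp at h0; rw [← h0] at hs; simpa using hs
      · refine ⟨b.coord 2 x, b.coord 0 x, hc 2, hc 0, ?_, ?_⟩
        · simp at h0; linarith
        · simp at h0; rw [← h0] at hs; simpa [add_comm] using hs
      · refine ⟨b.coord 0 x, b.coord 1 x, hc 0, hc 1, ?_, ?_⟩
        · simp at h0; linarith
        · simp at h0; rw [← h0] at hs; simpa using hs
  obtain ⟨H, hconv, hcomp, hne, hbH, hint⟩ := key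
  have hH : Q.region = H := by
    apply Subset.antisymm
    · intro x hx
      by_contra hxH
      obtain ⟨f, c, hf, hc⟩ := geometric_hahn_banach_closed_point hconv hcomp.isClosed hxH
      exact Q.notMem_region_of_halfSpace f (fun y hy => (hf y (hbH hy)).le) hc hx
    · intro x hx
      by_cases hxb : x ∈ Q.bd
      · exact Or.inl hxb
      · refine Or.inr ⟨hxb, (hcomp.isBounded.subset interior_subset).subset ?_⟩
        refine isPreconnected_connectedComponentIn.subset_left_of_subset_union isOpen_interior
          hcomp.isClosed.isOpen_compl (disjoint_left.2 fun y hy hy' => hy' (interior_subset hy))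
          (fun y hy => ?_) ⟨x, mem_connectedComponentIn hxb, hint x hx hxb⟩
        by_cases hyH : y ∈ H
        · exact Or.inl (hint y hyH (connectedComponentIn_subset _ _ hy))
        · exact Or.inr hyH
  rw [hH]
  exact ⟨hconv, hne⟩

theorem closure_interior_region_of_triangle (h3 : Q.n = 3) :
    closure (interior Q.region) = Q.region := by
  obtain ⟨hc, hne⟩ := Q.convex_region_of_triangle h3
  rw [hc.closure_interior_eq_closure_of_nonempty_interior hne, Q.isClosed_region.closure_eq]

end SimplePolygon

/-! ### Linear functionals on the plane and collinear segments -/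

theorem eq_zero_of_planeCross_ne_zero (f : Plane →L[ℝ] ℝ) {u w : Plane} (hu : f u = 0)
    (hw : f w = 0) (h : planeCross w u ≠ 0) : f = 0 := by
  have hdec : ∀ y : Plane, f y = y 0 * f (EuclideanSpace.single 0 1) +
      y 1 * f (EuclideanSpace.single 1 1) := by
    intro y
    have : y = y 0 • EuclideanSpace.single 0 (1 : ℝ) + y 1 • EuclideanSpace.single 1 (1 : ℝ) := by
      ext i; fin_cases i <;> simp
    conv_lhs => rw [this]
    simp
  rw [hdec] at hu hw
  rw [planeCross_apply] at h
  have h0 : f (EuclideanSpace.single 0 1) = 0 := by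
    apply (mul_eq_zero.1 _).resolve_left h
    linear_combination -w 1 * hu + u 1 * hw
  have h1 : f (EuclideanSpace.single 1 1) = 0 := by
    apply (mul_eq_zero.1 _).resolve_left h
    linear_combination w 0 * hu - u 0 * hw
  ext y
  rw [hdec, h0, h1]; simp

/-- Two collinear segments with endpoints in `V` whose relative interiors meet but avoid `V`
have the same endpoints. -/
theorem endpoints_eq_of_openSegment_inter {V : Set Plane} {a b c e y : Plane} (hab : a ≠ b)
    (ha : a ∈ V) (hb : b ∈ V) (hc : c ∈ V) (he : e ∈ V) (h1 : Disjoint (openSegment ℝ a b) V)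
    (h2 : Disjoint (openSegment ℝ c e) V) (hy : y ∈ openSegment ℝ a b)
    (hy' : y ∈ openSegment ℝ c e)
    (hcl : ∃ p : ℝ, c = AffineMap.lineMap a b p) (hel : ∃ q : ℝ, e = AffineMap.lineMap a b q) :
    (a = c ∧ b = e) ∨ (a = e ∧ b = c) := by
  obtain ⟨p, hp⟩ := hcl
  obtain ⟨q, hq⟩ := hel
  have hinj := AffineMap.lineMap_injective ℝ hab
  have h01 : openSegment ℝ a b = AffineMap.lineMap a b '' Ioo (0 : ℝ) 1 :=
    openSegment_eq_image_lineMap ℝ a b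
  rw [h01] at hy
  obtain ⟨t, ht, hty⟩ := hy
  have hce : ∀ p q : ℝ, openSegment ℝ (AffineMap.lineMap a b p) (AffineMap.lineMap a b q) =
      AffineMap.lineMap a b '' openSegment ℝ p q := fun p q => by rw [image_openSegment]
  wlog hpq : p ≤ q generalizing c e p q
  · rcases this he hc (by rwa [openSegment_symm]) (by rwa [openSegment_symm]) q hq p hp
      (le_of_not_ge hpq) with h | h
    · exact Or.inr h
    · exact Or.inl h
  left
  subst hp hq
  rw [hce] at h2 hy'
  rcases hpq.eq_or_lt with rfl | hpq
  · exfalso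
    rw [openSegment_same, image_singleton] at h2
    exact disjoint_left.1 h2 rfl hc
  rw [openSegment_eq_Ioo hpq] at h2 hy'
  obtain ⟨t', ht', hty'⟩ := hy'
  obtain rfl : t' = t := hinj (hty'.trans hty.symm)
  -- On the line parametrized by `a`, `b`, the value `p < 0` would put `a` inside the second
  -- segment, and `p > 0` would put `c` inside the first one. The common point `t` provides the
  -- other inequality in each case.
  have hp0 : p = 0 := by
    rcases lt_trichotomy p 0 with h | h | h
    · exact absurd ha (disjoint_left.1 h2 ⟨0, ⟨h, ht.1.trans ht'.2⟩, by simp⟩)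
    · exact h
    · exact absurd hc (disjoint_left.1 h1 (h01 ▸ ⟨p, ⟨h, ht'.1.trans ht.2⟩, rfl⟩))
  have hq1 : q = 1 := by
    rcases lt_trichotomy q 1 with h | h | h
    · exact absurd he (disjoint_left.1 h1 (h01 ▸ ⟨q, ⟨ht.1.trans ht'.2, h⟩, rfl⟩))
    · exact h
    · exact absurd hb (disjoint_left.1 h2 ⟨1, ⟨ht'.1.trans ht.2, h⟩, by simp⟩)
  subst hp0 hq1
  simp

/-! ### Directed edges and the points on them -/

namespace DirectedEdge

variable {N : ℕ} {F : Fin N → SimplePolygon}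

@[simp] theorem reverse_src (d : DirectedEdge F) : d.reverse.src = d.tgt := by
  obtain ⟨i, k, b⟩ := d; cases b <;> rfl

@[simp] theorem reverse_tgt (d : DirectedEdge F) : d.reverse.tgt = d.src := by
  obtain ⟨i, k, b⟩ := d; cases b <;> rfl

theorem eq_or_eq_reverse {d e : DirectedEdge F} (h : d.edge = e.edge) : d = e ∨ d = e.reverse := by
  obtain ⟨i, k, b⟩ := d
  obtain ⟨j, l, c⟩ := e
  simp only [edge, Sigma.mk.injEq] at h
  obtain ⟨rfl, h⟩ := h
  obtain rfl := eq_of_heq h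
  cases b <;> cases c <;> simp [reverse]

theorem src_mem_range (d : DirectedEdge F) : d.src ∈ range (F d.frag).poly.vertices := by
  unfold src; split_ifs
  · exact ⟨_, rfl⟩
  · exact ⟨_, rfl⟩

theorem tgt_mem_range (d : DirectedEdge F) : d.tgt ∈ range (F d.frag).poly.vertices := by
  rw [← reverse_src]; exact d.reverse.src_mem_range

theorem src_ne_tgt (d : DirectedEdge F) : d.src ≠ d.tgt := by
  unfold src tgt; split_ifs
  · exact ((F d.frag).vertex_ne_next d.index).symm
  · exact (F d.frag).vertex_ne_next d.index

theorem segment_eq_edgeSet (d : DirectedEdge F) :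
    segment ℝ d.src d.tgt = (F d.frag).poly.edgeSet ℝ d.index := by
  rw [SimplePolygon.edgeSet_eq_segment]
  unfold src tgt; split_ifs
  · rw [segment_symm]
  · rfl

theorem segment_subset_bd (d : DirectedEdge F) : segment ℝ d.src d.tgt ⊆ (F d.frag).bd := by
  rw [segment_eq_edgeSet]; exact (F d.frag).edgeSet_subset_bd _

theorem eq_src_or_eq_tgt {d : DirectedEdge F} {x : Plane} (hx : x ∈ segment ℝ d.src d.tgt)
    (hv : x ∈ range (F d.frag).poly.vertices) : x = d.src ∨ x = d.tgt := by
  rw [segment_eq_edgeSet] at hx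
  obtain ⟨m, rfl⟩ := hv
  unfold src tgt
  rcases (F d.frag).vertex_mem_edgeSet hx with h | h <;> split_ifs <;> simp [← h]

/-- Two edges of a polygon that share a point which is not a vertex agree. -/
theorem edge_eq_of_mem {d e : DirectedEdge F} (hf : d.frag = e.frag) {x : Plane}
    (hd : x ∈ segment ℝ d.src d.tgt) (he : x ∈ segment ℝ e.src e.tgt)
    (hv : x ∉ range (F d.frag).poly.vertices) : d.edge = e.edge := by
  rw [segment_eq_edgeSet] at hd he
  obtain ⟨i, k, b⟩ := d
  obtain ⟨j, l, c⟩ := e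
  obtain rfl : i = j := hf
  by_contra h
  have hkl : k ≠ l := by rintro rfl; exact h rfl
  exact hv ((F i).mem_range_of_mem_edgeSet hkl hd he)

theorem exists_of_mem_bd {i : Fin N} {x : Plane} (hx : x ∈ (F i).bd) :
    ∃ d : DirectedEdge F, d.frag = i ∧ x ∈ segment ℝ d.src d.tgt := by
  obtain ⟨k, hk⟩ := mem_iUnion.1 hx
  exact ⟨⟨i, k, false⟩, rfl, by rw [segment_eq_edgeSet]; exact hk⟩

instance : Finite (DirectedEdge F) := by
  refine Finite.of_injective (fun d => ((⟨d.frag, d.index⟩ : Σ i, Fin (F i).n), d.reversed)) ?_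
  rintro ⟨i, k, b⟩ ⟨j, l, c⟩ h
  simp only [Prod.mk.injEq, Sigma.mk.injEq] at h
  obtain ⟨⟨rfl, h⟩, rfl⟩ := h
  obtain rfl := eq_of_heq h
  rfl

end DirectedEdge

/-! ### The triangles of a fragment and the chords between them -/

namespace Portalgon

/-- The point of the surface represented by the point `x` of the fragment `i`. -/
def pt (P : Portalgon) (i : Fin P.N) (x : Plane) (hx : x ∈ (P.fragment i).region) : P.Surface :=
  P.proj ⟨i, x, hx⟩

theorem lineMap_mem_region (P : Portalgon) (d : P.DEdge) {t : ℝ} (ht : t ∈ Icc (0 : ℝ) 1) :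
    AffineMap.lineMap d.src d.tgt t ∈ (P.fragment d.frag).region := by
  apply SimplePolygon.bd_subset_region
  apply d.segment_subset_bd
  rw [segment_eq_image_lineMap]
  exact ⟨t, ht, rfl⟩

theorem pt_eq_of_glued (P : Portalgon) {d e : P.DEdge} (h : P.Glued d e) {t : ℝ}
    (ht : t ∈ Icc (0 : ℝ) 1) :
    P.pt d.frag (AffineMap.lineMap d.src d.tgt t) (P.lineMap_mem_region d ht) =
      P.pt e.frag (AffineMap.lineMap e.src e.tgt t) (P.lineMap_mem_region e ht) := by
  apply Quot.sound
  rcases h with h | h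
  · exact ⟨d, e, h, t, ht, ⟨rfl, rfl⟩, ⟨rfl, rfl⟩⟩
  · refine ⟨_, _, h, 1 - t, ⟨by linarith [ht.2], by linarith [ht.1]⟩, ⟨rfl, ?_⟩, ⟨rfl, ?_⟩⟩
    · simp [AffineMap.lineMap_apply_one_sub]
    · simp [AffineMap.lineMap_apply_one_sub]

theorem pt_congr (P : Portalgon) {i j : Fin P.N} {x y : Plane} (hij : i = j) (hxy : x = y)
    (hx : x ∈ (P.fragment i).region) (hy : y ∈ (P.fragment j).region) :
    P.pt i x hx = P.pt j y hy := by
  subst hij hxy; rfl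

theorem corresponding_symm (P : Portalgon) {x y : P.Points} (h : P.Corresponding x y) :
    P.Corresponding y x := by
  obtain ⟨d, e, hde, t, ht, hx, hy⟩ := h
  exact ⟨e, d, by rwa [Sym2.eq_swap], t, ht, hy, hx⟩

namespace IsTriangulationVia

variable {P P' : Portalgon} {parent : Fin P'.N → Fin P.N} (hT : P.IsTriangulationVia P' parent)

include hT

theorem region_subset (j : Fin P'.N) :
    (P'.fragment j).region ⊆ (P.fragment (parent j)).region := by
  rw [← hT.cover (parent j)]
  exact subset_biUnion_of_mem (u := fun j => (P'.fragment j).region) (show j ∈ {k | parent k = parent j} from rfl)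

theorem exists_mem {i : Fin P.N} {x : Plane} (hx : x ∈ (P.fragment i).region) :
    ∃ j, parent j = i ∧ x ∈ (P'.fragment j).region := by
  rw [← hT.cover i] at hx
  simpa using hx

theorem src_mem (d : P'.DEdge) :
    d.src ∈ range (P.fragment (parent d.frag)).poly.vertices := by
  rcases hT.edge_or_chord d with ⟨D, hD, h1, h2⟩ | h
  · rw [hD, h1]; exact D.src_mem_range
  · exact h.1

theorem tgt_mem (d : P'.DEdge) :
    d.tgt ∈ range (P.fragment (parent d.frag)).poly.vertices := by
  rw [← DirectedEdge.reverse_src]; exact hT.src_mem d.reverse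

/-- A point of the triangle `k` is a limit of interior points of `k`, and these would enter the open
interior of `j`. -/
theorem notMem_interior {j k : Fin P'.N} (hjk : j ≠ k) (hp : parent j = parent k) {y : Plane}
    (hk : y ∈ (P'.fragment k).region) : y ∉ interior (P'.fragment j).region := by
  intro hj
  rw [← SimplePolygon.closure_interior_region_of_triangle _ (hT.triangle k)] at hk
  obtain ⟨z, hz, hz'⟩ := mem_closure_iff.1 hk _ isOpen_interior hj
  exact disjoint_left.1 (hT.disjoint j k hjk hp) hz hz'

omit hT in
theorem exists_side {j : Fin P'.N} {y : Plane} (hy : y ∈ (P'.fragment j).region)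
    (hi : y ∉ interior (P'.fragment j).region) :
    ∃ d : P'.DEdge, d.frag = j ∧ y ∈ segment ℝ d.src d.tgt := by
  apply DirectedEdge.exists_of_mem_bd
  by_contra h
  exact hi (SimplePolygon.mem_interior_region _ hy h)

omit hT in
theorem vertex_notMem_interior (i : Fin P.N) {x : Plane}
    (hx : x ∈ range (P.fragment i).poly.vertices) : x ∉ interior (P.fragment i).region := by
  obtain ⟨k, rfl⟩ := hx
  exact SimplePolygon.notMem_interior_region_of_mem_bd _ (SimplePolygon.vertex_mem_bd _ k)

/-- Edges and vertices of a fragment are on its boundary, which contains no interior point of the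
region. -/
theorem isChord_of_mem_interior {d : P'.DEdge} {y : Plane} (hy : y ∈ segment ℝ d.src d.tgt)
    (hi : y ∈ interior (P.fragment (parent d.frag)).region) :
    (P.fragment (parent d.frag)).IsChord d.src d.tgt ∧ y ∈ openSegment ℝ d.src d.tgt := by
  constructor
  · rcases hT.edge_or_chord d with ⟨D, hD, h1, h2⟩ | h
    · exfalso
      rw [hD] at hi
      rw [h1, h2] at hy
      exact SimplePolygon.notMem_interior_region_of_mem_bd _ (D.segment_subset_bd hy) hi
    · exact h
  · refine mem_openSegment_of_ne_left_right ?_ ?_ hy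
    · rintro rfl; exact vertex_notMem_interior _ (hT.src_mem d) hi
    · rintro rfl; exact vertex_notMem_interior _ (hT.tgt_mem d) hi

/-- Sides of different triangles that meet in an interior point of the fragment are the same
chord. -/
theorem sides_eq {d e : P'.DEdge} (hne : d.frag ≠ e.frag) (hp : parent d.frag = parent e.frag)
    {y : Plane} (hd : y ∈ segment ℝ d.src d.tgt) (he : y ∈ segment ℝ e.src e.tgt)
    (hi : y ∈ interior (P.fragment (parent d.frag)).region) :
    (d.src = e.src ∧ d.tgt = e.tgt) ∨ (d.src = e.tgt ∧ d.tgt = e.src) := by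
  obtain ⟨hdc, hyd⟩ := hT.isChord_of_mem_interior hd hi
  obtain ⟨hec, hye⟩ := hT.isChord_of_mem_interior he (hp ▸ hi)
  have hV : ∀ i a b, (P.fragment i).IsChord a b →
      Disjoint (openSegment ℝ a b) (range (P.fragment i).poly.vertices) := fun i a b h =>
    disjoint_left.2 fun z hz hzv => vertex_notMem_interior _ hzv (h.2.2 hz)
  have hsub : ∀ e : P'.DEdge, segment ℝ e.src e.tgt ⊆ (P'.fragment e.frag).region := fun e =>
    e.segment_subset_bd.trans (SimplePolygon.bd_subset_region _)
  obtain ⟨hcd, hned⟩ := SimplePolygon.convex_region_of_triangle _ (hT.triangle d.frag)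
  obtain ⟨hce, hnee⟩ := SimplePolygon.convex_region_of_triangle _ (hT.triangle e.frag)
  -- The line `f = c` separates the two triangles, so it passes through `y`. As `y` is in the
  -- relative interior of both chords and each chord stays on one side of the line, both chords lie
  -- on the line.
  obtain ⟨f, c, hf1, hf2⟩ := geometric_hahn_banach_open hcd.interior isOpen_interior hce.interior
    (hT.disjoint _ _ hne hp)
  have hf0 : f ≠ 0 := by
    rintro rfl
    obtain ⟨z, hz⟩ := hned
    obtain ⟨w, hw⟩ := hnee
    have h1 := hf1 z hz
    have h2 := hf2 w hw
    simp at h1 h2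
    linarith
  have hfd : ∀ z ∈ (P'.fragment d.frag).region, f z ≤ c := by
    intro z hz
    rw [← SimplePolygon.closure_interior_region_of_triangle _ (hT.triangle _)] at hz
    exact closure_minimal (s := interior (P'.fragment d.frag).region) (t := {z | f z ≤ c})
      (fun w hw => (hf1 w hw).le) (isClosed_le f.continuous continuous_const) hz
  have hfe : ∀ z ∈ (P'.fragment e.frag).region, c ≤ f z := by
    intro z hz
    rw [← SimplePolygon.closure_interior_region_of_triangle _ (hT.triangle _)] at hz
    exact closure_minimal (s := interior (P'.fragment e.frag).region) (t := {z | c ≤ f z})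
      (fun w hw => hf2 w hw) (isClosed_le continuous_const f.continuous) hz
  have hy : f y = c := le_antisymm (hfd y (hsub d hd)) (hfe y (hsub e he))
  have hends : ∀ a b : Plane, ∀ g : Plane →L[ℝ] ℝ, ∀ c : ℝ, g a ≤ c → g b ≤ c → g y = c →
      y ∈ openSegment ℝ a b → g a = c ∧ g b = c := by
    rintro a b g c ha hb hgy ⟨p, q, hp, hq, hpq, rfl⟩
    simp only [map_add, map_smul, smul_eq_mul] at hgy
    obtain rfl : q = 1 - p := by linarith
    constructor <;> nlinarith
  obtain ⟨hs1, ht1⟩ := hends _ _ f c (hfd _ (hsub d (left_mem_segment ℝ _ _)))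
    (hfd _ (hsub d (right_mem_segment ℝ _ _))) hy hyd
  obtain ⟨hs2, ht2⟩ := hends _ _ (-f) (-c)
    (by simpa using hfe _ (hsub e (left_mem_segment ℝ _ _)))
    (by simpa using hfe _ (hsub e (right_mem_segment ℝ _ _))) (by simpa using hy) hye
  simp at hs2 ht2
  have hline : ∀ z, f z = c → ∃ p : ℝ, z = AffineMap.lineMap d.src d.tgt p := by
    intro z hz
    by_contra! hcon
    have hw : d.tgt - d.src ≠ 0 := sub_ne_zero.2 d.src_ne_tgt.symm
    refine hf0 (eq_zero_of_planeCross_ne_zero f (u := z - d.src) (w := d.tgt - d.src)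
      (by rw [map_sub]; linarith) (by rw [map_sub]; linarith) fun h0 => ?_)
    obtain ⟨p, hp⟩ := exists_smul_of_planeCross_eq_zero hw h0
    exact hcon p (by rw [AffineMap.lineMap_apply, vsub_eq_sub, ← hp]; simp)
  refine endpoints_eq_of_openSegment_inter d.src_ne_tgt hdc.1 hdc.2.1 (hp ▸ hec.1) (hp ▸ hec.2.1)
    (hV _ _ _ hdc) (hp ▸ hV _ _ _ hec) hyd hye (hline _ hs2) (hline _ ht2)

/-- Points of the triangles that represent the same point of a fragment are identified. -/
theorem pt_eq {j k : Fin P'.N} (hjk : parent j = parent k) {x : Plane}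
    (hj : x ∈ (P'.fragment j).region) (hk : x ∈ (P'.fragment k).region) :
    P'.pt j x hj = P'.pt k x hk := by
  by_contra hne
  obtain ⟨ε₀, hε₀, hconn⟩ := SimplePolygon.exists_isPreconnected_interior _ (hT.region_subset j hj)
  obtain ⟨ε₁, hε₁, h1⟩ := exists_ball_disjoint_of_finite (fun l => (P'.fragment l).region)
    (fun l => SimplePolygon.isClosed_region _) x
  obtain ⟨ε₂, hε₂, h2⟩ := exists_ball_disjoint_of_finite (fun d : P'.DEdge => segment ℝ d.src d.tgt)
    (fun d => by rw [DirectedEdge.segment_eq_edgeSet]; exact SimplePolygon.isClosed_edgeSet _ _) x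
  set ε := min ε₀ (min ε₁ ε₂) with hε
  have hεpos : 0 < ε := lt_min hε₀ (lt_min hε₁ hε₂)
  have hle1 : ε ≤ ε₁ := (min_le_right _ _).trans (min_le_left _ _)
  have hle2 : ε ≤ ε₂ := (min_le_right _ _).trans (min_le_right _ _)
  replace hconn := hconn ε hεpos (min_le_left _ _)
  set S := (interior (P.fragment (parent j)).region ∩ Metric.ball x ε) \ {x} with hS
  have hcl : ∀ p : Fin P'.N → Prop, IsClosed (⋃ l ∈ {l | p l}, (P'.fragment l).region) := fun p =>
    (toFinite _).isClosed_biUnion fun l _ => SimplePolygon.isClosed_region _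
  have hmeet : ∀ l, parent l = parent j → x ∈ (P'.fragment l).region →
      (S ∩ (P'.fragment l).region).Nonempty := by
    intro l hl hx
    rw [← SimplePolygon.closure_interior_region_of_triangle _ (hT.triangle l)] at hx
    obtain ⟨z, hzb, hzi⟩ := mem_closure_iff.1 hx _ Metric.isOpen_ball (Metric.mem_ball_self hεpos)
    obtain ⟨w, hw, hwx⟩ : ∃ w ∈ Metric.ball x ε ∩ interior (P'.fragment l).region, w ≠ x := by
      by_cases hzx : z = x
      · by_contra! hall
        have hsing : Metric.ball x ε ∩ interior (P'.fragment l).region = {x} :=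
          Subset.antisymm hall (singleton_subset_iff.2 (⟨Metric.mem_ball_self hεpos, hzx ▸ hzi⟩))
        have := (Metric.isOpen_ball (x := x) (ε := ε)).inter (isOpen_interior (s := (P'.fragment l).region))
        rw [hsing] at this
        exact not_isOpen_singleton x this
      · exact ⟨z, ⟨hzb, hzi⟩, hzx⟩
    refine ⟨w, ⟨⟨?_, hw.1⟩, hwx⟩, interior_subset hw.2⟩
    exact interior_mono (hl ▸ hT.region_subset l) hw.2
  -- The triangles at `x` form two classes: those whose copy of `x` is identified with the copy in
  -- `j`, and the others. Both classes meet the connected set `S` and together they cover it, so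
  -- their closed unions have a common point `y` in `S`, where a triangle of one class borders a
  -- triangle of the other.
  set p : Fin P'.N → Prop := fun l => parent l = parent j ∧
    ∃ hl : x ∈ (P'.fragment l).region, P'.pt l x hl = P'.pt j x hj with hp
  set q : Fin P'.N → Prop := fun l => parent l = parent j ∧
    ∃ hl : x ∈ (P'.fragment l).region, P'.pt l x hl ≠ P'.pt j x hj with hq
  obtain ⟨y, hyS, hyp, hyq⟩ := isPreconnected_closed_iff.1 hconn _ _ (hcl p) (hcl q) (by
    intro y hy
    obtain ⟨l, hl, hyl⟩ := hT.exists_mem (interior_subset hy.1.1)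
    have hxl : x ∈ (P'.fragment l).region := by
      by_contra h
      exact h1 l h y (lt_of_lt_of_le hy.1.2 hle1) hyl
    by_cases h : P'.pt l x hxl = P'.pt j x hj
    · exact Or.inl (mem_biUnion (show l ∈ {l | p l} from ⟨hl, hxl, h⟩) hyl)
    · exact Or.inr (mem_biUnion (show l ∈ {l | q l} from ⟨hl, hxl, h⟩) hyl))
    ((hmeet j rfl hj).mono (inter_subset_inter_right _
      (subset_biUnion_of_mem (u := fun l => (P'.fragment l).region) (show j ∈ {l | p l} from ⟨rfl, hj, rfl⟩))))
    ((hmeet k hjk.symm hk).mono (inter_subset_inter_right _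
      (subset_biUnion_of_mem (u := fun l => (P'.fragment l).region) (show k ∈ {l | q l} from ⟨hjk.symm, hk, Ne.symm hne⟩))))
  obtain ⟨l, ⟨hl, hxl, hleq⟩, hyl⟩ := mem_iUnion₂.1 hyp
  obtain ⟨m, ⟨hm, hxm, hmne⟩, hym⟩ := mem_iUnion₂.1 hyq
  have hlm : l ≠ m := by rintro rfl; exact hmne hleq
  obtain ⟨d, rfl, hd⟩ := exists_side (P' := P') hyl (hT.notMem_interior hlm (hl.trans hm.symm) hym)
  obtain ⟨e, rfl, he⟩ := exists_side (P' := P') hym (hT.notMem_interior hlm.symm (hm.trans hl.symm) hyl)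
  have hyε : dist y x < ε₂ := lt_of_lt_of_le hyS.1.2 hle2
  -- By the choice of the radius the chord through `y` passes through `x`, so its portal identifies
  -- the two copies of `x`.
  have hxd : x ∈ segment ℝ d.src d.tgt := by_contra fun h => h2 d h y hyε hd
  have hyi : y ∈ interior (P.fragment (parent d.frag)).region := hl ▸ hyS.1.1
  have hdc := (hT.isChord_of_mem_interior hd hyi).1
  have main : ∀ e' : P'.DEdge, e'.frag = e.frag → d.src = e'.src → d.tgt = e'.tgt → False := by
    intro e' hf hs ht
    have hg : P'.Glued d e' := (hT.glued_iff d e').2 (Or.inl ⟨by rw [hf, hl, hm],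
      fun h => hlm (by rw [← hf]; exact congrArg Sigma.fst h), hs, ht, hdc⟩)
    rw [segment_eq_image_lineMap] at hxd
    obtain ⟨t, ht', htx⟩ := hxd
    have h3 := P'.pt_eq_of_glued hg ht'
    apply hmne
    rw [← hleq]
    rw [P'.pt_congr rfl htx.symm hxl (P'.lineMap_mem_region d ht'), h3]
    exact P'.pt_congr hf.symm (by rw [← hs, ← ht, htx]) _ _
  rcases hT.sides_eq hlm (hl.trans hm.symm) hd he hyi with ⟨h3, h4⟩ | ⟨h3, h4⟩
  · exact main e rfl h3 h4
  · exact main e.reverse rfl (by simpa using h3) (by simpa using h4)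

end IsTriangulationVia

end Portalgon
-- The bijection between the two surfaces
namespace Portalgon

theorem continuous_proj (P : Portalgon) : Continuous P.proj := continuous_quot_mk

namespace IsTriangulationVia

variable {P P' : Portalgon} {parent : Fin P'.N → Fin P.N} (hT : P.IsTriangulationVia P' parent)

include hT

/-- Every edge of a fragment is a side of a triangle. -/
theorem exists_side_eq (D : P.DEdge) :
    ∃ d : P'.DEdge, parent d.frag = D.frag ∧ d.src = D.src ∧ d.tgt = D.tgt := by
  set m := AffineMap.lineMap D.src D.tgt (1 / 2 : ℝ) with hm
  have hmD : m ∈ segment ℝ D.src D.tgt := by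
    rw [segment_eq_image_lineMap]; exact ⟨1 / 2, by norm_num, rfl⟩
  have hmb := D.segment_subset_bd hmD
  have hmv : m ∉ range (P.fragment D.frag).poly.vertices := by
    intro h
    rcases DirectedEdge.eq_src_or_eq_tgt hmD h with h | h
    · rw [hm, AffineMap.lineMap_eq_left_iff] at h
      exact h.elim D.src_ne_tgt (by norm_num)
    · rw [hm, AffineMap.lineMap_eq_right_iff] at h
      exact h.elim D.src_ne_tgt (by norm_num)
  obtain ⟨j, hj, hmj⟩ := hT.exists_mem (SimplePolygon.bd_subset_region _ hmb)
  have hni := SimplePolygon.notMem_interior_region_of_mem_bd _ hmb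
  obtain ⟨d, rfl, hd⟩ := exists_side (P' := P') hmj fun h =>
    hni (hj ▸ interior_mono (hT.region_subset j) h)
  -- The side `d` contains the midpoint of `D`. If `d` is an edge it is `D` up to direction, because
  -- a point that is no vertex is on only one edge. A chord would have this boundary point in its
  -- relative interior.
  rcases hT.edge_or_chord d with ⟨E, hE, h1, h2⟩ | h
  · have hDE : D.edge = E.edge := DirectedEdge.edge_eq_of_mem (hj.symm.trans hE) hmD
      (by rwa [← h1, ← h2]) hmv
    rcases DirectedEdge.eq_or_eq_reverse hDE with rfl | rfl
    · exact ⟨d, hE, h1, h2⟩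
    · exact ⟨d.reverse, hE, by simpa, by simpa⟩
  · exfalso
    have hop : m ∈ openSegment ℝ d.src d.tgt := by
      refine mem_openSegment_of_ne_left_right ?_ ?_ hd
      · rintro h; exact hmv (h ▸ hj ▸ hT.src_mem d)
      · rintro h; exact hmv (h ▸ hj ▸ hT.tgt_mem d)
    exact hni (hj ▸ h.2.2 hop)

/-- The map from the surface of a triangulation to the surface of the portalgon. -/
def incl : P'.Surface → P.Surface :=
  Quot.lift (fun z => P.pt (parent z.1) z.2 (hT.region_subset _ z.2.2)) (by
    rintro ⟨i, x, hx⟩ ⟨j, y, hy⟩ ⟨d, e, hde, t, ht, ⟨hi, hxd⟩, ⟨hj, hye⟩⟩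
    simp only at hi hj hxd hye
    subst hi hj hxd hye
    rcases (hT.glued_iff d e).1 (Or.inl hde) with ⟨h1, -, h2, h3, -⟩ |
      ⟨D, E, hDE, ⟨h1, h2, h3⟩, ⟨h4, h5, h6⟩⟩
    · exact P.pt_congr h1 (by simp only [h2, h3]) _ _
    · rw [P.pt_congr h1 (by simp only [h2, h3]) _ (P.lineMap_mem_region D ht), P.pt_eq_of_glued hDE ht]
      exact P.pt_congr h4.symm (by simp only [h5, h6]) _ _)

theorem incl_pt (j : Fin P'.N) (x : Plane) (hx : x ∈ (P'.fragment j).region) :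
    hT.incl (P'.pt j x hx) = P.pt (parent j) x (hT.region_subset j hx) := rfl

theorem continuous_incl : Continuous hT.incl := by
  refine continuous_quot_lift _ (continuous_sigma fun j => ?_)
  have h : Continuous fun x : (P'.fragment j).region =>
      (⟨x, hT.region_subset j x.2⟩ : (P.fragment (parent j)).region) :=
    continuous_subtype_val.subtype_mk _
  exact P.continuous_proj.comp ((@continuous_sigmaMk _
    (fun i => (P.fragment i).region) _ (parent j)).comp h)

/-- The inverse of `incl`. -/
def cut : P.Surface → P'.Surface :=
  Quot.lift (fun z => P'.pt (hT.exists_mem z.2.2).choose z.2 (hT.exists_mem z.2.2).choose_spec.2) (by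
    rintro ⟨i, x, hx⟩ ⟨j, y, hy⟩ ⟨D, E, hDE, t, ht, ⟨hi, hxd⟩, ⟨hj, hye⟩⟩
    simp only at hi hj hxd hye
    subst hi hj hxd hye
    obtain ⟨d, h1, h2, h3⟩ := hT.exists_side_eq D
    obtain ⟨e, h4, h5, h6⟩ := hT.exists_side_eq E
    have hg : P'.Glued d e := (hT.glued_iff d e).2 (Or.inr ⟨D, E, Or.inl hDE, ⟨h1, h2, h3⟩, ⟨h4, h5, h6⟩⟩)
    have hd := P'.lineMap_mem_region d ht
    have he := P'.lineMap_mem_region e ht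
    rw [h2, h3] at hd
    rw [h5, h6] at he
    simp only
    -- `pt_eq` replaces the arbitrarily chosen triangles by those that have `D` and `E` as sides,
    -- where the portal is available.
    rw [hT.pt_eq ((hT.exists_mem hx).choose_spec.1.trans h1.symm) _ hd,
      hT.pt_eq ((hT.exists_mem hy).choose_spec.1.trans h4.symm) _ he,
      P'.pt_congr rfl (by rw [h2, h3]) hd (P'.lineMap_mem_region d ht), P'.pt_eq_of_glued hg ht]
    exact P'.pt_congr rfl (by rw [h5, h6]) _ _)

theorem cut_pt {i : Fin P.N} {j : Fin P'.N} (hj : parent j = i) {x : Plane}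
    (hx : x ∈ (P'.fragment j).region) (hx' : x ∈ (P.fragment i).region) :
    hT.cut (P.pt i x hx') = P'.pt j x hx :=
  hT.pt_eq ((hT.exists_mem hx').choose_spec.1.trans hj.symm) _ _

theorem cut_incl (w : P'.Surface) : hT.cut (hT.incl w) = w := by
  obtain ⟨⟨j, x, hx⟩, rfl⟩ := Quot.exists_rep w
  exact hT.cut_pt rfl hx _

theorem incl_cut (w : P.Surface) : hT.incl (hT.cut w) = w := by
  obtain ⟨⟨i, x, hx⟩, rfl⟩ := Quot.exists_rep w
  obtain ⟨j, rfl, hxj⟩ := hT.exists_mem hx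
  exact congrArg hT.incl (hT.cut_pt rfl hxj hx)

end IsTriangulationVia

end Portalgon
namespace Portalgon

variable (P : Portalgon)

/-! ### Equivalence classes of points -/

/-- The point is a vertex of its fragment. -/
def IsVertex (z : P.Points) : Prop := (z.2 : Plane) ∈ range (P.fragment z.1).poly.vertices

variable {P}

theorem isVertex_lineMap_iff (d : P.DEdge) {t : ℝ} (ht : t ∈ Icc (0 : ℝ) 1) :
    AffineMap.lineMap d.src d.tgt t ∈ range (P.fragment d.frag).poly.vertices ↔ t = 0 ∨ t = 1 := by
  constructor
  · intro h
    have hmem : AffineMap.lineMap d.src d.tgt t ∈ segment ℝ d.src d.tgt := by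
      rw [segment_eq_image_lineMap]; exact ⟨t, ht, rfl⟩
    rcases DirectedEdge.eq_src_or_eq_tgt hmem h with h | h
    · rw [AffineMap.lineMap_eq_left_iff] at h
      exact Or.inl (h.resolve_left d.src_ne_tgt)
    · rw [AffineMap.lineMap_eq_right_iff] at h
      exact Or.inr (h.resolve_left d.src_ne_tgt)
  · rintro (rfl | rfl)
    · simpa using d.src_mem_range
    · simpa using d.tgt_mem_range

theorem Corresponding.isVertex_iff {x y : P.Points} (h : P.Corresponding x y) :
    P.IsVertex x ↔ P.IsVertex y := by
  obtain ⟨i, x, hx⟩ := x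
  obtain ⟨j, y, hy⟩ := y
  obtain ⟨d, e, hde, t, ht, ⟨hi, hxd⟩, ⟨hj, hye⟩⟩ := h
  simp only at hi hj hxd hye
  subst hi hj hxd hye
  exact (isVertex_lineMap_iff d ht).trans (isVertex_lineMap_iff e ht).symm

/-- Only one edge passes through a point that is no vertex, and only one portal uses this edge. So
both identifications come from the same portal, and the second one undoes the first. -/
theorem Corresponding.eq_of_not_isVertex {x y z : P.Points} (h : P.Corresponding x y)
    (h' : P.Corresponding y z) (hy : ¬ P.IsVertex y) : x = z := by
  obtain ⟨i, x, hx⟩ := x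
  obtain ⟨j, y, hyr⟩ := y
  obtain ⟨k, z, hz⟩ := z
  obtain ⟨d, e, hde, t, ht, ⟨hi, hxd⟩, ⟨hj, hye⟩⟩ := h
  obtain ⟨d', e', hde', t', ht', ⟨hj', hyd'⟩, ⟨hk, hze'⟩⟩ := h'
  simp only at hi hj hxd hye hj' hyd' hk hze'
  have hmem : ∀ (d : P.DEdge) (t : ℝ), t ∈ Icc (0 : ℝ) 1 →
      AffineMap.lineMap d.src d.tgt t ∈ segment ℝ d.src d.tgt := fun d t ht => by
    rw [segment_eq_image_lineMap]; exact ⟨t, ht, rfl⟩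
  have hedge : e.edge = d'.edge := DirectedEdge.edge_eq_of_mem (hj.symm.trans hj')
    (hye ▸ hmem e t ht) (hyd' ▸ hmem d' t' ht') (by subst hj; exact hy)
  have hs := P.portal_unique _ hde _ hde' e (Sym2.mem_mk_right _ _) d' (Sym2.mem_mk_left _ _) hedge
  rcases Sym2.eq_iff.1 hs with ⟨rfl, rfl⟩ | ⟨rfl, rfl⟩
  · exact absurd hedge.symm (P.portal_distinct _ _ hde)
  · obtain rfl : t = t' := AffineMap.lineMap_injective ℝ e.src_ne_tgt (hye.symm.trans hyd')
    subst hi hk hxd hze'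
    rfl

/-- Away from the vertices a chain of identifications collapses to at most one portal. Vertices are
only identified with vertices; as there are finitely many of them, no further control is needed for
`finite_lifts`. -/
theorem eq_or_corresponding_of_proj_eq {x y : P.Points} (h : P.proj x = P.proj y) :
    x = y ∨ P.Corresponding x y ∨ (P.IsVertex x ∧ P.IsVertex y) := by
  have h' := Quot.eqvGen_exact h
  induction h' with
  | rel x y hxy => exact Or.inr (Or.inl hxy)
  | refl x => exact Or.inl rfl
  | symm x y hxy ih =>
    rcases ih h.symm with h1 | h1 | h1
    · exact Or.inl h1.symm
    · exact Or.inr (Or.inl (P.corresponding_symm h1))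
    · exact Or.inr (Or.inr h1.symm)
  | trans x y z hxy hyz ih1 ih2 =>
    have e1 : P.proj x = P.proj y := Quot.eqvGen_sound hxy
    have e2 : P.proj y = P.proj z := Quot.eqvGen_sound hyz
    rcases ih1 e1 with rfl | h1 | h1
    · exact ih2 e2
    · rcases ih2 e2 with rfl | h2 | h2
      · exact Or.inr (Or.inl h1)
      · by_cases hv : P.IsVertex y
        · exact Or.inr (Or.inr ⟨h1.isVertex_iff.2 hv, h2.isVertex_iff.1 hv⟩)
        · exact Or.inl (h1.eq_of_not_isVertex h2 hv)
      · exact Or.inr (Or.inr ⟨h1.isVertex_iff.2 h2.1, h2.2⟩)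
    · rcases ih2 e2 with rfl | h2 | h2
      · exact Or.inr (Or.inr h1)
      · exact Or.inr (Or.inr ⟨h1.1, h2.isVertex_iff.1 h1.2⟩)
      · exact Or.inr (Or.inr ⟨h1.1, h2.2⟩)

variable (P) in
/-- The points of a fragment that represent a given point of the surface. -/
def lifts (w : P.Surface) (k : Fin P.N) : Set Plane :=
  {x | ∃ hx : x ∈ (P.fragment k).region, P.pt k x hx = w}

theorem finite_lifts (w : P.Surface) (k : Fin P.N) : (P.lifts w k).Finite := by
  obtain ⟨z, rfl⟩ := Quot.exists_rep w
  change (P.lifts (P.proj z) k).Finite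
  by_cases hz : P.IsVertex z
  · refine (((finite_range (P.fragment k).poly.vertices)).union
      (finite_singleton (z.2 : Plane))).subset ?_
    rintro x ⟨hx, hxz⟩
    rcases eq_or_corresponding_of_proj_eq hxz with h | h | h
    · exact Or.inr (by rw [← h]; rfl)
    · exact Or.inl (h.isVertex_iff.2 hz)
    · exact Or.inl h.1
  · refine ((Set.Subsingleton.finite (s := {x | ∃ hx : x ∈ (P.fragment k).region,
      P.Corresponding ⟨k, x, hx⟩ z}) ?_).union (finite_singleton (z.2 : Plane))).subset ?_
    · rintro x ⟨hx, hxz⟩ y ⟨hy, hyz⟩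
      have := hxz.eq_of_not_isVertex (P.corresponding_symm hyz) hz
      simpa using this
    · rintro x ⟨hx, hxz⟩
      rcases eq_or_corresponding_of_proj_eq hxz with h | h | h
      · exact Or.inr (by rw [← h]; rfl)
      · exact Or.inl ⟨hx, h⟩
      · exact absurd h.2 hz

/-! ### Small balls on the surface -/

variable (P) in
/-- `ε` is so small that the `ε`-balls around the points representing `w` meet only the edges
through these points, and are disjoint from each other. -/
structure IsGoodRadius (w : P.Surface) (ε : ℝ) : Prop where
  pos : 0 < ε
  mem_segment : ∀ d : P.DEdge, ∀ x ∈ P.lifts w d.frag, ∀ y ∈ segment ℝ d.src d.tgt,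
    dist y x < ε → x ∈ segment ℝ d.src d.tgt
  eq_of_dist_lt : ∀ k, ∀ x ∈ P.lifts w k, ∀ x' ∈ P.lifts w k, dist x x' < 2 * ε → x = x'

theorem exists_isGoodRadius (w : P.Surface) : ∃ ε, P.IsGoodRadius w ε := by
  have hev : ∀ δ : ℝ, 0 < δ → ∀ᶠ ε in nhdsWithin (0 : ℝ) (Ioi 0), ε < δ := fun δ hδ =>
    mem_nhdsWithin_of_mem_nhds (Iio_mem_nhds hδ)
  have h1 : ∀ᶠ ε in nhdsWithin (0 : ℝ) (Ioi 0), ∀ d : P.DEdge, ∀ x ∈ P.lifts w d.frag,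
      ∀ y ∈ segment ℝ d.src d.tgt, dist y x < ε → x ∈ segment ℝ d.src d.tgt := by
    refine Filter.eventually_all.2 fun d => (Filter.eventually_all_finite (finite_lifts w _)).2
      fun x _ => ?_
    obtain ⟨δ, hδ, h⟩ := exists_ball_disjoint_of_finite (fun d : P.DEdge => segment ℝ d.src d.tgt)
      (fun d => by rw [DirectedEdge.segment_eq_edgeSet]; exact SimplePolygon.isClosed_edgeSet _ _) x
    filter_upwards [hev δ hδ] with ε hε y hy hyx
    by_contra hx
    exact h d hx y (hyx.trans hε) hy
  have h2 : ∀ᶠ ε in nhdsWithin (0 : ℝ) (Ioi 0), ∀ k, ∀ x ∈ P.lifts w k, ∀ x' ∈ P.lifts w k,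
      dist x x' < 2 * ε → x = x' := by
    refine Filter.eventually_all.2 fun k => (Filter.eventually_all_finite (finite_lifts w _)).2
      fun x _ => (Filter.eventually_all_finite (finite_lifts w _)).2 fun x' _ => ?_
    by_cases h : x = x'
    · simp [h]
    · filter_upwards [hev _ (half_pos (dist_pos.2 h))] with ε hε hlt
      linarith
  obtain ⟨ε, h1, h2, h3⟩ := (h1.and (h2.and self_mem_nhdsWithin)).exists
  exact ⟨ε, h3, h1, h2⟩

theorem dist_lineMap_of_portal {d e : P.DEdge} (h : s(d, e) ∈ P.portals) (t t₀ : ℝ) :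
    dist (AffineMap.lineMap e.src e.tgt t) (AffineMap.lineMap e.src e.tgt t₀) =
      dist (AffineMap.lineMap d.src d.tgt t) (AffineMap.lineMap d.src d.tgt t₀) := by
  rw [dist_lineMap_lineMap, dist_lineMap_lineMap, P.portal_length _ _ h]

/-- Representatives of one point near `w` are equally far from representatives of `w`, and the
segments to them represent the same points. -/
theorem IsGoodRadius.exists_lift {w : P.Surface} {ε : ℝ} (hε : P.IsGoodRadius w ε)
    (hC : ∀ k, Convex ℝ (P.fragment k).region) {a b : P.Points} (hab : P.proj a = P.proj b)
    {x : Plane} (hx : x ∈ P.lifts w a.1) (hxa : dist (a.2 : Plane) x < ε) :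
    ∃ x' ∈ P.lifts w b.1, dist (b.2 : Plane) x' = dist (a.2 : Plane) x ∧
      ∀ r ∈ Icc (0 : ℝ) 1, ∃ h h', P.pt a.1 (AffineMap.lineMap x a.2 r) h =
        P.pt b.1 (AffineMap.lineMap x' b.2 r) h' := by
  have hcomb : ∀ k, ∀ x ∈ (P.fragment k).region, ∀ y ∈ (P.fragment k).region, ∀ r ∈ Icc (0 : ℝ) 1,
      AffineMap.lineMap x y r ∈ (P.fragment k).region := fun k x hx y hy r hr =>
    (hC k).lineMap_mem hx hy hr
  have step : ∀ {a b : P.Points}, P.Corresponding a b → ∀ x ∈ P.lifts w a.1,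
      dist (a.2 : Plane) x < ε → ∃ x' ∈ P.lifts w b.1, dist (b.2 : Plane) x' = dist (a.2 : Plane) x ∧
      ∀ r ∈ Icc (0 : ℝ) 1, ∃ h h', P.pt a.1 (AffineMap.lineMap x a.2 r) h =
        P.pt b.1 (AffineMap.lineMap x' b.2 r) h' := by
    rintro ⟨i, y, hy⟩ ⟨j, z, hz⟩ ⟨d, e, hde, t, ht, ⟨hi, hyd⟩, ⟨hj, hze⟩⟩ x hx hxa
    simp only at hi hj hyd hze
    subst hi hj hyd hze
    have hxd := hε.mem_segment d x hx _ (by rw [segment_eq_image_lineMap]; exact ⟨t, ht, rfl⟩) hxa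
    rw [segment_eq_image_lineMap] at hxd
    obtain ⟨t₀, ht₀, rfl⟩ := hxd
    obtain ⟨hxr, hxw⟩ := hx
    refine ⟨AffineMap.lineMap e.src e.tgt t₀, ⟨P.lineMap_mem_region e ht₀, ?_⟩,
      dist_lineMap_of_portal hde _ _, fun r hr => ⟨hcomb _ _ hxr _ hy r hr,
        hcomb _ _ (P.lineMap_mem_region e ht₀) _ hz r hr, ?_⟩⟩
    · rw [← hxw]
      exact (P.pt_eq_of_glued (Or.inl hde) ht₀).symm
    -- Both segments run along the two edges of the portal, with the same parameters between `t₀`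
    -- and `t`.
    · have hr' : AffineMap.lineMap t₀ t r ∈ Icc (0 : ℝ) 1 := (convex_Icc 0 1).lineMap_mem ht₀ ht hr
      have := P.pt_eq_of_glued (Or.inl hde) hr'
      simpa only [AffineMap.apply_lineMap] using this
  -- The claim is proved in both directions at once, so that the induction passes through the
  -- symmetric closure.
  have main : ∀ {a b : P.Points}, Relation.EqvGen P.Corresponding a b →
      (∀ x ∈ P.lifts w a.1, dist (a.2 : Plane) x < ε → ∃ x' ∈ P.lifts w b.1,
        dist (b.2 : Plane) x' = dist (a.2 : Plane) x ∧
        ∀ r ∈ Icc (0 : ℝ) 1, ∃ h h', P.pt a.1 (AffineMap.lineMap x a.2 r) h =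
        P.pt b.1 (AffineMap.lineMap x' b.2 r) h') ∧
      (∀ x ∈ P.lifts w b.1, dist (b.2 : Plane) x < ε → ∃ x' ∈ P.lifts w a.1,
        dist (a.2 : Plane) x' = dist (b.2 : Plane) x ∧
        ∀ r ∈ Icc (0 : ℝ) 1, ∃ h h', P.pt b.1 (AffineMap.lineMap x b.2 r) h =
        P.pt a.1 (AffineMap.lineMap x' a.2 r) h') := by
    intro a b h
    induction h with
    | rel a b h => exact ⟨step h, step (P.corresponding_symm h)⟩
    | refl a =>
      have : ∀ x ∈ P.lifts w a.1, dist (a.2 : Plane) x < ε → ∃ x' ∈ P.lifts w a.1,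
          dist (a.2 : Plane) x' = dist (a.2 : Plane) x ∧
          ∀ r ∈ Icc (0 : ℝ) 1, ∃ h h', P.pt a.1 (AffineMap.lineMap x a.2 r) h =
          P.pt a.1 (AffineMap.lineMap x' a.2 r) h' := fun x hx _ =>
        ⟨x, hx, rfl, fun r hr => ⟨hcomb _ _ hx.1 _ a.2.2 r hr, hcomb _ _ hx.1 _ a.2.2 r hr, rfl⟩⟩
      exact ⟨this, this⟩
    | symm a b _ ih => exact ih.symm
    | trans a b c _ _ ih1 ih2 =>
      have comp : ∀ {a b c : P.Points}, (∀ x ∈ P.lifts w a.1, dist (a.2 : Plane) x < ε →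
          ∃ x' ∈ P.lifts w b.1, dist (b.2 : Plane) x' = dist (a.2 : Plane) x ∧
          ∀ r ∈ Icc (0 : ℝ) 1, ∃ h h', P.pt a.1 (AffineMap.lineMap x a.2 r) h =
          P.pt b.1 (AffineMap.lineMap x' b.2 r) h') → (∀ x ∈ P.lifts w b.1,
          dist (b.2 : Plane) x < ε →
          ∃ x' ∈ P.lifts w c.1, dist (c.2 : Plane) x' = dist (b.2 : Plane) x ∧
          ∀ r ∈ Icc (0 : ℝ) 1, ∃ h h', P.pt b.1 (AffineMap.lineMap x b.2 r) h =
          P.pt c.1 (AffineMap.lineMap x' c.2 r) h') → ∀ x ∈ P.lifts w a.1,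
          dist (a.2 : Plane) x < ε →
          ∃ x' ∈ P.lifts w c.1, dist (c.2 : Plane) x' = dist (a.2 : Plane) x ∧
          ∀ r ∈ Icc (0 : ℝ) 1, ∃ h h', P.pt a.1 (AffineMap.lineMap x a.2 r) h =
          P.pt c.1 (AffineMap.lineMap x' c.2 r) h' := by
        intro a b c h1 h2 x hx hxa
        obtain ⟨x₁, hx₁, hd₁, hr₁⟩ := h1 x hx hxa
        obtain ⟨x₂, hx₂, hd₂, hr₂⟩ := h2 x₁ hx₁ (hd₁ ▸ hxa)
        refine ⟨x₂, hx₂, hd₂.trans hd₁, fun r hr => ?_⟩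
        obtain ⟨h, h', e1⟩ := hr₁ r hr
        obtain ⟨_, h'', e2⟩ := hr₂ r hr
        exact ⟨h, h'', e1.trans e2⟩
      exact ⟨comp ih1.1 ih2.1, comp ih2.2 ih1.2⟩
  exact (main (Quot.eqvGen_exact hab)).1 x hx hxa

/-- A function on the surface that measures the distance to `w` as long as it is small. -/
theorem IsGoodRadius.exists_radial {w : P.Surface} {ε : ℝ} (hε : P.IsGoodRadius w ε)
    (hC : ∀ k, Convex ℝ (P.fragment k).region) : ∃ ρ : P.Surface → ℝ≥0∞,
      (∀ k y hy y' hy', ρ (P.pt k y hy) ≤ ρ (P.pt k y' hy') + edist y y') ∧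
      (∀ k y hy, ∀ x ∈ P.lifts w k, dist y x < ε → ρ (P.pt k y hy) = edist y x) ∧
      (∀ k y hy, ρ (P.pt k y hy) < ENNReal.ofReal ε → ∃ x ∈ P.lifts w k, dist y x < ε) ∧
      ρ w = 0 := by
  -- The minimum with `ε` makes the value independent of the representative: `exists_lift`
  -- transports the points over `w` only within distance `ε`.
  set f : P.Points → ℝ≥0∞ := fun a => min (ENNReal.ofReal ε) (Metric.infEDist (a.2 : Plane) (P.lifts w a.1))
    with hf
  have hle : ∀ a b, P.Corresponding a b → f b ≤ f a := by
    intro a b hab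
    refine le_min (min_le_left _ _) (Metric.le_infEDist.2 fun x hx => ?_)
    rcases lt_or_ge (dist (a.2 : Plane) x) ε with h | h
    · obtain ⟨x', hx', hd, -⟩ := hε.exists_lift hC (Quot.sound hab) hx h
      refine (min_le_right _ _).trans ((Metric.infEDist_le_edist_of_mem hx').trans ?_)
      rw [edist_dist, edist_dist, hd]
    · refine (min_le_left _ _).trans ?_
      rw [edist_dist]; exact ENNReal.ofReal_le_ofReal h
  have hval : ∀ k y (hy : y ∈ (P.fragment k).region), ∀ x ∈ P.lifts w k, dist y x < ε →
      f ⟨k, y, hy⟩ = edist y x := by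
    intro k y hy x hx hyx
    have : Metric.infEDist y (P.lifts w k) = edist y x := by
      refine le_antisymm (Metric.infEDist_le_edist_of_mem hx) (Metric.le_infEDist.2 fun x' hx' => ?_)
      rw [edist_dist, edist_dist]
      apply ENNReal.ofReal_le_ofReal
      by_contra! hlt
      have := dist_triangle_left x x' y
      have hxx := hε.eq_of_dist_lt k x hx x' hx' (by linarith)
      rw [hxx] at hlt
      exact lt_irrefl _ hlt
    simp only [hf, this]
    rw [min_eq_right]
    rw [edist_dist]; exact ENNReal.ofReal_le_ofReal hyx.le
  refine ⟨Quot.lift f fun a b hab => le_antisymm (hle b a (P.corresponding_symm hab)) (hle a b hab),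
    ?_, hval, ?_, ?_⟩
  · intro k y hy y' hy'
    change min _ _ ≤ min _ _ + _
    rw [min_add]
    refine min_le_min le_self_add ?_
    exact Metric.infEDist_le_infEDist_add_edist
  · intro k y hy h
    change min _ _ < _ at h
    rw [min_lt_iff] at h
    obtain ⟨x, hx, hlt⟩ := Metric.infEDist_lt_iff.1 (h.resolve_left (lt_irrefl _))
    exact ⟨x, hx, (edist_lt_ofReal).1 hlt⟩
  · obtain ⟨⟨k, y, hy⟩, rfl⟩ := Quot.exists_rep w
    exact (hval k y hy y ⟨hy, rfl⟩ (by simpa using hε.pos)).trans (edist_self _)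

end Portalgon

theorem eVariationOn_Icc_le_of_edist_le {E : Type*} [PseudoEMetricSpace E] {h : ℝ → E} {f : ℝ → ℝ}
    {a b : ℝ} (hab : a ≤ b) (hf : MonotoneOn f (Icc a b))
    (hd : ∀ u ∈ Icc a b, ∀ v ∈ Icc a b, u ≤ v → edist (h u) (h v) ≤ ENNReal.ofReal (f v - f u)) :
    eVariationOn h (Icc a b) ≤ ENNReal.ofReal (f b - f a) := by
  have h1 : eVariationOn h (Icc a b) ≤ eVariationOn f (Icc a b) := by
    refine iSup_le ?_
    rintro ⟨n, u, hu, us⟩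
    refine le_trans (Finset.sum_le_sum fun i _ => ?_) (eVariationOn.sum_le hu us)
    rw [edist_comm, edist_dist (f _), Real.dist_eq,
      abs_of_nonneg (sub_nonneg.2 (hf (us _) (us _) (hu (Nat.le_succ i))))]
    exact hd _ (us i) _ (us (i + 1)) (hu (Nat.le_succ i))
  have h2 := hf.eVariationOn_eq (left_mem_Icc.2 hab) (right_mem_Icc.2 hab)
  rw [inter_self] at h2
  exact h1.trans h2.le

namespace Portalgon

variable {P : Portalgon}

/-! ### Splittings of curves -/

variable (P) in
/-- On `[a, b]`, the curve `γ` is the image of the curve `h` in the fragment `i`. -/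
structure IsPiece (γ : ℝ → P.Surface) (a b : ℝ) (i : Fin P.N) (h : ℝ → Plane) : Prop where
  le : a ≤ b
  continuousOn : ContinuousOn h (Icc a b)
  eq : ∀ u ∈ Icc a b, ∃ hr, P.pt i (h u) hr = γ u

theorem IsPiece.mono {γ : ℝ → P.Surface} {a b : ℝ} {i : Fin P.N} {h : ℝ → Plane}
    (H : P.IsPiece γ a b i h) {c d : ℝ} (hc : a ≤ c) (hcd : c ≤ d) (hd : d ≤ b) :
    P.IsPiece γ c d i h :=
  ⟨hcd, H.continuousOn.mono (Icc_subset_Icc hc hd), fun u hu => H.eq u (Icc_subset_Icc hc hd hu)⟩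

variable (P) in
/-- On `[a, b]`, the curve `γ` splits into pieces of total length `ℓ`. -/
inductive SplitLength (γ : ℝ → P.Surface) : ℝ → ℝ → ℝ≥0∞ → Prop
  | nil (a : ℝ) : SplitLength γ a a 0
  | cons {a b c : ℝ} {ℓ : ℝ≥0∞} (i : Fin P.N) (h : ℝ → Plane) (H : P.IsPiece γ a b i h)
      (rest : SplitLength γ b c ℓ) : SplitLength γ a c (eVariationOn h (Icc a b) + ℓ)

namespace SplitLength

variable {γ δ : ℝ → P.Surface} {a b c : ℝ} {ℓ ℓ' : ℝ≥0∞}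

theorem le (S : P.SplitLength γ a b ℓ) : a ≤ b := by
  induction S with
  | nil a => exact le_rfl
  | cons i h H _ ih => exact H.le.trans ih

theorem single {i : Fin P.N} {h : ℝ → Plane} (H : P.IsPiece γ a b i h) :
    P.SplitLength γ a b (eVariationOn h (Icc a b)) := by
  simpa using SplitLength.cons i h H (SplitLength.nil b)

theorem trans (S : P.SplitLength γ a b ℓ) (S' : P.SplitLength γ b c ℓ') :
    P.SplitLength γ a c (ℓ + ℓ') := by
  induction S with
  | nil a => simpa using S'
  | cons i h H _ ih => rw [add_assoc]; exact SplitLength.cons i h H (ih S')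

theorem split (S : P.SplitLength γ a b ℓ) {u : ℝ} (hu : u ∈ Icc a b) :
    ∃ ℓ₁ ℓ₂, P.SplitLength γ a u ℓ₁ ∧ P.SplitLength γ u b ℓ₂ ∧ ℓ₁ + ℓ₂ = ℓ := by
  induction S with
  | nil a =>
    obtain rfl : u = a := le_antisymm hu.2 hu.1
    exact ⟨0, 0, nil _, nil _, by simp⟩
  | @cons a b c ℓ i h H rest ih =>
    rcases le_total u b with hub | hub
    · refine ⟨_, _, single (H.mono le_rfl hu.1 hub), cons i h (H.mono hu.1 hub le_rfl) rest, ?_⟩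
      have := eVariationOn.Icc_add_Icc h hu.1 hub (mem_univ u)
      simp only [univ_inter] at this
      rw [← add_assoc, this]
    · obtain ⟨ℓ₁, ℓ₂, S1, S2, he⟩ := ih ⟨hub, hu.2⟩
      exact ⟨_, _, cons i h H S1, S2, by rw [add_assoc, he]⟩

theorem reparam (S : P.SplitLength γ a b ℓ) {p q : ℝ} (hp : 0 < p) {a' b' : ℝ}
    (ha : p * a' + q = a) (hb : p * b' + q = b) (hδ : ∀ r ∈ Icc a' b', δ r = γ (p * r + q)) :
    P.SplitLength δ a' b' ℓ := by
  induction S generalizing a' with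
  | nil a =>
    obtain rfl : a' = b' := by
      have : p * a' = p * b' := by linarith
      exact mul_left_cancel₀ hp.ne' this
    exact nil _
  | @cons a b c ℓ i h H rest ih =>
    have hm : p * ((b - q) / p) + q = b := by field_simp; ring
    have h1 : a' ≤ (b - q) / p := by
      have := H.le
      rw [le_div_iff₀ hp]; linarith
    have h2 : (b - q) / p ≤ b' := by
      have := rest.le
      rw [div_le_iff₀ hp]; linarith
    have hmono : Monotone fun r : ℝ => p * r + q := fun r s hrs => by
      have := mul_le_mul_of_nonneg_left hrs hp.le
      simp only; linarith
    have himg : (fun r : ℝ => p * r + q) '' Icc a' ((b - q) / p) = Icc a b := by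
      rw [image_affine_Icc' hp, ha, hm]
    have hvar : eVariationOn (h ∘ fun r => p * r + q) (Icc a' ((b - q) / p)) =
        eVariationOn h (Icc a b) := by
      rw [eVariationOn.comp_eq_of_monotoneOn _ _ (hmono.monotoneOn _), himg]
    rw [← hvar]
    refine cons i _ ⟨h1, ?_, fun u hu => ?_⟩ (ih hm hb fun r hr => hδ r ⟨h1.trans hr.1, hr.2⟩)
    · refine H.continuousOn.comp (by fun_prop) ?_
      rw [← himg]; exact mapsTo_image _ _
    · rw [hδ u ⟨hu.1, hu.2.trans h2⟩]
      exact H.eq _ (himg ▸ mem_image_of_mem _ hu)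

/-- Bounds lengths from below: a function that is 1-Lipschitz on each fragment grows along each
piece by no more than the length of the piece. It is applied to the radial function around a point.
-/
theorem le_add {ρ : P.Surface → ℝ≥0∞} (hρ : ∀ k y hy y' hy',
    ρ (P.pt k y hy) ≤ ρ (P.pt k y' hy') + edist y y') (S : P.SplitLength γ a b ℓ) :
    ρ (γ b) ≤ ρ (γ a) + ℓ := by
  induction S with
  | nil a => simp
  | @cons a b c ℓ i h H rest ih =>
    obtain ⟨ha, ea⟩ := H.eq a (left_mem_Icc.2 H.le)
    obtain ⟨hb, eb⟩ := H.eq b (right_mem_Icc.2 H.le)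
    refine ih.trans ?_
    rw [← add_assoc]
    gcongr
    rw [← ea, ← eb]
    refine (hρ i _ hb _ ha).trans ?_
    gcongr
    exact eVariationOn.edist_le _ (right_mem_Icc.2 H.le) (left_mem_Icc.2 H.le)

end SplitLength

theorem Splitting.splitLength {s t : P.Surface} {π : Path s t} (S : P.Splitting π) :
    P.SplitLength π.extend 0 1 S.length := by
  have key : ∀ (n : ℕ) (time : Fin (n + 1) → I) (_ : Monotone time) (frag : Fin n → Fin P.N)
      (piece : Fin n → I → Plane)
      (_ : ∀ j, ContinuousOn (piece j) (Icc (time j.castSucc) (time j.succ)))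
      (_ : ∀ j, ∀ u ∈ Icc (time j.castSucc) (time j.succ),
        ∃ h : piece j u ∈ (P.fragment (frag j)).region, P.proj ⟨frag j, piece j u, h⟩ = π u),
      P.SplitLength π.extend (time 0) (time (Fin.last n))
        (∑ j, eVariationOn (piece j) (Icc (time j.castSucc) (time j.succ))) := by
    intro n
    induction n with
    | zero => intro time _ frag piece _ _; simpa using SplitLength.nil _
    | succ n ih =>
      intro time hmono frag piece hc hp
      rw [Fin.sum_univ_succ]
      have hrest := ih (fun j => time j.succ) (fun i j hij => hmono (Fin.succ_le_succ_iff.2 hij))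
        (fun j => frag j.succ) (fun j => piece j.succ) (fun j => hc j.succ) (fun j => hp j.succ)
      have h01 : time 0 ≤ time 1 := hmono (Fin.zero_le _)
      have hmaps : MapsTo (projIcc (0 : ℝ) 1 zero_le_one) (Icc (time 0 : ℝ) (time 1))
          (Icc (time 0) (time 1)) := by
        intro u hu
        have hu' : u ∈ Icc (0 : ℝ) 1 := ⟨(time 0).2.1.trans hu.1, hu.2.trans (time 1).2.2⟩
        rw [projIcc_of_mem _ hu']
        exact hu
      have hvar : eVariationOn (piece 0 ∘ projIcc (0 : ℝ) 1 zero_le_one) (Icc (time 0 : ℝ) (time 1)) =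
          eVariationOn (piece 0) (Icc (time 0) (time 1)) := by
        rw [eVariationOn.comp_eq_of_monotoneOn (piece 0) (projIcc (0 : ℝ) 1 zero_le_one)
          ((monotone_projIcc _).monotoneOn _)]
        congr 1
        refine Subset.antisymm hmaps.image_subset fun u hu => ⟨u, hu, projIcc_val _ u⟩
      have hH : P.IsPiece π.extend (time 0) (time 1) (frag 0)
          (piece 0 ∘ projIcc (0 : ℝ) 1 zero_le_one) := by
        refine ⟨h01, ?_, fun u hu => ?_⟩
        · exact (hc 0).comp continuous_projIcc.continuousOn hmaps
        · exact hp 0 _ (hmaps hu)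
      have := SplitLength.cons _ _ hH hrest
      rw [hvar] at this
      exact this
  have := key S.size S.time S.monotone_time S.frag S.piece S.continuousOn_piece S.proj_piece
  rw [S.time_zero, S.time_last] at this
  exact this

theorem length_le_of_splitLength {s t : P.Surface} {π : Path s t} {ℓ : ℝ≥0∞}
    (S : P.SplitLength π.extend 0 1 ℓ) : P.length π ≤ ℓ := by
  have key : ∀ a b ℓ, P.SplitLength π.extend a b ℓ → ∀ (ha : a ∈ I) (hb : b ∈ I),
      ∃ (n : ℕ) (time : Fin (n + 1) → I) (frag : Fin n → Fin P.N) (piece : Fin n → I → Plane),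
      (∀ j : Fin n, time j.castSucc ≤ time j.succ) ∧
      (∀ j, ContinuousOn (piece j) (Icc (time j.castSucc) (time j.succ))) ∧
      (∀ j, ∀ u ∈ Icc (time j.castSucc) (time j.succ),
        ∃ h : piece j u ∈ (P.fragment (frag j)).region, P.proj ⟨frag j, piece j u, h⟩ = π u) ∧
      time 0 = ⟨a, ha⟩ ∧ time (Fin.last n) = ⟨b, hb⟩ ∧
      ∑ j, eVariationOn (piece j) (Icc (time j.castSucc) (time j.succ)) = ℓ := by
    intro a b ℓ S
    induction S with
    | nil a =>
      intro ha hb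
      exact ⟨0, fun _ => ⟨a, ha⟩, Fin.elim0, Fin.elim0, fun j => j.elim0, fun j => j.elim0,
        fun j => j.elim0, rfl, rfl, by simp⟩
    | @cons a b c ℓ i h H rest ih =>
      intro ha hc
      have hb : b ∈ I := ⟨ha.1.trans H.le, rest.le.trans hc.2⟩
      obtain ⟨n, time, frag, piece, h1, h2, h3, h4, h5, h6⟩ := ih hb hc
      have himg : Subtype.val '' (Icc (⟨a, ha⟩ : I) (time 0)) = Icc a b := by
        rw [h4]
        ext u
        constructor
        · rintro ⟨v, hv, rfl⟩; exact hv
        · intro hu; exact ⟨⟨u, ha.1.trans hu.1, hu.2.trans hb.2⟩, hu, rfl⟩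
      refine ⟨n + 1, Fin.cons ⟨a, ha⟩ time, Fin.cons i frag, Fin.cons (h ∘ Subtype.val) piece,
        ?_, ?_, ?_, rfl, ?_, ?_⟩
      · intro j
        refine Fin.cases ?_ (fun j => ?_) j
        · simpa [h4] using H.le
        · simpa using h1 j
      · intro j
        refine Fin.cases ?_ (fun j => ?_) j
        · simp only [Fin.castSucc_zero, Fin.cons_zero, Fin.cons_succ]
          refine H.continuousOn.comp continuous_subtype_val.continuousOn ?_
          rw [← himg]; exact mapsTo_image _ _
        · simpa using h2 j
      · intro j
        refine Fin.cases ?_ (fun j => ?_) j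
        · simp only [Fin.castSucc_zero, Fin.cons_zero, Fin.cons_succ]
          intro u hu
          obtain ⟨hr, he⟩ := H.eq u (himg ▸ mem_image_of_mem _ hu)
          exact ⟨hr, he.trans (Path.extend_apply π u.2)⟩
        · exact h3 j
      · rw [← Fin.succ_last, Fin.cons_succ, h5]
      · rw [Fin.sum_univ_succ]
        simp only [Fin.castSucc_zero, Fin.cons_zero, Fin.cons_succ]
        rw [eVariationOn.comp_eq_of_monotoneOn _ _ ((Subtype.mono_coe _).monotoneOn _), himg]
        congr 1
  obtain ⟨n, time, frag, piece, h1, h2, h3, h4, h5, h6⟩ := key 0 1 ℓ S ⟨le_rfl, zero_le_one⟩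
    ⟨zero_le_one, le_rfl⟩
  refine iInf_le_of_le ⟨n, time, Fin.monotone_iff_le_succ.2 h1, h4, h5, frag, piece, h2, h3⟩ ?_
  exact h6.le

/-! ### The distance on the surface -/

theorem distance_le_length {s t : P.Surface} (π : Path s t) : P.distance s t ≤ P.length π :=
  iInf_le _ π

theorem distance_triangle (s t u : P.Surface) :
    P.distance s u ≤ P.distance s t + P.distance t u := by
  simp only [distance, length, ENNReal.iInf_add, ENNReal.add_iInf]
  refine le_iInf fun π' => le_iInf fun S' => le_iInf fun π => le_iInf fun S =>
    (iInf_le _ (π.trans π')).trans ?_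
  refine length_le_of_splitLength (SplitLength.trans (b := 1 / 2) ?_ ?_)
  · refine S.splitLength.reparam (p := 2) (q := 0) two_pos (by norm_num) (by norm_num) fun r hr => ?_
    rw [Path.extend_apply _ ⟨hr.1, hr.2.trans (by norm_num)⟩]
    change (if r ≤ 1 / 2 then _ else _) = _
    rw [if_pos hr.2, add_zero]
  · refine S'.splitLength.reparam (p := 2) (q := -1) two_pos (by norm_num) (by norm_num)
      fun r hr => ?_
    rw [Path.extend_apply _ ⟨le_trans (by norm_num) hr.1, hr.2⟩]
    change (if r ≤ 1 / 2 then _ else _) = _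
    split_ifs with h
    · obtain rfl : r = 1 / 2 := le_antisymm h hr.1
      norm_num
    · rfl

theorem distance_le_eVariationOn {a b : ℝ} (hab : a ≤ b) (i : Fin P.N) {h : ℝ → Plane}
    (hc : ContinuousOn h (Icc a b)) (hr : ∀ u ∈ Icc a b, h u ∈ (P.fragment i).region) :
    P.distance (P.pt i (h a) (hr a (left_mem_Icc.2 hab))) (P.pt i (h b) (hr b (right_mem_Icc.2 hab)))
      ≤ eVariationOn h (Icc a b) := by
  have hmaps : MapsTo (fun r : ℝ => a + r * (b - a)) (Icc 0 1) (Icc a b) := by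
    intro r hr
    constructor <;> simp only <;> nlinarith [hr.1, hr.2, sub_nonneg.2 hab]
  have hcont : ContinuousOn (fun r : ℝ => h (a + r * (b - a))) (Icc 0 1) :=
    hc.comp (by fun_prop) hmaps
  have hg : Continuous fun r : I => (⟨h (a + r * (b - a)), hr _ (hmaps r.2)⟩ : (P.fragment i).region) :=
    (continuousOn_iff_continuous_domRestrict.1 hcont).subtype_mk _
  let π : Path (P.pt i (h a) (hr a (left_mem_Icc.2 hab))) (P.pt i (h b) (hr b (right_mem_Icc.2 hab))) :=
    { toFun := fun r => P.pt i (h (a + r * (b - a))) (hr _ (hmaps r.2))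
      continuous_toFun := P.continuous_proj.comp ((@continuous_sigmaMk _
        (fun i => (P.fragment i).region) _ i).comp hg)
      source' := P.pt_congr rfl (by simp) _ _
      target' := P.pt_congr rfl (by simp) _ _ }
  have hpiece : P.IsPiece π.extend 0 1 i (fun r : ℝ => h (a + r * (b - a))) :=
    ⟨zero_le_one, hcont, fun u hu => ⟨hr _ (hmaps hu), (Path.extend_apply π hu).symm⟩⟩
  refine (distance_le_length π).trans ((length_le_of_splitLength (SplitLength.single hpiece)).trans ?_)
  refine eVariationOn.comp_le_of_monotoneOn h _ (fun r _ s _ hrs => ?_) hmaps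
  have := mul_le_mul_of_nonneg_right hrs (sub_nonneg.2 hab)
  linarith

theorem distance_self (s : P.Surface) : P.distance s s = 0 := by
  obtain ⟨⟨i, x, hx⟩, rfl⟩ := Quot.exists_rep s
  have := distance_le_eVariationOn (le_refl (0 : ℝ)) i (h := fun _ => x) continuousOn_const
    fun _ _ => hx
  rw [eVariationOn.subsingleton _ (by simp)] at this
  exact nonpos_iff_eq_zero.1 this

theorem SplitLength.distance_le {γ : ℝ → P.Surface} {a b : ℝ} {ℓ : ℝ≥0∞}
    (S : P.SplitLength γ a b ℓ) : P.distance (γ a) (γ b) ≤ ℓ := by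
  induction S with
  | nil a => rw [distance_self]
  | @cons a b c ℓ i h H rest ih =>
    refine (distance_triangle _ (γ b) _).trans (add_le_add ?_ ih)
    have hr : ∀ u ∈ Icc a b, h u ∈ (P.fragment i).region := fun u hu => (H.eq u hu).1
    have := distance_le_eVariationOn H.le i H.continuousOn hr
    have ha : P.pt i (h a) _ = γ a := (H.eq a (left_mem_Icc.2 H.le)).2
    have hb : P.pt i (h b) _ = γ b := (H.eq b (right_mem_Icc.2 H.le)).2
    rwa [ha, hb] at this

theorem le_add_distance {ρ : P.Surface → ℝ≥0∞} (hρ : ∀ k y hy y' hy',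
    ρ (P.pt k y hy) ≤ ρ (P.pt k y' hy') + edist y y') (s t : P.Surface) :
    ρ t ≤ ρ s + P.distance s t := by
  simp only [distance, length, ENNReal.add_iInf]
  refine le_iInf fun π => le_iInf fun S => ?_
  simpa using S.splitLength.le_add hρ

theorem eVariationOn_lineMap_le (x y : Plane) :
    eVariationOn (AffineMap.lineMap x y : ℝ → Plane) (Icc 0 1) ≤ edist x y := by
  have := eVariationOn_Icc_le_of_edist_le (h := (AffineMap.lineMap x y : ℝ → Plane))
    (f := fun r => r * dist x y) (zero_le_one) (fun r _ s _ hrs =>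
      mul_le_mul_of_nonneg_right hrs dist_nonneg) (fun u _ v _ huv => by
      rw [edist_dist, dist_lineMap_lineMap, Real.dist_eq, abs_sub_comm, abs_of_nonneg (by linarith),
        sub_mul])
  simpa [edist_dist] using this

theorem distance_le_edist_of_segment_subset {k : Fin P.N} {x y : Plane}
    (h : segment ℝ x y ⊆ (P.fragment k).region) (hx : x ∈ (P.fragment k).region)
    (hy : y ∈ (P.fragment k).region) : P.distance (P.pt k x hx) (P.pt k y hy) ≤ edist x y := by
  have := distance_le_eVariationOn (zero_le_one) k (h := (AffineMap.lineMap x y : ℝ → Plane))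
    (AffineMap.lineMap_continuous).continuousOn (fun u hu => h (by
      rw [segment_eq_image_lineMap]; exact ⟨u, hu, rfl⟩))
  have e1 : P.pt k x hx = P.pt k (AffineMap.lineMap x y (0 : ℝ)) (by simpa) :=
    P.pt_congr rfl (by simp) _ _
  have e2 : P.pt k y hy = P.pt k (AffineMap.lineMap x y (1 : ℝ)) (by simpa) :=
    P.pt_congr rfl (by simp) _ _
  rw [e1, e2]
  exact this.trans (eVariationOn_lineMap_le x y)

theorem distance_le_edist (hC : ∀ k, Convex ℝ (P.fragment k).region) {k : Fin P.N} {x y : Plane}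
    (hx : x ∈ (P.fragment k).region) (hy : y ∈ (P.fragment k).region) :
    P.distance (P.pt k x hx) (P.pt k y hy) ≤ edist x y :=
  distance_le_edist_of_segment_subset ((hC k).segment_subset hx hy) hx hy

/-- Locally, the distance on the surface is the Euclidean distance. -/
theorem IsGoodRadius.distance_eq {w : P.Surface} {ε : ℝ} (hε : P.IsGoodRadius w ε)
    (hC : ∀ k, Convex ℝ (P.fragment k).region) {k : Fin P.N} {x y : Plane} (hx : x ∈ P.lifts w k)
    (hy : y ∈ (P.fragment k).region) (hyx : dist y x < ε) :
    P.distance w (P.pt k y hy) = edist y x := by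
  obtain ⟨hxr, rfl⟩ := hx
  refine le_antisymm ((distance_le_edist hC hxr hy).trans_eq (edist_comm _ _)) ?_
  obtain ⟨ρ, h1, h2, -, h4⟩ := hε.exists_radial hC
  have := le_add_distance h1 (P.pt k x hxr) (P.pt k y hy)
  rwa [h4, zero_add, h2 k y hy x ⟨hxr, rfl⟩ hyx] at this

theorem IsGoodRadius.exists_lift_of_distance_lt {w : P.Surface} {ε : ℝ} (hε : P.IsGoodRadius w ε)
    (hC : ∀ k, Convex ℝ (P.fragment k).region) {k : Fin P.N} {y : Plane}
    (hy : y ∈ (P.fragment k).region) (h : P.distance w (P.pt k y hy) < ENNReal.ofReal ε) :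
    ∃ x ∈ P.lifts w k, dist y x < ε := by
  obtain ⟨ρ, h1, -, h3, h4⟩ := hε.exists_radial hC
  have := le_add_distance h1 w (P.pt k y hy)
  rw [h4, zero_add] at this
  exact h3 k y hy (this.trans_lt h)

theorem eq_of_distance_eq_zero (hC : ∀ k, Convex ℝ (P.fragment k).region) {w v : P.Surface}
    (h : P.distance w v = 0) : w = v := by
  obtain ⟨ε, hε⟩ := exists_isGoodRadius w
  obtain ⟨⟨k, y, hy⟩, rfl⟩ := Quot.exists_rep v
  have h' : P.distance w (P.pt k y hy) = 0 := h
  obtain ⟨x, hx, hyx⟩ := hε.exists_lift_of_distance_lt hC hy (by rw [h']; simpa using hε.pos)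
  rw [hε.distance_eq hC hx hy hyx, edist_eq_zero] at h'
  obtain ⟨hxr, rfl⟩ := hx
  exact P.pt_congr rfl h'.symm _ _

end Portalgon
-- Comparison of the distances on the two surfaces
namespace Portalgon
namespace IsTriangulationVia

variable {P P' : Portalgon} {parent : Fin P'.N → Fin P.N} (hT : P.IsTriangulationVia P' parent)

include hT

theorem convex_region (j : Fin P'.N) : Convex ℝ (P'.fragment j).region :=
  (SimplePolygon.convex_region_of_triangle _ (hT.triangle j)).1

/-- A curve in a fragment can be replaced by a polygonal curve that visits each triangle once. -/
theorem distance_le_eVariationOn {i : Fin P.N} {h : ℝ → Plane} (J : Finset (Fin P'.N))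
    (hJ : ∀ j ∈ J, parent j = i) {a b : ℝ} (hab : a ≤ b) (hc : ContinuousOn h (Icc a b))
    (hcov : ∀ u ∈ Icc a b, ∃ j ∈ J, h u ∈ (P'.fragment j).region) {k l : Fin P'.N}
    (hk : parent k = i) (hl : parent l = i) (hka : h a ∈ (P'.fragment k).region)
    (hlb : h b ∈ (P'.fragment l).region) :
    P'.distance (P'.pt k (h a) hka) (P'.pt l (h b) hlb) ≤ eVariationOn h (Icc a b) := by
  induction hn : J.card using Nat.strong_induction_on generalizing J a k with
  | _ n ih =>
    subst hn
    obtain ⟨j, hjJ, hja⟩ := hcov a (left_mem_Icc.2 hab)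
    have hcl : IsCompact (Icc a b ∩ h ⁻¹' (P'.fragment j).region) :=
      isCompact_Icc.of_isClosed_subset
        (hc.preimage_isClosed_of_isClosed isClosed_Icc (SimplePolygon.isClosed_region _))
        inter_subset_left
    -- `t` is the last time at which the curve is in the triangle `j`. The straight segment inside
    -- `j` replaces the curve up to `t`, and `j` is not needed afterwards. This gives finitely many
    -- pieces even if the curve crosses a chord infinitely often.
    obtain ⟨t, ⟨ht, hjt⟩, hmax⟩ := hcl.exists_isGreatest ⟨a, left_mem_Icc.2 hab, hja⟩
    have h1 : P'.distance (P'.pt k (h a) hka) (P'.pt j (h t) hjt) ≤ eVariationOn h (Icc a t) := by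
      rw [hT.pt_eq (hk.trans (hJ j hjJ).symm) hka hja]
      exact (distance_le_edist hT.convex_region hja hjt).trans
        (eVariationOn.edist_le _ (left_mem_Icc.2 ht.1) (right_mem_Icc.2 ht.1))
    rcases ht.2.eq_or_lt with rfl | htb
    · rwa [hT.pt_eq (hl.trans (hJ j hjJ).symm) hlb hjt]
    · have hsub : Icc t b ⊆ Icc a b := Icc_subset_Icc_left ht.1
      have hC : IsClosed (⋃ m ∈ {m | m ∈ J.erase j}, (P'.fragment m).region) :=
        (toFinite _).isClosed_biUnion fun m _ => SimplePolygon.isClosed_region _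
      have hcov' : Icc t b ⊆ Icc t b ∩ h ⁻¹' (⋃ m ∈ {m | m ∈ J.erase j}, (P'.fragment m).region) := by
        have hcl' := (hc.mono hsub).preimage_isClosed_of_isClosed isClosed_Icc hC
        -- After `t` the other triangles cover the curve. Their union is closed, so they contain its
        -- point at time `t` as well.
        rw [← closure_Ioc htb.ne]
        refine closure_minimal (fun u hu => ⟨?_, ?_⟩) (by rwa [closure_Ioc htb.ne])
        · exact subset_closure hu
        · obtain ⟨m, hm, hum⟩ := hcov u ⟨ht.1.trans hu.1.le, hu.2⟩
          have hmj : m ≠ j := by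
            rintro rfl
            exact absurd (hmax ⟨⟨ht.1.trans hu.1.le, hu.2⟩, hum⟩) (not_le.2 hu.1)
          exact mem_biUnion (show m ∈ {m | m ∈ J.erase j} from Finset.mem_erase.2 ⟨hmj, hm⟩) hum
      have h2 := ih _ (Finset.card_erase_lt_of_mem hjJ) (J.erase j)
        (fun m hm => hJ m (Finset.mem_of_mem_erase hm)) htb.le (hc.mono hsub)
        (fun u hu => by simpa using (hcov' hu).2) (hJ j hjJ) hjt rfl
      have := eVariationOn.Icc_add_Icc h ht.1 ht.2 (mem_univ t)
      simp only [univ_inter] at this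
      rw [← this]
      exact (distance_triangle _ _ _).trans (add_le_add h1 h2)

theorem distance_cut_le_of_splitLength {γ : ℝ → P.Surface} {a b : ℝ} {ℓ : ℝ≥0∞}
    (S : P.SplitLength γ a b ℓ) : P'.distance (hT.cut (γ a)) (hT.cut (γ b)) ≤ ℓ := by
  induction S with
  | nil a => rw [distance_self]
  | @cons a b c ℓ i h H rest ih =>
    refine (distance_triangle _ (hT.cut (γ b)) _).trans (add_le_add ?_ ih)
    obtain ⟨ha, ea⟩ := H.eq a (left_mem_Icc.2 H.le)
    obtain ⟨hb, eb⟩ := H.eq b (right_mem_Icc.2 H.le)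
    obtain ⟨k, hk, hka⟩ := hT.exists_mem ha
    obtain ⟨l, hl, hlb⟩ := hT.exists_mem hb
    rw [← ea, ← eb, hT.cut_pt hk hka, hT.cut_pt hl hlb]
    classical
    refine hT.distance_le_eVariationOn (Finset.univ.filter fun j => parent j = i)
      (fun j hj => (Finset.mem_filter.1 hj).2) H.le H.continuousOn (fun u hu => ?_) hk hl hka hlb
    obtain ⟨hr, -⟩ := H.eq u hu
    obtain ⟨j, hj, hju⟩ := hT.exists_mem hr
    exact ⟨j, by simpa using hj, hju⟩

theorem distance_le_distance_incl (s t : P'.Surface) :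
    P'.distance s t ≤ P.distance (hT.incl s) (hT.incl t) := by
  refine le_iInf fun π => le_iInf fun S => ?_
  have := hT.distance_cut_le_of_splitLength S.splitLength
  simpa [cut_incl] using this

theorem splitLength_incl {γ : ℝ → P'.Surface} {a b : ℝ} {ℓ : ℝ≥0∞}
    (S : P'.SplitLength γ a b ℓ) : P.SplitLength (hT.incl ∘ γ) a b ℓ := by
  induction S with
  | nil a => exact SplitLength.nil a
  | cons i h H rest ih =>
    refine SplitLength.cons (parent i) h ⟨H.le, H.continuousOn, fun u hu => ?_⟩ ih
    obtain ⟨hr, he⟩ := H.eq u hu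
    exact ⟨hT.region_subset i hr, congrArg hT.incl he⟩

end IsTriangulationVia
end Portalgon

/-! ### Shortest paths on a surface with convex fragments -/

theorem dist_le_sub_of_eventually {E : Type*} [PseudoMetricSpace E] {h : ℝ → E} {f : ℝ → ℝ} {a b : ℝ}
    (hab : a ≤ b) (hh : ContinuousOn h (Icc a b)) (hf : ContinuousOn f (Icc a b))
    (hloc : ∀ u ∈ Ico a b, ∀ᶠ v in nhdsWithin u (Ioi u), dist (h u) (h v) ≤ f v - f u) :
    dist (h a) (h b) ≤ f b - f a := by
  have key : Icc a b ⊆ {v | dist (h a) (h v) ≤ f v - f a} := by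
    refine IsClosed.Icc_subset_of_forall_exists_gt ?_ (by simp) ?_
    · have h1 : ContinuousOn (fun v => dist (h a) (h v)) (Icc a b) := by fun_prop
      have h2 : ContinuousOn (fun v => f v - f a) (Icc a b) := hf.sub continuousOn_const
      have := isClosed_Icc.isClosed_le h1 h2
      rwa [inter_comm]
    · rintro u ⟨hu, hub⟩ y hy
      have h1 : ∀ᶠ v in nhdsWithin u (Ioi u), v ∈ Ioc u y := Ioc_mem_nhdsGT hy
      obtain ⟨v, hv, hvy⟩ := ((hloc u hub).and h1).exists
      refine ⟨v, ?_, hvy⟩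
      have := dist_triangle (h a) (h u) (h v)
      simp only [mem_ofPred_eq] at hu ⊢
      linarith
  exact key (right_mem_Icc.2 hab)

namespace Portalgon

variable {P : Portalgon}

/-- The distance from the starting point, as a function of time. -/
def arc {s t : P.Surface} (π : Path s t) (u : ℝ) : ℝ := (P.distance s (π.extend u)).toReal

theorem arc_zero {s t : P.Surface} (π : Path s t) : arc π 0 = 0 := by
  simp [arc, distance_self]

namespace IsShortest

variable {s t : P.Surface} {π : Path s t} (hπ : P.IsShortest π)

include hπ

theorem distance_ne_top : P.distance s t ≠ ⊤ := hπ.2 ▸ hπ.1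

/-- A splitting of π can be cut at `u` and `v`, and each of the three parts is at least as long as
the distance between its ends. So a shortest path attains equality in the triangle inequality. -/
theorem add_add_le {u v : ℝ} (hu : 0 ≤ u) (huv : u ≤ v) (hv : v ≤ 1) :
    P.distance s (π.extend u) + P.distance (π.extend u) (π.extend v) +
      P.distance (π.extend v) t ≤ P.distance s t := by
  rw [← hπ.2]
  refine le_iInf fun S => ?_
  obtain ⟨ℓ₁, ℓ₂, S1, S2, h1⟩ := S.splitLength.split (u := v) ⟨hu.trans huv, hv⟩
  obtain ⟨ℓ₃, ℓ₄, S3, S4, h2⟩ := S1.split (u := u) ⟨hu, huv⟩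
  have e1 := S3.distance_le
  have e2 := S4.distance_le
  have e3 := S2.distance_le
  rw [Path.extend_zero] at e1
  rw [Path.extend_one] at e3
  rw [← h1, ← h2]
  gcongr

theorem distance_eq_add {u v : ℝ} (hu : 0 ≤ u) (huv : u ≤ v) (hv : v ≤ 1) :
    P.distance s (π.extend v) = P.distance s (π.extend u) + P.distance (π.extend u) (π.extend v) := by
  refine le_antisymm (distance_triangle _ _ _) ?_
  have h1 := hπ.add_add_le hu huv hv
  have h2 : P.distance (π.extend v) t ≠ ⊤ :=
    ne_top_of_le_ne_top hπ.distance_ne_top (le_add_self.trans h1)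
  exact (ENNReal.add_le_add_iff_right h2).1 (h1.trans (distance_triangle _ _ _))

theorem distance_extend_ne_top {u : ℝ} (hu : u ∈ Icc (0 : ℝ) 1) : P.distance s (π.extend u) ≠ ⊤ := by
  have h1 := hπ.add_add_le hu.1 le_rfl hu.2
  exact ne_top_of_le_ne_top hπ.distance_ne_top ((le_self_add.trans le_self_add).trans h1)

theorem distance_eq {u v : ℝ} (hu : 0 ≤ u) (huv : u ≤ v) (hv : v ≤ 1) :
    P.distance (π.extend u) (π.extend v) = ENNReal.ofReal (arc π v - arc π u) := by
  have h := hπ.distance_eq_add hu huv hv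
  have h1 := hπ.distance_extend_ne_top ⟨hu, huv.trans hv⟩
  have h2 := hπ.distance_extend_ne_top ⟨hu.trans huv, hv⟩
  have h3 : P.distance (π.extend u) (π.extend v) ≠ ⊤ :=
    ne_top_of_le_ne_top h2 (h ▸ le_add_self)
  rw [arc, arc, h, ENNReal.toReal_add h1 h3, add_sub_cancel_left, ENNReal.ofReal_toReal h3]

theorem monotoneOn_arc : MonotoneOn (arc π) (Icc 0 1) := by
  intro u hu v hv huv
  have h := hπ.distance_eq_add hu.1 huv hv.2
  exact ENNReal.toReal_mono (hπ.distance_extend_ne_top hv) (h ▸ le_self_add)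

variable (hC : ∀ k, Convex ℝ (P.fragment k).region)

include hC

theorem abs_arc_sub_le {a b : ℝ} {i : Fin P.N} {h : ℝ → Plane} (ha : 0 ≤ a) (hb : b ≤ 1)
    (H : P.IsPiece π.extend a b i h) {u v : ℝ} (hu : u ∈ Icc a b) (hv : v ∈ Icc a b)
    (huv : u ≤ v) : arc π v - arc π u ≤ dist (h u) (h v) := by
  obtain ⟨h1, e1⟩ := H.eq u hu
  obtain ⟨h2, e2⟩ := H.eq v hv
  have := distance_le_edist hC h1 h2
  rw [e1, e2, hπ.distance_eq (ha.trans hu.1) huv (hv.2.trans hb), edist_dist] at this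
  exact (ENNReal.ofReal_le_ofReal_iff dist_nonneg).1 this

theorem continuousOn_arc_of_piece {a b : ℝ} {i : Fin P.N} {h : ℝ → Plane} (ha : 0 ≤ a) (hb : b ≤ 1)
    (H : P.IsPiece π.extend a b i h) : ContinuousOn (arc π) (Icc a b) := by
  intro u hu
  rw [ContinuousWithinAt, tendsto_iff_dist_tendsto_zero]
  have h1 := tendsto_iff_dist_tendsto_zero.1 (H.continuousOn u hu)
  refine squeeze_zero' (Filter.Eventually.of_forall fun _ => dist_nonneg) ?_ h1
  filter_upwards [self_mem_nhdsWithin] with v hv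
  have hsub : Icc a b ⊆ Icc 0 1 := Icc_subset_Icc ha hb
  rcases le_total u v with huv | huv
  · have := hπ.abs_arc_sub_le hC ha hb H hu hv huv
    rw [Real.dist_eq, abs_of_nonneg (sub_nonneg.2 (hπ.monotoneOn_arc (hsub hu) (hsub hv) huv)),
      dist_comm]
    exact this
  · have := hπ.abs_arc_sub_le hC ha hb H hv hu huv
    rw [dist_comm, Real.dist_eq,
      abs_of_nonneg (sub_nonneg.2 (hπ.monotoneOn_arc (hsub hv) (hsub hu) huv))]
    exact this

/-- The pieces of a shortest path are straight. -/
theorem dist_eq_of_piece {a b : ℝ} {i : Fin P.N} {h : ℝ → Plane} (ha : 0 ≤ a) (hb : b ≤ 1)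
    (H : P.IsPiece π.extend a b i h) {u v : ℝ} (hu : u ∈ Icc a b) (hv : v ∈ Icc a b)
    (huv : u ≤ v) : dist (h u) (h v) = arc π v - arc π u := by
  refine le_antisymm ?_ (hπ.abs_arc_sub_le hC ha hb H hu hv huv)
  have hsub : Icc u v ⊆ Icc a b := Icc_subset_Icc hu.1 hv.2
  -- For this inequality it suffices to look at times just after each `w`, where the distance from
  -- the point of the path at time `w` is the Euclidean one.
  refine dist_le_sub_of_eventually huv (H.continuousOn.mono hsub)
    ((hπ.continuousOn_arc_of_piece hC ha hb H).mono hsub) fun w hw => ?_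
  have hwab := hsub (Ico_subset_Icc_self hw)
  obtain ⟨hr, hwe⟩ := H.eq w hwab
  obtain ⟨ε, hε⟩ := exists_isGoodRadius (π.extend w)
  have hcont : Filter.Tendsto h (nhdsWithin w (Ioi w)) (nhds (h w)) :=
    (H.continuousOn w hwab).mono_left (nhdsWithin_le_of_mem
      (Filter.mem_of_superset (Ioc_mem_nhdsGT hw.2) fun z hz =>
        ⟨hwab.1.trans hz.1.le, hz.2.trans hv.2⟩))
  filter_upwards [hcont (Metric.ball_mem_nhds (h w) hε.pos), Ioc_mem_nhdsGT hw.2] with z hz hzv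
  have hzab : z ∈ Icc a b := ⟨hwab.1.trans hzv.1.le, hzv.2.trans hv.2⟩
  obtain ⟨hzr, hze⟩ := H.eq z hzab
  have := hε.distance_eq hC ⟨hr, hwe⟩ hzr hz
  rw [hze, hπ.distance_eq (ha.trans hwab.1) hzv.1.le (hzab.2.trans hb), edist_dist] at this
  rw [dist_comm]
  refine ((ENNReal.ofReal_eq_ofReal_iff ?_ dist_nonneg).1 this).ge
  exact sub_nonneg.2 (hπ.monotoneOn_arc ⟨ha.trans hwab.1, hwab.2.trans hb⟩
    ⟨ha.trans hzab.1, hzab.2.trans hb⟩ hzv.1.le)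

/-- On straight pieces the variation is the increase of `arc`, and these increases telescope. So a
splitting of a subpath of a shortest path cannot waste length. -/
theorem splitLength_le {a b : ℝ} {ℓ : ℝ≥0∞} (S : P.SplitLength π.extend a b ℓ) (ha : 0 ≤ a)
    (hb : b ≤ 1) : ℓ ≤ ENNReal.ofReal (arc π b - arc π a) := by
  induction S with
  | nil a => simp
  | @cons a m b ℓ i h H rest ih =>
    have hm : m ≤ 1 := rest.le.trans hb
    have h0m := ha.trans H.le
    have h1 : eVariationOn h (Icc a m) ≤ ENNReal.ofReal (arc π m - arc π a) :=
      eVariationOn_Icc_le_of_edist_le H.le (hπ.monotoneOn_arc.mono (Icc_subset_Icc ha hm))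
        fun u hu v hv huv => by
          rw [edist_dist, hπ.dist_eq_of_piece hC ha hm H hu hv huv]
    refine (add_le_add h1 (ih h0m hb)).trans ?_
    rw [← ENNReal.ofReal_add]
    · apply le_of_eq; congr 1; ring
    · exact sub_nonneg.2 (hπ.monotoneOn_arc ⟨ha, H.le.trans hm⟩ ⟨h0m, hm⟩ H.le)
    · exact sub_nonneg.2 (hπ.monotoneOn_arc ⟨h0m, hm⟩ ⟨h0m.trans rest.le, hb⟩ rest.le)

omit hC in
theorem exists_splitLength {u v : ℝ} (hu : 0 ≤ u) (huv : u ≤ v) (hv : v ≤ 1) :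
    ∃ ℓ, P.SplitLength π.extend u v ℓ := by
  have hne : Nonempty (P.Splitting π) := by
    by_contra h
    rw [not_nonempty_iff] at h
    exact hπ.1 (iInf_of_empty _)
  obtain ⟨S⟩ := hne
  obtain ⟨ℓ₁, ℓ₂, S1, S2, h1⟩ := S.splitLength.split (u := v) ⟨hu.trans huv, hv⟩
  obtain ⟨ℓ₃, ℓ₄, S3, S4, h2⟩ := S1.split (u := u) ⟨hu, huv⟩
  exact ⟨_, S4⟩

theorem continuousOn_arc : ContinuousOn (arc π) (Icc 0 1) := by
  obtain ⟨ℓ, S⟩ := hπ.exists_splitLength le_rfl zero_le_one le_rfl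
  have key : ∀ a b ℓ, P.SplitLength π.extend a b ℓ → 0 ≤ a → b ≤ 1 →
      ContinuousOn (arc π) (Icc a b) := by
    intro a b ℓ S ha hb
    induction S with
    | nil a => simp
    | @cons a m b ℓ i h H rest ih =>
      rw [← Icc_union_Icc_eq_Icc H.le rest.le]
      exact (hπ.continuousOn_arc_of_piece hC ha (rest.le.trans hb) H).union_of_isClosed
        (ih (ha.trans H.le) hb) isClosed_Icc isClosed_Icc
  exact key _ _ _ S le_rfl le_rfl

/-- A shortest path is straight on each side of each of its points. -/
theorem exists_segment {c : ℝ} (hc : c ∈ Icc 0 (arc π 1)) :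
    (c < arc π 1 → ∃ (k : Fin P.N) (x y : Plane), x ≠ y ∧ ∀ r ∈ Icc (0 : ℝ) 1,
      ∃ h, ∃ v ∈ Icc (0 : ℝ) 1, P.pt k (AffineMap.lineMap x y r) h = π.extend v ∧
        arc π v = c + r * dist x y) ∧
    (0 < c → ∃ (k : Fin P.N) (x y : Plane), x ≠ y ∧ ∀ r ∈ Icc (0 : ℝ) 1,
      ∃ h, ∃ v ∈ Icc (0 : ℝ) 1, P.pt k (AffineMap.lineMap x y r) h = π.extend v ∧
        arc π v = c - r * dist x y) := by
  obtain ⟨ℓ, S⟩ := hπ.exists_splitLength le_rfl zero_le_one le_rfl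
  have key : ∀ a b ℓ, P.SplitLength π.extend a b ℓ → 0 ≤ a → b ≤ 1 →
      ∀ c ∈ Icc (arc π a) (arc π b), (c < arc π b → ∃ (k : Fin P.N) (x y : Plane), x ≠ y ∧
        ∀ r ∈ Icc (0 : ℝ) 1, ∃ h, ∃ v ∈ Icc (0 : ℝ) 1,
          P.pt k (AffineMap.lineMap x y r) h = π.extend v ∧ arc π v = c + r * dist x y) ∧
      (arc π a < c → ∃ (k : Fin P.N) (x y : Plane), x ≠ y ∧ ∀ r ∈ Icc (0 : ℝ) 1,
        ∃ h, ∃ v ∈ Icc (0 : ℝ) 1, P.pt k (AffineMap.lineMap x y r) h = π.extend v ∧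
          arc π v = c - r * dist x y) := by
    intro a b ℓ S
    induction S with
    | nil a =>
      intro _ _ c hc
      exact ⟨fun h => absurd h (not_lt.2 hc.1), fun h => absurd h (not_lt.2 hc.2)⟩
    | @cons a m b ℓ i h H rest ih =>
      intro ha hb c hc
      have hm : m ≤ 1 := rest.le.trans hb
      have hdist := fun {u v} (hu : u ∈ Icc a m) (hv : v ∈ Icc a m) (huv : u ≤ v) =>
        hπ.dist_eq_of_piece hC ha hm H hu hv huv
      have hcont := hπ.continuousOn_arc_of_piece hC ha hm H
      have hsub : Icc a m ⊆ Icc 0 1 := Icc_subset_Icc ha hm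
      have hle := hπ.monotoneOn_arc (hsub (left_mem_Icc.2 H.le)) (hsub (right_mem_Icc.2 H.le)) H.le
      constructor
      · intro hcb
        rcases lt_or_ge c (arc π m) with hcm | hcm
        · obtain ⟨u, hu, hfu⟩ := intermediate_value_Icc H.le hcont ⟨hc.1, hcm.le⟩
          have hum := hdist hu (right_mem_Icc.2 H.le) hu.2
          rw [hfu] at hum
          refine ⟨i, h u, h m, dist_pos.1 (by rw [hum]; linarith), fun r hr => ?_⟩
          have hcu : ContinuousOn (arc π) (Icc u m) := hcont.mono (Icc_subset_Icc_left hu.1)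
          obtain ⟨v, hv, hfv⟩ := intermediate_value_Icc hu.2 hcu
            (show c + r * dist (h u) (h m) ∈ Icc (arc π u) (arc π m) by
              rw [hfu, hum]
              constructor <;> nlinarith [hr.1, hr.2])
          have hva : v ∈ Icc a m := ⟨hu.1.trans hv.1, hv.2⟩
          have hline : h v = AffineMap.lineMap (h u) (h m) r := by
            apply eq_lineMap_of_dist_eq_mul_of_dist_eq_mul
            · rw [hdist hu hva hv.1, hfv, hfu]; ring
            · rw [hdist hva (right_mem_Icc.2 H.le) hv.2, hfv, hum]; ring
          obtain ⟨hr', he⟩ := H.eq v hva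
          exact ⟨hline ▸ hr', v, hsub hva, (P.pt_congr rfl hline.symm _ _).trans he, hfv⟩
        · exact (ih (ha.trans H.le) hb c ⟨hcm, hc.2⟩).1 hcb
      · intro hac
        rcases le_or_gt c (arc π m) with hcm | hcm
        · obtain ⟨u, hu, hfu⟩ := intermediate_value_Icc H.le hcont ⟨hc.1, hcm⟩
          have hum := hdist (left_mem_Icc.2 H.le) hu hu.1
          rw [hfu, dist_comm] at hum
          refine ⟨i, h u, h a, dist_pos.1 (by rw [hum]; linarith), fun r hr => ?_⟩
          have hcu : ContinuousOn (arc π) (Icc a u) := hcont.mono (Icc_subset_Icc_right hu.2)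
          obtain ⟨v, hv, hfv⟩ := intermediate_value_Icc hu.1 hcu
            (show c - r * dist (h u) (h a) ∈ Icc (arc π a) (arc π u) by
              rw [hfu, hum]
              constructor <;> nlinarith [hr.1, hr.2])
          have hva : v ∈ Icc a m := ⟨hv.1, hv.2.trans hu.2⟩
          have hline : h v = AffineMap.lineMap (h u) (h a) r := by
            apply eq_lineMap_of_dist_eq_mul_of_dist_eq_mul
            · rw [dist_comm, hdist hva hu hv.2, hfv, hfu]; ring
            · rw [dist_comm, hdist (left_mem_Icc.2 H.le) hva hv.1, hfv, hum]; ring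
          obtain ⟨hr', he⟩ := H.eq v hva
          exact ⟨hline ▸ hr', v, hsub hva, (P.pt_congr rfl hline.symm _ _).trans he, hfv⟩
        · exact (ih (ha.trans H.le) hb c ⟨hcm.le, hc.2⟩).2 (by linarith)
  have h0 := arc_zero π
  have := key _ _ _ S le_rfl le_rfl c (by rwa [h0])
  rwa [h0] at this

end IsShortest
end Portalgon
-- Shortest paths of the triangulation on the surface of the portalgon
namespace Portalgon
namespace IsTriangulationVia

variable {P P' : Portalgon} {parent : Fin P'.N → Fin P.N} (hT : P.IsTriangulationVia P' parent)

include hT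

/-- Subpaths of shortest paths on the surface of a triangulation are shortest paths on the surface
of the portalgon. -/
theorem isShortest_map_subpath {s t : P'.Surface} {π : Path s t} (hπ : P'.IsShortest π) {u v : I}
    (huv : u ≤ v) : P.IsShortest ((π.subpath u v).map hT.continuous_incl) := by
  have hlen : P.length ((π.subpath u v).map hT.continuous_incl) ≤
      ENNReal.ofReal (arc π v - arc π u) := by
    -- A constant subpath is treated separately, because the affine reparametrization needs the
    -- positive slope `v - u`.
    rcases huv.eq_or_lt with rfl | huv
    · simp only [sub_self, ENNReal.ofReal_zero]
      obtain ⟨⟨i, x, hx⟩, hw⟩ := Quot.exists_rep (hT.incl (π u))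
      have hpiece : P.IsPiece ((π.subpath u u).map hT.continuous_incl).extend 0 1 i fun _ => x := by
        refine ⟨zero_le_one, continuousOn_const, fun r hr => ⟨hx, ?_⟩⟩
        rw [Path.extend_apply _ hr]
        have : (π.subpath u u) ⟨r, hr⟩ = π u := by simp
        exact hw.trans (congrArg hT.incl this.symm)
      have := length_le_of_splitLength (SplitLength.single hpiece)
      rwa [eVariationOn.constant_on (by rintro _ ⟨_, _, rfl⟩ _ ⟨_, _, rfl⟩; rfl)] at this
    · obtain ⟨ℓ, S⟩ := hπ.exists_splitLength u.2.1 huv.le v.2.2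
      refine le_trans ?_ (hπ.splitLength_le hT.convex_region S u.2.1 v.2.2)
      refine length_le_of_splitLength ((hT.splitLength_incl S).reparam (p := v - u) (q := u)
        (sub_pos.2 huv) (by simp) (by simp) fun r hr => ?_)
      rw [Path.extend_apply _ hr]
      have hmem : (v - u : ℝ) * r + u ∈ Icc (0 : ℝ) 1 := by
        have hu := u.2.1
        have hv := v.2.2
        have huv' : (u : ℝ) < v := huv
        constructor <;> nlinarith [hr.1, hr.2]
      simp only [Function.comp_apply]
      rw [Path.extend_apply _ hmem]
      change hT.incl (π (Icc.convexComb u v ⟨r, hr⟩)) = _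
      congr 2
      ext
      simp only [Icc.coe_convexComb]
      ring
  have hdist : ENNReal.ofReal (arc π v - arc π u) ≤ P.distance (hT.incl (π u)) (hT.incl (π v)) := by
    rw [← hπ.distance_eq u.2.1 huv v.2.2, Path.extend_apply _ u.2, Path.extend_apply _ v.2]
    exact hT.distance_le_distance_incl _ _
  exact ⟨ne_top_of_le_ne_top ENNReal.ofReal_ne_top hlen,
    le_antisymm (hlen.trans hdist) (distance_le_length _)⟩

end IsTriangulationVia
end Portalgon

/-! ### Sets with a locally isometric function -/

section Lifts

variable {E : Type*} [NormedAddCommGroup E] [NormedSpace ℝ E] {A : Set E} {φ : E → ℝ}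

/-- Near each point `z` of `A`, the set `A` is a union of segments from `z`, on each of which `φ`
is isometric. -/
def LocallyStraight (A : Set E) (φ : E → ℝ) : Prop :=
  ∀ z ∈ A, ∃ ε > 0, ∀ y ∈ A, dist y z < ε → |φ y - φ z| = dist y z ∧ segment ℝ z y ⊆ A

/-- `φ` is not injective near `z`. -/
def IsFold (A : Set E) (φ : E → ℝ) (z : E) : Prop :=
  ∀ ε > 0, ∃ y ∈ A, ∃ y' ∈ A, dist y z < ε ∧ dist y' z < ε ∧ y ≠ y' ∧ φ y = φ y'

/-- There is a curve in `A` from `p` to `q` that is parametrized by `φ`. -/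
def HasLift (A : Set E) (φ : E → ℝ) (p q : E) : Prop :=
  ∃ g : ℝ → E, ContinuousOn g (uIcc (φ p) (φ q)) ∧ (∀ c ∈ uIcc (φ p) (φ q), g c ∈ A ∧ φ (g c) = c) ∧
    g (φ p) = p ∧ g (φ q) = q

omit [NormedSpace ℝ E] in
theorem HasLift.symm {p q : E} (h : HasLift A φ p q) : HasLift A φ q p := by
  obtain ⟨g, h1, h2, h3, h4⟩ := h
  exact ⟨g, by rwa [uIcc_comm], by rwa [uIcc_comm], h4, h3⟩

omit [NormedSpace ℝ E] in
theorem HasLift.mono {B : Set E} (hAB : A ⊆ B) {p q : E} (h : HasLift A φ p q) :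
    HasLift B φ p q := by
  obtain ⟨g, h1, h2, h3, h4⟩ := h
  exact ⟨g, h1, fun c hc => ⟨hAB (h2 c hc).1, (h2 c hc).2⟩, h3, h4⟩

omit [NormedSpace ℝ E] in
theorem HasLift.of_mem {p : E} (hp : p ∈ A) : HasLift A φ p p :=
  ⟨fun _ => p, continuousOn_const, fun c hc => ⟨hp, by simpa [eq_comm] using hc⟩, rfl, rfl⟩

omit [NormedSpace ℝ E] in
theorem IsFold.mono {B : Set E} (hAB : A ⊆ B) {z : E} (h : IsFold A φ z) : IsFold B φ z := by
  intro ε hε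
  obtain ⟨y, hy, y', hy', h⟩ := h ε hε
  exact ⟨y, hAB hy, y', hAB hy', h⟩

theorem LocallyStraight.continuousOn (hA : LocallyStraight A φ) : ContinuousOn φ A := by
  intro z hz
  obtain ⟨ε, hε, h⟩ := hA z hz
  rw [Metric.continuousWithinAt_iff]
  intro δ hδ
  refine ⟨min ε δ, lt_min hε hδ, fun y hy hyz => ?_⟩
  rw [lt_min_iff] at hyz
  rw [Real.dist_eq, (h y hy hyz.1).1]
  exact hyz.2

/-- Along the segment, |φ - φ z| is the distance from `z`. The sign of φ - φ z is constant, because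
φ would otherwise return to the value φ z at a positive distance from `z`. So φ is affine on the
segment. -/
theorem LocallyStraight.apply_lineMap (hA : LocallyStraight A φ) {z : E} (hz : z ∈ A) :
    ∃ ε > 0, ∀ y ∈ A, dist y z < ε → |φ y - φ z| = dist y z ∧ ∀ r ∈ Icc (0 : ℝ) 1,
      AffineMap.lineMap z y r ∈ A ∧ φ (AffineMap.lineMap z y r) = φ z + r * (φ y - φ z) := by
  obtain ⟨ε, hε, h⟩ := hA z hz
  refine ⟨ε, hε, fun y hy hyz => ⟨(h y hy hyz).1, ?_⟩⟩
  obtain ⟨h1, h2⟩ := h y hy hyz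
  have hmem : ∀ r ∈ Icc (0 : ℝ) 1, AffineMap.lineMap z y r ∈ A := fun r hr =>
    h2 (by rw [segment_eq_image_lineMap]; exact ⟨r, hr, rfl⟩)
  have habs : ∀ r ∈ Icc (0 : ℝ) 1, |φ (AffineMap.lineMap z y r) - φ z| = r * dist y z := by
    intro r hr
    have hd : dist (AffineMap.lineMap z y r) z = r * dist y z := by
      rw [dist_lineMap_left, Real.norm_of_nonneg hr.1, dist_comm]
    rw [(h _ (hmem r hr) (by rw [hd]; nlinarith [hr.2, dist_nonneg (x := y) (y := z)])).1, hd]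
  intro r hr
  refine ⟨hmem r hr, ?_⟩
  rcases eq_or_ne y z with rfl | hne
  · simp
  rcases hr.1.eq_or_lt with rfl | hr0
  · simp
  have hd : 0 < dist y z := dist_pos.2 hne
  have hsq : |φ (AffineMap.lineMap z y r) - φ z| = |r * (φ y - φ z)| := by
    rw [habs r hr, abs_mul, h1, abs_of_pos hr0]
  rcases abs_eq_abs.1 hsq with h3 | h3
  · linarith
  · exfalso
    have hcont : ContinuousOn (fun t : ℝ => φ (AffineMap.lineMap z y t)) (uIcc r 1) := by
      rw [uIcc_of_le hr.2]
      exact hA.continuousOn.comp AffineMap.lineMap_continuous.continuousOn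
        fun t ht => hmem t ⟨hr.1.trans ht.1, ht.2⟩
    have hz' : φ z ∈ uIcc (φ (AffineMap.lineMap z y r)) (φ (AffineMap.lineMap z y (1 : ℝ))) := by
      rw [mem_uIcc, AffineMap.lineMap_apply_one]
      rcases le_total (φ y) (φ z) with h | h
      · exact Or.inr ⟨h, by nlinarith⟩
      · exact Or.inl ⟨by nlinarith, h⟩
    obtain ⟨t, ht, htz⟩ := intermediate_value_uIcc hcont hz'
    rw [uIcc_of_le hr.2] at ht
    have := habs t ⟨hr.1.trans ht.1, ht.2⟩
    simp only at htz
    rw [htz, sub_self, abs_zero] at this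
    have htpos : 0 < t := hr0.trans_le ht.1
    have := mul_pos htpos hd
    linarith

theorem LocallyStraight.eventually_hasLift (hA : LocallyStraight A φ) {z : E} (hz : z ∈ A) :
    ∃ ε > 0, ∀ y ∈ A, dist y z < ε → HasLift A φ z y := by
  obtain ⟨ε, hε, h⟩ := hA.apply_lineMap hz
  refine ⟨ε, hε, fun y hy hyz => ?_⟩
  obtain ⟨h1, h2⟩ := h y hy hyz
  rcases eq_or_ne (φ y) (φ z) with he | hne
  · have : y = z := by rw [he, sub_self, abs_zero] at h1; exact dist_eq_zero.1 h1.symm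
    subst this
    exact HasLift.of_mem hz
  have hne' : φ y - φ z ≠ 0 := sub_ne_zero.2 hne
  refine ⟨fun c => AffineMap.lineMap z y ((c - φ z) / (φ y - φ z)), ?_, fun c hc => ?_, ?_, ?_⟩
  · exact (AffineMap.lineMap_continuous.comp (by fun_prop)).continuousOn
  · have hr : (c - φ z) / (φ y - φ z) ∈ Icc (0 : ℝ) 1 := by
      rcases mem_uIcc.1 hc with hc | hc
      · have : 0 < φ y - φ z := lt_of_le_of_ne (by linarith) hne'.symm
        exact ⟨div_nonneg (by linarith) this.le, (div_le_one this).2 (by linarith)⟩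
      · have : φ y - φ z < 0 := lt_of_le_of_ne (by linarith) hne'
        exact ⟨div_nonneg_of_nonpos (by linarith) this.le, (div_le_one_of_neg this).2 (by linarith)⟩
    refine ⟨(h2 _ hr).1, ?_⟩
    rw [(h2 _ hr).2, div_mul_cancel₀ _ hne']; ring
  · simp
  · simp [hne']

/-- The function φ is affine on the short segments, so a segment whose ends have levels in the
interval stays in it. -/
theorem LocallyStraight.truncate (hA : LocallyStraight A φ) (α β : ℝ) :
    LocallyStraight (A ∩ φ ⁻¹' Icc α β) φ := by
  rintro z ⟨hz, hzα, hzβ⟩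
  obtain ⟨ε, hε, h⟩ := hA.apply_lineMap hz
  refine ⟨ε, hε, fun y ⟨hy, hyα, hyβ⟩ hyz => ⟨(h y hy hyz).1, ?_⟩⟩
  rw [segment_eq_image_lineMap]
  rintro _ ⟨r, hr, rfl⟩
  obtain ⟨h1, h2⟩ := (h y hy hyz).2 r hr
  refine ⟨h1, ?_⟩
  rw [mem_preimage, h2]
  have : φ z + r * (φ y - φ z) = (1 - r) • φ z + r • φ y := by simp; ring
  rw [this]
  exact convex_Icc α β ⟨hzα, hzβ⟩ ⟨hyα, hyβ⟩ (by linarith [hr.2]) hr.1 (by ring)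

omit [NormedSpace ℝ E] in
/-- Curves parametrized by `φ` that agree somewhere agree everywhere. -/
theorem lift_unique (hno : ∀ z ∈ A, ¬ IsFold A φ z) {g₁ g₂ : ℝ → E} {a b : ℝ}
    (h1 : ContinuousOn g₁ (uIcc a b)) (h2 : ContinuousOn g₂ (uIcc a b))
    (h1' : ∀ c ∈ uIcc a b, g₁ c ∈ A ∧ φ (g₁ c) = c) (h2' : ∀ c ∈ uIcc a b, g₂ c ∈ A ∧ φ (g₂ c) = c)
    (hab : g₁ a = g₂ a) : g₁ b = g₂ b := by
  refine ((isPreconnected_uIcc (a := a) (b := b)).induction₂'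
    (fun x y => g₁ x = g₂ x ↔ g₁ y = g₂ y) ?_ (fun _ _ _ _ _ _ h h' => h.trans h')
    left_mem_uIcc right_mem_uIcc).1 hab
  intro x hx
  by_cases hxe : g₁ x = g₂ x
  · have hf := hno (g₁ x) (h1' x hx).1
    unfold IsFold at hf
    push Not at hf
    obtain ⟨ε, hε, hf⟩ := hf
    have e1 := h1 x hx (Metric.ball_mem_nhds (g₁ x) hε)
    have e2 := h2 x hx (Metric.ball_mem_nhds (g₂ x) hε)
    filter_upwards [e1, e2, self_mem_nhdsWithin] with y hy1 hy2 hy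
    have : g₁ y = g₂ y := by
      by_contra hne
      refine hf _ (h1' y hy).1 _ (h2' y hy).1 hy1 ?_ hne ((h1' y hy).2.trans (h2' y hy).2.symm)
      rw [hxe]; exact hy2
    exact ⟨iff_of_true hxe this, iff_of_true this hxe⟩
  · have : ∀ᶠ y in nhdsWithin x (uIcc a b), g₁ y ≠ g₂ y :=
      ((h1 x hx).prodMk (h2 x hx)).eventually (isOpen_ne_fun continuous_fst continuous_snd |>.mem_nhds hxe)
    filter_upwards [this] with y hy
    exact ⟨iff_of_false hxe hy, iff_of_false hy hxe⟩

omit [NormedSpace ℝ E] in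
-- The two level intervals share only φ q, so the two curves can be concatenated.
theorem HasLift.trans_of_mem {p q r : E} (h : HasLift A φ p q) (h' : HasLift A φ q r)
    (hq : φ q ∈ uIcc (φ p) (φ r)) : HasLift A φ p r := by
  obtain ⟨g₁, h1, h2, h3, h4⟩ := h
  obtain ⟨g₂, k1, k2, k3, k4⟩ := h'
  classical
  set g : ℝ → E := fun c => if c ∈ uIcc (φ p) (φ q) then g₁ c else g₂ c with hg
  have e1 : EqOn g g₁ (uIcc (φ p) (φ q)) := fun c hc => if_pos hc
  have hint : ∀ c, c ∈ uIcc (φ p) (φ q) → c ∈ uIcc (φ q) (φ r) → c = φ q := by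
    intro c hc hc'
    rw [mem_uIcc] at hq hc hc'
    rcases hq with hq | hq <;> rcases hc with hc | hc <;> rcases hc' with hc' | hc' <;> linarith
  have e2 : EqOn g g₂ (uIcc (φ q) (φ r)) := by
    intro c hc
    by_cases hc' : c ∈ uIcc (φ p) (φ q)
    · rw [e1 hc', hint c hc' hc, h4, k3]
    · exact if_neg hc'
  have hU : uIcc (φ p) (φ r) ⊆ uIcc (φ p) (φ q) ∪ uIcc (φ q) (φ r) := uIcc_subset_uIcc_union_uIcc
  refine ⟨g, ?_, fun c hc => ?_, ?_, ?_⟩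
  · exact ((h1.congr e1).union_of_isClosed (k1.congr e2) isClosed_Icc isClosed_Icc).mono hU
  · rcases hU hc with hc | hc
    · rw [e1 hc]; exact h2 c hc
    · rw [e2 hc]; exact k2 c hc
  · rw [e1 left_mem_uIcc, h3]
  · rw [e2 right_mem_uIcc, k4]

omit [NormedSpace ℝ E] in
-- One of the three levels is between the other two. If it is φ q, the curves are concatenated.
-- Otherwise the level interval of one curve contains that of the other, the curves agree there by
-- `lift_unique`, and a restriction of the longer curve is the required lift.
theorem HasLift.trans (hno : ∀ z ∈ A, ¬ IsFold A φ z) {p q r : E} (h : HasLift A φ p q)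
    (h' : HasLift A φ q r) : HasLift A φ p r := by
  have tri : φ q ∈ uIcc (φ p) (φ r) ∨ φ r ∈ uIcc (φ q) (φ p) ∨ φ p ∈ uIcc (φ q) (φ r) := by
    simp only [mem_uIcc]
    rcases le_total (φ p) (φ q) with h1 | h1 <;> rcases le_total (φ q) (φ r) with h2 | h2 <;>
      rcases le_total (φ p) (φ r) with h3 | h3 <;> simp [*]
  have key : ∀ {p q r : E}, HasLift A φ p q → HasLift A φ q r → φ r ∈ uIcc (φ q) (φ p) →
      HasLift A φ p r := by
    rintro p q r ⟨g₁, h1, h2, h3, h4⟩ ⟨g₂, k1, k2, k3, k4⟩ hr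
    rw [uIcc_comm] at h1 h2
    have hsub : uIcc (φ q) (φ r) ⊆ uIcc (φ q) (φ p) := uIcc_subset_uIcc_left hr
    have hsub' : uIcc (φ p) (φ r) ⊆ uIcc (φ q) (φ p) := by
      rw [uIcc_comm (φ q)] at hr ⊢; exact uIcc_subset_uIcc_left hr
    have := lift_unique hno (h1.mono hsub) k1 (fun c hc => h2 c (hsub hc)) k2 (h4.trans k3.symm)
    exact ⟨g₁, h1.mono hsub', fun c hc => h2 c (hsub' hc), h3, this.trans k4⟩
  rcases tri with ht | ht | ht
  · exact h.trans_of_mem h' ht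
  · exact key h h' ht
  · exact (key h'.symm h.symm ht).symm

/-- Without folds, being joined by a lift is an equivalence relation on `A`, and nearby points are
related. So all points of a connected set are. -/
theorem LocallyStraight.hasLift_of_isPreconnected (hA : LocallyStraight A φ)
    (hno : ∀ z ∈ A, ¬ IsFold A φ z) {C : Set E} (hC : IsPreconnected C) (hCA : C ⊆ A) {p q : E}
    (hp : p ∈ C) (hq : q ∈ C) : HasLift A φ p q := by
  refine hC.induction₂' (HasLift A φ) (fun x hx => ?_) (fun _ _ _ _ _ _ h h' => h.trans hno h') hp hq
  obtain ⟨ε, hε, h⟩ := hA.eventually_hasLift (hCA hx)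
  filter_upwards [mem_nhdsWithin_of_mem_nhds (Metric.ball_mem_nhds x hε), self_mem_nhdsWithin]
    with y hy hyC
  exact ⟨h y (hCA hyC) hy, (h y (hCA hyC) hy).symm⟩

/-- A lift is 1-Lipschitz, as φ is locally isometric on segments of `A`. By `hd` its ends are at
least as far apart as its length, so it realizes the distance, and in a strictly convex space it is
the segment. -/
theorem HasLift.segment_subset [StrictConvexSpace ℝ E] (hA : LocallyStraight A φ) {p q : E}
    (h : HasLift A φ p q) (hd : |φ p - φ q| ≤ dist p q) : segment ℝ p q ⊆ A := by
  wlog hle : φ p ≤ φ q generalizing p q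
  · rw [segment_symm]
    exact this h.symm (by rwa [abs_sub_comm, dist_comm]) (le_of_not_ge hle)
  obtain ⟨g, h1, h2, h3, h4⟩ := h
  rw [uIcc_of_le hle] at h1 h2
  have hlip : ∀ u v, φ p ≤ u → u ≤ v → v ≤ φ q → dist (g u) (g v) ≤ v - u := by
    intro u v hu huv hv
    have hsub : Icc u v ⊆ Icc (φ p) (φ q) := Icc_subset_Icc hu hv
    refine dist_le_sub_of_eventually (f := fun x => x) huv (h1.mono hsub) continuousOn_id
      fun w hw => ?_
    have hw' := hsub (Ico_subset_Icc_self hw)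
    obtain ⟨ε, hε, hloc⟩ := hA (g w) (h2 w hw').1
    have hcont : Filter.Tendsto g (nhdsWithin w (Ioi w)) (nhds (g w)) :=
      (h1 w hw').mono_left (nhdsWithin_le_of_mem
        (Filter.mem_of_superset (Ioc_mem_nhdsGT hw.2) fun z hz =>
          ⟨hw'.1.trans hz.1.le, hz.2.trans hv⟩))
    filter_upwards [hcont (Metric.ball_mem_nhds (g w) hε), Ioc_mem_nhdsGT hw.2] with z hz hzv
    have hz' : z ∈ Icc (φ p) (φ q) := ⟨hw'.1.trans hzv.1.le, hzv.2.trans hv⟩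
    have := (hloc (g z) (h2 z hz').1 hz).1
    rw [(h2 z hz').2, (h2 w hw').2, abs_of_nonneg (by linarith [hzv.1])] at this
    rw [dist_comm, ← this]
  have hD : φ q - φ p ≤ dist p q := by
    rw [abs_sub_comm, abs_of_nonneg (by linarith)] at hd; exact hd
  have hD' : dist p q ≤ φ q - φ p := by
    have := hlip (φ p) (φ q) le_rfl hle le_rfl
    rwa [h3, h4] at this
  rw [segment_eq_image_lineMap]
  rintro _ ⟨r, hr, rfl⟩
  set c := φ p + r * (φ q - φ p) with hc
  have hr0 := hr.1
  have hr1 := hr.2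
  have hpc : φ p ≤ c := by nlinarith
  have hcq : c ≤ φ q := by nlinarith
  have d1 := hlip (φ p) c le_rfl hpc hcq
  have d2 := hlip c (φ q) hpc hcq le_rfl
  rw [h3] at d1
  rw [h4] at d2
  have hDeq : dist p q = φ q - φ p := le_antisymm hD' hD
  have htri := dist_triangle p (g c) q
  have : g c = AffineMap.lineMap p q r := by
    apply eq_lineMap_of_dist_eq_mul_of_dist_eq_mul
    · rw [hDeq]; nlinarith
    · rw [hDeq]; nlinarith
  rw [← this]
  exact (h2 c ⟨hpc, hcq⟩).1

end Lifts

/-! ### Cutting off the folds -/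

section Truncation

variable {E : Type*} [NormedAddCommGroup E] [NormedSpace ℝ E] {A : Set E} {φ : E → ℝ}

theorem LocallyStraight.const_sub (hA : LocallyStraight A φ) (L : ℝ) :
    LocallyStraight A (fun x => L - φ x) := by
  intro z hz
  obtain ⟨ε, hε, h⟩ := hA z hz
  refine ⟨ε, hε, fun y hy hyz => ⟨?_, (h y hy hyz).2⟩⟩
  rw [← (h y hy hyz).1, abs_sub_comm]
  congr 1
  ring

omit [NormedSpace ℝ E] in
theorem IsFold.of_const_sub {L : ℝ} {z : E} (h : IsFold A (fun x => L - φ x) z) :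
    IsFold A φ z := by
  intro ε hε
  obtain ⟨y, hy, y', hy', h1, h2, h3, h4⟩ := h ε hε
  exact ⟨y, hy, y', hy', h1, h2, h3, by simpa using h4⟩

omit [NormedSpace ℝ E] in
theorem IsFold.const_sub {z : E} (h : IsFold A φ z) (L : ℝ) :
    IsFold A (fun x => L - φ x) z := by
  intro ε hε
  obtain ⟨y, hy, y', hy', h1, h2, h3, h4⟩ := h ε hε
  exact ⟨y, hy, y', hy', h1, h2, h3, by simpa using h4⟩

omit [NormedSpace ℝ E] in
theorem HasLift.of_const_sub {L : ℝ} {p q : E} (h : HasLift A (fun x => L - φ x) p q) :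
    HasLift A φ p q := by
  obtain ⟨g, h1, h2, h3, h4⟩ := h
  have hm : MapsTo (fun c => L - c) (uIcc (φ p) (φ q)) (uIcc (L - φ p) (L - φ q)) := by
    intro c hc
    rw [mem_uIcc] at hc ⊢
    rcases hc with hc | hc
    · exact Or.inr ⟨by linarith, by linarith⟩
    · exact Or.inl ⟨by linarith, by linarith⟩
  refine ⟨fun c => g (L - c), h1.comp (by fun_prop) hm, fun c hc => ⟨(h2 _ (hm hc)).1, ?_⟩, h3, h4⟩
  have := (h2 _ (hm hc)).2
  linarith

/-- If there is a fold `z` at level 0, the cut `α` is chosen below all positive levels of the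
finitely many `p i`. The `p i` that are cut off then have level 0, hence equal `z`, and a short
segment of `A` leads from `z` up to level `α`. If there is none, `α = 0` and nothing is cut off. -/
theorem LocallyStraight.exists_truncation_bot {ι : Type*} [Finite ι] (hA : LocallyStraight A φ)
    (h0 : ∀ z ∈ A, 0 ≤ φ z)
    (hfold : ∀ z ∈ A, IsFold A φ z → φ z = 0 → ∀ p ∈ A, φ p = 0 → p = z)
    {p : ι → E} (hp : ∀ i, p i ∈ A) {δ : ℝ} (hδ : 0 < δ) :
    ∃ α, 0 ≤ α ∧ α < δ ∧ (α = 0 → ∀ z ∈ A, IsFold A φ z → φ z ≠ 0) ∧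
      ∀ i, φ (p i) < α → (∀ j, φ (p j) < α → p i = p j) ∧
        ∃ y ∈ A, φ y = α ∧ HasLift A φ (p i) y := by
  by_cases hz : ∃ z ∈ A, IsFold A φ z ∧ φ z = 0
  · obtain ⟨z, hz, hzf, hz0⟩ := hz
    obtain ⟨ε₁, hε₁, h1⟩ := hA.apply_lineMap hz
    obtain ⟨ε₂, hε₂, h2⟩ := hA.eventually_hasLift hz
    have : ∃ y ∈ A, dist y z < min ε₁ ε₂ ∧ y ≠ z := by
      obtain ⟨y, hy, y', hy', d1, d2, hne, -⟩ := hzf (min ε₁ ε₂) (lt_min hε₁ hε₂)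
      by_cases hyz : y = z
      · exact ⟨y', hy', d2, fun h => hne (hyz.trans h.symm)⟩
      · exact ⟨y, hy, d1, hyz⟩
    obtain ⟨y, hy, hyz, hne⟩ := this
    rw [lt_min_iff] at hyz
    obtain ⟨hd, hl⟩ := h1 y hy hyz.1
    rw [hz0, sub_zero, abs_of_nonneg (h0 y hy)] at hd
    have hη : 0 < φ y := by rw [hd]; exact dist_pos.2 hne
    have hall : ∀ᶠ α in nhdsWithin (0 : ℝ) (Ioi 0), ∀ i, 0 < φ (p i) → α < φ (p i) := by
      rw [Filter.eventually_all]
      intro i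
      by_cases hi : 0 < φ (p i)
      · filter_upwards [Ioo_mem_nhdsGT hi] with α hα _ using hα.2
      · exact Filter.Eventually.of_forall fun _ h => absurd h hi
    have hδ' : ∀ᶠ α in nhdsWithin (0 : ℝ) (Ioi 0), α ∈ Ioo 0 δ := Ioo_mem_nhdsGT hδ
    have hη' : ∀ᶠ α in nhdsWithin (0 : ℝ) (Ioi 0), α ∈ Ioo 0 (φ y) := Ioo_mem_nhdsGT hη
    obtain ⟨α, hα, hαδ, hαη⟩ := (hall.and (hδ'.and hη')).exists
    have hzero : ∀ i, φ (p i) < α → p i = z := by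
      intro i hi
      refine hfold z hz hzf hz0 _ (hp i) ?_
      by_contra hne
      exact (hα i (lt_of_le_of_ne (h0 _ (hp i)) (Ne.symm hne))).not_gt hi
    refine ⟨α, hαδ.1.le, hαδ.2, fun h => absurd h hαδ.1.ne', fun i hi =>
      ⟨fun j hj => (hzero i hi).trans (hzero j hj).symm, ?_⟩⟩
    have hr : α / φ y ∈ Icc (0 : ℝ) 1 := ⟨div_nonneg hαδ.1.le hη.le, (div_le_one hη).2 hαη.2.le⟩
    obtain ⟨h3, h4⟩ := hl _ hr
    refine ⟨_, h3, ?_, ?_⟩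
    · rw [h4, hz0, sub_zero, zero_add, div_mul_cancel₀ _ hη.ne']
    · rw [hzero i hi]
      refine h2 _ h3 ?_
      rw [dist_lineMap_left, Real.norm_of_nonneg hr.1, dist_comm]
      nlinarith [hr.2, dist_nonneg (x := y) (y := z), hyz.2]
  · exact ⟨0, le_rfl, hδ, fun _ z hz' hf h => hz ⟨z, hz', hf, h⟩,
      fun i hi => absurd hi (h0 _ (hp i)).not_gt⟩

/-- The `p i` outside the levels from `α` to `β` are moved along lifts to the nearer cut, and the
others stay where they are. There are no folds between the cuts, so points `p' i` and `p' j` in a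
connected set are joined by a lift. It extends to a lift from `p i` to `p j`, unless both were moved
to the same cut, but in that case they coincide. -/
theorem LocallyStraight.exists_truncation [StrictConvexSpace ℝ E] {ι : Type*} [Finite ι]
    (hA : LocallyStraight A φ) {L : ℝ} (hL : 0 ≤ L) (h0 : ∀ z ∈ A, φ z ∈ Icc 0 L)
    (hfold : ∀ z ∈ A, IsFold A φ z → (φ z = 0 ∨ φ z = L) ∧ ∀ p ∈ A, φ p = φ z → p = z)
    {p : ι → E} (hp : ∀ i, p i ∈ A) (hd : ∀ i j, |φ (p i) - φ (p j)| ≤ dist (p i) (p j)) :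
    ∃ α β, 0 ≤ α ∧ α ≤ β ∧ β ≤ L ∧ ∃ p' : ι → E, (∀ i, p' i ∈ A ∩ φ ⁻¹' Icc α β) ∧
      ∀ i j, (∃ C ⊆ A ∩ φ ⁻¹' Icc α β, IsPreconnected C ∧ p' i ∈ C ∧ p' j ∈ C) →
        segment ℝ (p i) (p j) ⊆ A := by
  suffices H : ∃ α β, 0 ≤ α ∧ α ≤ β ∧ β ≤ L ∧
      (∀ z ∈ A, IsFold A φ z → φ z ∉ Icc α β) ∧
      (∀ i, φ (p i) < α → (∀ j, φ (p j) < α → p i = p j) ∧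
        ∃ y ∈ A, φ y = α ∧ HasLift A φ (p i) y) ∧
      (∀ i, β < φ (p i) → (∀ j, β < φ (p j) → p i = p j) ∧
        ∃ y ∈ A, φ y = β ∧ HasLift A φ (p i) y) by
    obtain ⟨α, β, hα, hαβ, hβ, hno, hbot, htop⟩ := H
    have : ∀ i, ∃ y ∈ A, HasLift A φ (p i) y ∧ ((φ (p i) < α ∧ φ y = α) ∨
        (β < φ (p i) ∧ φ y = β) ∨ (α ≤ φ (p i) ∧ φ (p i) ≤ β ∧ y = p i)) := by
      intro i
      rcases lt_or_ge (φ (p i)) α with h | h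
      · obtain ⟨y, hy, hyα, hl⟩ := (hbot i h).2
        exact ⟨y, hy, hl, Or.inl ⟨h, hyα⟩⟩
      rcases lt_or_ge β (φ (p i)) with h' | h'
      · obtain ⟨y, hy, hyα, hl⟩ := (htop i h').2
        exact ⟨y, hy, hl, Or.inr (Or.inl ⟨h', hyα⟩)⟩
      exact ⟨p i, hp i, HasLift.of_mem (hp i), Or.inr (Or.inr ⟨h, h', rfl⟩)⟩
    choose p' hp' hl hcase using this
    have hmem : ∀ i, φ (p' i) ∈ Icc α β := by
      intro i
      rcases hcase i with ⟨_, h⟩ | ⟨_, h⟩ | ⟨h, h', e⟩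
      · rw [h]; exact ⟨le_rfl, hαβ⟩
      · rw [h]; exact ⟨hαβ, le_rfl⟩
      · rw [e]; exact ⟨h, h'⟩
    refine ⟨α, β, hα, hαβ, hβ, p', fun i => ⟨hp' i, hmem i⟩, ?_⟩
    rintro i j ⟨C, hCA, hC, hi, hj⟩
    by_cases hij : p i = p j
    · rw [hij, segment_same, singleton_subset_iff]
      exact hp j
    have hlift : HasLift A φ (p' i) (p' j) :=
      ((hA.truncate α β).hasLift_of_isPreconnected
        (fun z hz hf => hno z hz.1 (hf.mono inter_subset_left) hz.2) hC hCA hi hj).mono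
        inter_subset_left
    have h1 : φ (p' i) ∈ uIcc (φ (p i)) (φ (p' j)) := by
      have := hmem j
      rw [mem_uIcc]
      rcases hcase i with ⟨h, h'⟩ | ⟨h, h'⟩ | ⟨h, h', e⟩
      · exact Or.inl ⟨by linarith, by linarith [this.1]⟩
      · exact Or.inr ⟨by linarith [this.2], by linarith⟩
      · rw [e]
        exact (le_total _ _).imp (fun h => ⟨le_rfl, h⟩) (fun h => ⟨h, le_rfl⟩)
    have h2 : φ (p' j) ∈ uIcc (φ (p i)) (φ (p j)) := by
      rw [mem_uIcc]
      rcases hcase j with ⟨h, h'⟩ | ⟨h, h'⟩ | ⟨h, h', e⟩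
      · have : α ≤ φ (p i) := not_lt.1 fun hi => hij ((hbot i hi).1 j h)
        exact Or.inr ⟨by linarith, by linarith⟩
      · have : φ (p i) ≤ β := not_lt.1 fun hi => hij ((htop i hi).1 j h)
        exact Or.inl ⟨by linarith, by linarith⟩
      · rw [e]
        exact (le_total (φ (p i)) (φ (p j))).imp (fun h => ⟨h, le_rfl⟩) (fun h => ⟨le_rfl, h⟩)
    exact (((hl i).trans_of_mem hlift h1).trans_of_mem (hl j).symm h2).segment_subset hA (hd i j)
  -- For a path of length 0 the set `A` is discrete, so there are no folds and nothing has to be cut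
  -- off. Otherwise both cuts remove less than L / 2, which keeps them in order.
  rcases hL.eq_or_lt with rfl | hL
  · have hφ : ∀ z ∈ A, φ z = 0 := fun z hz => le_antisymm (h0 z hz).2 (h0 z hz).1
    refine ⟨0, 0, le_rfl, le_rfl, le_rfl, fun z hz hf => ?_, fun i hi => ?_, fun i hi => ?_⟩
    · exfalso
      obtain ⟨ε, hε, h⟩ := hA z hz
      have key : ∀ y ∈ A, dist y z < ε → y = z := fun y hy hyz => by
        have := (h y hy hyz).1
        rw [hφ y hy, hφ z hz, sub_self, abs_zero] at this
        exact dist_eq_zero.1 this.symm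
      obtain ⟨y, hy, y', hy', d1, d2, hne, -⟩ := hf ε hε
      exact hne ((key y hy d1).trans (key y' hy' d2).symm)
    · exact absurd hi (hφ _ (hp i)).ge.not_gt
    · exact absurd hi (hφ _ (hp i)).le.not_gt
  · obtain ⟨α, hα, hαδ, hα0, hbot⟩ := hA.exists_truncation_bot (fun z hz => (h0 z hz).1)
      (fun z hz hf hz0 q hq hq0 => (hfold z hz hf).2 q hq (hq0.trans hz0.symm)) hp (half_pos hL)
    obtain ⟨γ, hγ, hγδ, hγ0, htop⟩ := (hA.const_sub L).exists_truncation_bot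
      (fun z hz => sub_nonneg.2 (h0 z hz).2)
      (fun z hz hf hz0 q hq hq0 => (hfold z hz hf.of_const_sub).2 q hq (by linarith)) hp
      (half_pos hL)
    refine ⟨α, L - γ, hα, by linarith, by linarith, fun z hz hf hzm => ?_, hbot, fun i hi => ?_⟩
    · rcases (hfold z hz hf).1 with h | h
      · exact hα0 (le_antisymm (by linarith [hzm.1]) hα) z hz hf h
      · exact hγ0 (le_antisymm (by linarith [hzm.2]) hγ) z hz (hf.const_sub L) (by linarith)
    · obtain ⟨h1, y, hy, h2, h3⟩ := htop i (by linarith)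
      exact ⟨fun j hj => h1 j (by linarith), y, hy, by linarith, h3.of_const_sub⟩

end Truncation
-- The trace of a shortest path is locally straight
namespace Portalgon

variable {P : Portalgon}

theorem SplitLength.reverse {γ δ : ℝ → P.Surface} {a b : ℝ} {ℓ : ℝ≥0∞}
    (S : P.SplitLength γ a b ℓ) (hδ : ∀ r, δ r = γ (1 - r)) :
    P.SplitLength δ (1 - b) (1 - a) ℓ := by
  induction S with
  | nil a => exact SplitLength.nil _
  | @cons a b c ℓ i h H rest ih =>
    have hmaps : MapsTo (fun r : ℝ => 1 - r) (Icc (1 - b) (1 - a)) (Icc a b) :=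
      fun r hr => ⟨by linarith [hr.2], by linarith [hr.1]⟩
    have hpiece : P.IsPiece δ (1 - b) (1 - a) i (h ∘ fun r => 1 - r) :=
      ⟨by linarith [H.le], H.continuousOn.comp (by fun_prop) hmaps, fun u hu => by
        rw [hδ]; exact H.eq _ (hmaps hu)⟩
    have hvar : eVariationOn (h ∘ fun r : ℝ => 1 - r) (Icc (1 - b) (1 - a)) =
        eVariationOn h (Icc a b) := by
      rw [eVariationOn.comp_eq_of_antitoneOn _ _ fun x _ y _ hxy => by linarith,
        image_const_sub_Icc]
      simp
    rw [← hvar, add_comm]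
    exact ih.trans (SplitLength.single hpiece)

theorem distance_comm (s t : P.Surface) : P.distance s t = P.distance t s := by
  suffices h : ∀ s t : P.Surface, P.distance t s ≤ P.distance s t from le_antisymm (h t s) (h s t)
  intro s t
  refine le_iInf fun π => le_iInf fun S => (distance_le_length π.symm).trans ?_
  have := S.splitLength.reverse (δ := π.symm.extend) fun r => by rw [Path.extend_symm_apply]
  simp only [sub_self, sub_zero] at this
  exact length_le_of_splitLength this

namespace IsShortest

variable {s t : P.Surface} {π : Path s t} (hπ : P.IsShortest π)

include hπ

theorem distance_eq_abs {u v : ℝ} (hu : u ∈ Icc (0 : ℝ) 1) (hv : v ∈ Icc (0 : ℝ) 1) :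
    P.distance (π.extend u) (π.extend v) = ENNReal.ofReal |arc π u - arc π v| := by
  rcases le_total u v with h | h
  · rw [hπ.distance_eq hu.1 h hv.2, abs_sub_comm,
      abs_of_nonneg (sub_nonneg.2 (hπ.monotoneOn_arc hu hv h))]
  · rw [distance_comm, hπ.distance_eq hv.1 h hu.2,
      abs_of_nonneg (sub_nonneg.2 (hπ.monotoneOn_arc hv hu h))]

theorem arc_mem_Icc {u : ℝ} (hu : u ∈ Icc (0 : ℝ) 1) : arc π u ∈ Icc 0 (arc π 1) := by
  refine ⟨ENNReal.toReal_nonneg, hπ.monotoneOn_arc hu ⟨zero_le_one, le_rfl⟩ hu.2⟩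

variable (hC : ∀ k, Convex ℝ (P.fragment k).region)

include hC

theorem extend_eq_of_arc_eq {u v : ℝ} (hu : u ∈ Icc (0 : ℝ) 1) (hv : v ∈ Icc (0 : ℝ) 1)
    (h : arc π u = arc π v) : π.extend u = π.extend v :=
  eq_of_distance_eq_zero hC (by rw [hπ.distance_eq_abs hu hv, h]; simp)

/-- Merges the two sides of `exists_segment`: `δ` is the shorter of the lengths of the two segments
at level `c`. At an end of the path one of the sides is vacuous. -/
theorem exists_near_segment {c : ℝ} (hc : c ∈ Icc 0 (arc π 1)) : ∃ δ > 0,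
    ∀ c' ∈ Icc 0 (arc π 1), |c' - c| < δ → ∃ (k : Fin P.N) (x y : Plane), dist x y = |c' - c| ∧
      ∀ r ∈ Icc (0 : ℝ) 1, ∃ h, ∃ v ∈ Icc (0 : ℝ) 1,
        P.pt k (AffineMap.lineMap x y r) h = π.extend v ∧ arc π v = c + r * (c' - c) := by
  -- `τ` is 1 for the part of the path after level `c` and -1 for the part before it.
  have hsign : ∀ τ : ℝ, (∃ (k : Fin P.N) (x y : Plane), x ≠ y ∧ ∀ r ∈ Icc (0 : ℝ) 1,
      ∃ h, ∃ v ∈ Icc (0 : ℝ) 1, P.pt k (AffineMap.lineMap x y r) h = π.extend v ∧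
        arc π v = c + τ * (r * dist x y)) → ∃ δ > 0, ∀ c' : ℝ, |c' - c| < δ →
      c' - c = τ * |c' - c| → ∃ (k : Fin P.N) (x y : Plane), dist x y = |c' - c| ∧
      ∀ r ∈ Icc (0 : ℝ) 1, ∃ h, ∃ v ∈ Icc (0 : ℝ) 1,
        P.pt k (AffineMap.lineMap x y r) h = π.extend v ∧ arc π v = c + r * (c' - c) := by
    rintro τ ⟨k, x, y, hxy, h⟩
    have hd : 0 < dist x y := dist_pos.2 hxy
    refine ⟨dist x y, hd, fun c' hc' hs => ?_⟩
    have hr₀ : |c' - c| / dist x y ∈ Icc (0 : ℝ) 1 :=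
      ⟨by positivity, (div_le_one hd).2 hc'.le⟩
    refine ⟨k, x, AffineMap.lineMap x y (|c' - c| / dist x y), ?_, fun r hr => ?_⟩
    · rw [dist_left_lineMap, Real.norm_of_nonneg hr₀.1, div_mul_cancel₀ _ hd.ne']
    · have hrr : r * (|c' - c| / dist x y) ∈ Icc (0 : ℝ) 1 :=
        ⟨mul_nonneg hr.1 hr₀.1, mul_le_one₀ hr.2 hr₀.1 hr₀.2⟩
      obtain ⟨h1, v, hv, h2, h3⟩ := h _ hrr
      have e : AffineMap.lineMap x (AffineMap.lineMap x y (|c' - c| / dist x y)) r =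
          (AffineMap.lineMap x y (r * (|c' - c| / dist x y)) : Plane) := by
        simp [AffineMap.lineMap_apply, mul_smul]
      refine ⟨e ▸ h1, v, hv, (P.pt_congr rfl e _ _).trans h2, ?_⟩
      rw [h3]
      have : r * (|c' - c| / dist x y) * dist x y = r * |c' - c| := by field_simp
      rw [this]
      linear_combination -r * hs
  have hup : ∃ δ > 0, ∀ c' ∈ Icc 0 (arc π 1), |c' - c| < δ → c < c' →
      ∃ (k : Fin P.N) (x y : Plane), dist x y = |c' - c| ∧
      ∀ r ∈ Icc (0 : ℝ) 1, ∃ h, ∃ v ∈ Icc (0 : ℝ) 1,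
        P.pt k (AffineMap.lineMap x y r) h = π.extend v ∧ arc π v = c + r * (c' - c) := by
    by_cases hcL : c < arc π 1
    · obtain ⟨δ, hδ, h⟩ := hsign 1 (by simpa using (hπ.exists_segment hC hc).1 hcL)
      exact ⟨δ, hδ, fun c' _ h1 h2 => h c' h1 (by rw [one_mul, abs_of_pos (sub_pos.2 h2)])⟩
    · exact ⟨1, one_pos, fun c' hc' _ h2 => absurd (h2.trans_le hc'.2) hcL⟩
  have hdown : ∃ δ > 0, ∀ c' ∈ Icc 0 (arc π 1), |c' - c| < δ → c' < c →
      ∃ (k : Fin P.N) (x y : Plane), dist x y = |c' - c| ∧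
      ∀ r ∈ Icc (0 : ℝ) 1, ∃ h, ∃ v ∈ Icc (0 : ℝ) 1,
        P.pt k (AffineMap.lineMap x y r) h = π.extend v ∧ arc π v = c + r * (c' - c) := by
    by_cases hcL : 0 < c
    · obtain ⟨δ, hδ, h⟩ := hsign (-1)
        (by simpa [sub_eq_add_neg] using (hπ.exists_segment hC hc).2 hcL)
      exact ⟨δ, hδ, fun c' _ h1 h2 => h c' h1 (by rw [abs_of_neg (sub_neg.2 h2)]; ring)⟩
    · exact ⟨1, one_pos, fun c' hc' _ h2 => absurd (hc'.1.trans_lt h2) hcL⟩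
  obtain ⟨δ₁, hδ₁, h1⟩ := hup
  obtain ⟨δ₂, hδ₂, h2⟩ := hdown
  refine ⟨min δ₁ δ₂, lt_min hδ₁ hδ₂, fun c' hc' hlt => ?_⟩
  rw [lt_min_iff] at hlt
  rcases lt_trichotomy c c' with h | rfl | h
  · exact h1 c' hc' hlt.1 h
  · obtain ⟨v, hv, hvc⟩ := intermediate_value_Icc zero_le_one (hπ.continuousOn_arc hC)
      (by rwa [arc_zero] : c ∈ Icc (arc π 0) (arc π 1))
    obtain ⟨⟨k, x, hx⟩, hw⟩ := Quot.exists_rep (π.extend v)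
    refine ⟨k, x, x, by simp, fun r _ => ⟨by simpa using hx, v, hv, ?_, by simp [hvc]⟩⟩
    exact (P.pt_congr rfl (by simp) _ hx).trans hw
  · exact h2 c' hc' hlt.2 h

end IsShortest

namespace IsTriangulationVia

variable {P' : Portalgon} {parent : Fin P'.N → Fin P.N} (hT : P.IsTriangulationVia P' parent)

/-- The points of a fragment that represent a point of a path on the surface of a triangulation. -/
def pathTrace (i : Fin P.N) {s t : P'.Surface} (π : Path s t) : Set Plane :=
  {x | ∃ hx : x ∈ (P.fragment i).region, hT.cut (P.pt i x hx) ∈ range π}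

open Classical in
/-- The distance from `s` on the surface of the triangulation, as a function on a fragment. -/
def level (i : Fin P.N) (s : P'.Surface) (x : Plane) : ℝ :=
  if hx : x ∈ (P.fragment i).region then (P'.distance s (hT.cut (P.pt i x hx))).toReal else 0

variable {i : Fin P.N} {s t : P'.Surface} {π : Path s t}

theorem mem_pathTrace_of_eq {x : Plane} {hx : x ∈ (P.fragment i).region} {v : ℝ}
    (h : hT.cut (P.pt i x hx) = π.extend v) : x ∈ hT.pathTrace i π ∧ hT.level i s x = arc π v :=
  ⟨⟨hx, by rw [h, ← Path.extend_range π]; exact mem_range_self v⟩, by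
    rw [level, dif_pos hx, h]; rfl⟩

theorem exists_of_mem_pathTrace {x : Plane} (h : x ∈ hT.pathTrace i π) :
    ∃ hx, ∃ v ∈ Icc (0 : ℝ) 1, hT.cut (P.pt i x hx) = π.extend v ∧ hT.level i s x = arc π v := by
  obtain ⟨hx, v, hv⟩ := h
  have h : hT.cut (P.pt i x hx) = π.extend v := by rw [Path.extend_apply _ v.2]; exact hv.symm
  exact ⟨hx, v, v.2, h, (hT.mem_pathTrace_of_eq h).2⟩

variable (hπ : P'.IsShortest π)

include hπ

theorem level_mem_Icc {x : Plane} (h : x ∈ hT.pathTrace i π) :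
    hT.level i s x ∈ Icc 0 (arc π 1) := by
  obtain ⟨hx, v, hv, h1, h2⟩ := hT.exists_of_mem_pathTrace h
  rw [h2]
  exact hπ.arc_mem_Icc hv

theorem pt_eq_of_level_eq {x y : Plane} (hx : x ∈ hT.pathTrace i π) (hy : y ∈ hT.pathTrace i π)
    (h : hT.level i s x = hT.level i s y) : P.pt i x hx.1 = P.pt i y hy.1 := by
  obtain ⟨hx, v, hv, h1, h2⟩ := hT.exists_of_mem_pathTrace hx
  obtain ⟨hy, u, hu, h3, h4⟩ := hT.exists_of_mem_pathTrace hy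
  have := hπ.extend_eq_of_arc_eq hT.convex_region hv hu (by rw [← h2, ← h4, h])
  rw [← hT.incl_cut (P.pt i x hx), ← hT.incl_cut (P.pt i y hy), h1, h3, this]

theorem abs_level_sub_le {x y : Plane} (hx : x ∈ hT.pathTrace i π) (hy : y ∈ hT.pathTrace i π)
    (h : segment ℝ x y ⊆ (P.fragment i).region) :
    |hT.level i s x - hT.level i s y| ≤ dist x y := by
  obtain ⟨hx, v, hv, h1, h2⟩ := hT.exists_of_mem_pathTrace hx
  obtain ⟨hy, u, hu, h3, h4⟩ := hT.exists_of_mem_pathTrace hy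
  have hd := hπ.distance_eq_abs hv hu
  have := hd.ge.trans (hT.distance_le_distance_incl _ _)
  rw [← h1, ← h3, hT.incl_cut, hT.incl_cut] at this
  have := this.trans (distance_le_edist_of_segment_subset h hx hy)
  rw [edist_dist, ENNReal.ofReal_le_ofReal_iff dist_nonneg] at this
  rwa [h2, h4]

/-- If `y` is close to `z`, both are in one triangle `j`, and the surface distance between them is
Euclidean; as the path is shortest, it is also the difference of the levels. Between these levels
the path runs along a segment of some triangle `k`, which need not be `j`. By `exists_lift` the
segment from `z` to `y` represents the same points of the surface, so it is part of the trace. -/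
theorem locallyStraight : LocallyStraight (hT.pathTrace i π) (hT.level i s) := by
  intro z hz
  obtain ⟨hzr, v₀, hv₀, hz1, hz2⟩ := hT.exists_of_mem_pathTrace hz
  obtain ⟨ε, hε⟩ := exists_isGoodRadius (π.extend v₀)
  obtain ⟨δ, hδ, hnear⟩ := hπ.exists_near_segment hT.convex_region (hπ.arc_mem_Icc hv₀)
  obtain ⟨ε', hε', hball⟩ := exists_ball_disjoint_of_finite
    (fun j => (P'.fragment j).region) (fun j => SimplePolygon.isClosed_region _) z
  refine ⟨min ε (min δ ε'), lt_min hε.pos (lt_min hδ hε'), fun y hy hyz => ?_⟩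
  rw [lt_min_iff, lt_min_iff] at hyz
  obtain ⟨hyr, v, hv, hy1, hy2⟩ := hT.exists_of_mem_pathTrace hy
  obtain ⟨j, hj, hyj⟩ := hT.exists_mem hyr
  have hzj : z ∈ (P'.fragment j).region := by_contra fun h => hball j h y hyz.2.2 hyj
  rw [hT.cut_pt hj hyj] at hy1
  rw [hT.cut_pt hj hzj] at hz1
  have hd := hε.distance_eq hT.convex_region ⟨hzj, hz1⟩ hyj hyz.1
  rw [hy1, hπ.distance_eq_abs hv₀ hv, edist_dist,
    ENNReal.ofReal_eq_ofReal_iff (abs_nonneg _) dist_nonneg, abs_sub_comm] at hd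
  refine ⟨by rw [hy2, hz2, hd], ?_⟩
  obtain ⟨k, x₀, x₁, hx, hseg⟩ := hnear _ (hπ.arc_mem_Icc hv) (by rw [hd]; exact hyz.2.1)
  obtain ⟨h0, u₀, hu₀, e0, e0'⟩ := hseg 0 (by simp)
  obtain ⟨h1, u₁, hu₁, e1, e1'⟩ := hseg 1 (by simp)
  have hx₀ : x₀ ∈ P'.lifts (π.extend v₀) k := by
    refine ⟨by simpa using h0, ?_⟩
    rw [← hπ.extend_eq_of_arc_eq hT.convex_region hu₀ hv₀ (by rw [e0']; ring), ← e0]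
    exact P'.pt_congr rfl (by simp) _ _
  have hx₁ : x₁ ∈ (P'.fragment k).region := by simpa using h1
  have heq : P'.proj ⟨j, y, hyj⟩ = P'.proj ⟨k, x₁, hx₁⟩ := by
    refine hy1.trans (Eq.trans ?_ (P'.pt_congr rfl (by simp) h1 hx₁))
    rw [e1]
    exact hπ.extend_eq_of_arc_eq hT.convex_region hv hu₁ (by rw [e1']; ring)
  obtain ⟨x', hx', hd', hlift⟩ := hε.exists_lift hT.convex_region heq
    (x := z) ⟨hzj, hz1⟩ hyz.1
  simp only at hx' hd' hlift
  -- Both points represent the same point of the surface and are within `ε` of `x₁`, while different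
  -- such points are at least `2 * ε` apart.
  have hxx : x' = x₀ := by
    refine hε.eq_of_dist_lt k _ hx' _ hx₀ ?_
    have := dist_triangle_left x' x₀ x₁
    rw [hd', dist_comm x₁ x₀, hx, hd] at this
    linarith [hyz.1]
  subst hxx
  rw [segment_eq_image_lineMap]
  rintro _ ⟨r, hr, rfl⟩
  obtain ⟨h, h', e⟩ := hlift r hr
  obtain ⟨_, u, hu, e', -⟩ := hseg r hr
  refine (hT.mem_pathTrace_of_eq (hx := ?_) (v := u) ?_).1
  · rw [← hj]; exact hT.region_subset j h
  · rw [hT.cut_pt hj h, e, e']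

end IsTriangulationVia
end Portalgon

/-! ### Shortcuts past a boundary point -/

/-- Of the segments from two points of a circle to a third one, one meets the rays from the center
through the first two points only in its endpoint. -/
theorem exists_forall_combination_ne {E : Type*} [NormedAddCommGroup E] [NormedSpace ℝ E]
    {u u' v : E} (hu : ‖u‖ = ‖v‖) (hu' : ‖u'‖ = ‖v‖) (hv : v ≠ 0) (huu : u ≠ u') (huv : v ≠ u)
    (huv' : v ≠ u') :
    (v ≠ -u ∧ ∀ r ∈ Ioc (0 : ℝ) 1, ∀ a : ℝ, 0 ≤ a →
      (1 - r) • u + r • v ≠ a • u ∧ (1 - r) • u + r • v ≠ a • u') ∨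
    (v ≠ -u' ∧ ∀ r ∈ Ioc (0 : ℝ) 1, ∀ a : ℝ, 0 ≤ a →
      (1 - r) • u' + r • v ≠ a • u ∧ (1 - r) • u' + r • v ≠ a • u') := by
  have key : ∀ {x y : E} {c d : ℝ}, ‖x‖ = ‖v‖ → ‖y‖ = ‖v‖ → c • x = d • y → d ≠ 0 →
      y = x ∨ y = -x := by
    intro x y c d hx hy h hd
    have hn : 0 < ‖v‖ := norm_pos_iff.2 hv
    have h1 : |c| = |d| := by
      have := congrArg norm h
      rw [norm_smul, norm_smul, hx, hy, Real.norm_eq_abs, Real.norm_eq_abs] at this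
      exact mul_right_cancel₀ hn.ne' this
    have h2 : ∀ {z : E}, d • z = d • y → y = z := fun h => ((smul_right_injective E hd) h).symm
    rcases abs_eq_abs.1 h1 with rfl | rfl
    · exact Or.inl (h2 h)
    · exact Or.inr (h2 (by rw [smul_neg, ← neg_smul, h]))
  have own : ∀ {x : E}, ‖x‖ = ‖v‖ → v ≠ x → v ≠ -x → ∀ r ∈ Ioc (0 : ℝ) 1, ∀ a : ℝ,
      (1 - r) • x + r • v ≠ a • x := by
    intro x hx h1 h2 r hr a h
    have : (a - (1 - r)) • x = r • v := by rw [sub_smul, ← h]; abel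
    exact (key hx rfl this hr.1.ne').elim h1 h2
  have opp : ∀ {x y : E}, ‖x‖ = ‖v‖ → ‖y‖ = ‖v‖ → x ≠ y → v = -x → v ≠ -y ∧
      ∀ r ∈ Ioc (0 : ℝ) 1, ∀ a : ℝ, 0 ≤ a → (1 - r) • y + r • v ≠ a • x := by
    rintro x y hx hy hxy rfl
    refine ⟨fun h => hxy (neg_injective h), fun r hr a ha h => ?_⟩
    have h1 : (1 - r) • y = (a + r) • x := by rw [add_smul, ← h, smul_neg]; abel
    have h2 := hr.1
    have h3 : |1 - r| = |a + r| := by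
      have hn : 0 < ‖-x‖ := norm_pos_iff.2 hv
      have := congrArg norm h1
      rw [norm_smul, norm_smul, hx, hy, Real.norm_eq_abs, Real.norm_eq_abs] at this
      exact mul_right_cancel₀ hn.ne' this
    rw [abs_of_nonneg (by linarith [hr.2]), abs_of_nonneg (by linarith)] at h3
    rw [h3] at h1
    exact hxy ((smul_right_injective E (show a + r ≠ 0 by linarith)) h1).symm
  -- If `v` is opposite to one of the two points, the segment to it passes through the center, and
  -- the other point has to be chosen.
  by_cases e : v = -u
  · right
    obtain ⟨h1, h2⟩ := opp hu hu' huu e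
    exact ⟨h1, fun r hr a ha => ⟨h2 r hr a ha, own hu' huv' h1 r hr a⟩⟩
  by_cases e' : v = -u'
  · left
    obtain ⟨h1, h2⟩ := opp hu' hu huu.symm e'
    exact ⟨h1, fun r hr a ha => ⟨own hu huv h1 r hr a, h2 r hr a ha⟩⟩
  by_contra! hno
  obtain ⟨r, hr, a, ha, h1⟩ := hno.1 e
  obtain ⟨r', hr', a', ha', h2⟩ := hno.2 e'
  have h1 := h1 (own hu huv e r hr a)
  have h2 : (1 - r') • u' + r' • v = a' • u := by
    by_contra h
    exact own hu' huv' e' r' hr' a' (h2 h)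
  have hr0 := hr.1
  have hr0' := hr'.1
  -- If both segments met the ray through the other point, eliminating `u'` would make `v` a
  -- multiple of `u`, contrary to `v ≠ u` and `v ≠ -u`. In other words, `u'` cannot be between `u`
  -- and `v` while `u` is between `u'` and `v`.
  have h3 : (a * a' - (1 - r') * (1 - r)) • u = ((1 - r') * r + a * r') • v := by
    have e1 : (1 - r') • ((1 - r) • u + r • v) = (1 - r') • a • u' := by rw [h1]
    have e2 : a • ((1 - r') • u' + r' • v) = a • a' • u := by rw [h2]
    rw [sub_smul, add_smul, mul_smul, ← e2, mul_smul, mul_smul, mul_smul, smul_add,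
      smul_comm a (1 - r') u', ← e1, smul_add]
    abel
  have hpos : (1 - r') * r + a * r' ≠ 0 := by
    intro h
    have hnn : 0 ≤ (1 - r') * r := mul_nonneg (by linarith [hr'.2]) hr0.le
    have hnn' : 0 ≤ a * r' := mul_nonneg ha hr0'.le
    have ha0 : a = 0 := by
      rcases mul_eq_zero.1 (by linarith : a * r' = 0) with h | h
      · exact h
      · exact absurd h hr0'.ne'
    rw [ha0, zero_smul] at h1
    refine (key (c := -(1 - r)) hu rfl ?_ hr0.ne').elim huv e
    rw [neg_smul, neg_eq_iff_add_eq_zero, h1]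
  exact (key hu rfl h3 hpos).elim huv e

/-- A shortcut past a boundary point: of three points equally close to it, two of them on the
boundary, the third one can be joined to one of the other two. -/
theorem SimplePolygon.exists_segment_subset (Q : SimplePolygon) {z : Plane} (hz : z ∈ Q.bd) :
    ∃ ε > 0, ∀ y ∈ Q.bd, ∀ y' ∈ Q.bd, ∀ b ∈ Q.region, dist y z < ε → dist y' z = dist y z →
      dist b z = dist y z → y ≠ y' → b ≠ y → b ≠ y' →
      (segment ℝ y b ⊆ Q.region ∧ dist y b < 2 * dist y z) ∨
      (segment ℝ y' b ⊆ Q.region ∧ dist y' b < 2 * dist y z) := by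
  obtain ⟨u₁, u₂, -, -, -, ε, hε, hrays⟩ := Q.exists_rays hz
  refine ⟨ε, hε, fun y hy y' hy' b hb hyz hyy hbz hne hby hby' => ?_⟩
  have hyz0 : y ≠ z := by
    rintro rfl
    rw [dist_self, dist_eq_zero] at hbz
    exact hby hbz
  have hyz0' : y' ≠ z := by
    rintro rfl
    rw [dist_self, eq_comm, dist_eq_zero] at hyy
    exact hyz0 hyy
  have ray : ∀ {p q w : Plane} {c d : ℝ}, 0 ≤ c → 0 ≤ d → p = z + c • w → q = z + d • w → p ≠ z →
      ∃ a : ℝ, 0 ≤ a ∧ q - z = a • (p - z) := by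
    rintro p q w c d hc hd rfl rfl hpz
    have hc0 : c ≠ 0 := by rintro rfl; simp at hpz
    refine ⟨d / c, by positivity, ?_⟩
    rw [add_sub_cancel_left, add_sub_cancel_left, smul_smul, div_mul_cancel₀ _ hc0]
  have same : ∀ {w : Plane} {c d : ℝ}, 0 ≤ c → 0 ≤ d → y = z + c • w → y' = z + d • w → False := by
    intro w c d hc hd h h'
    obtain ⟨a, ha, e⟩ := ray hc hd h h' hyz0
    have hn : dist y' z = a * dist y z := by
      rw [dist_eq_norm, e, norm_smul, Real.norm_of_nonneg ha, dist_eq_norm]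
    have : a = 1 := by
      have hpos := dist_pos.2 hyz0
      rw [hyy] at hn
      exact mul_right_cancel₀ hpos.ne' (by linarith)
    rw [this, one_smul] at e
    exact hne (sub_left_injective e).symm
  -- The points `y` and `y'` are different and equally far from `z`, so they are on different rays,
  -- and the boundary near `z` consists of the rays through them.
  have hbd : ∀ p ∈ Q.bd, dist p z < ε → ∃ a : ℝ, 0 ≤ a ∧
      (p - z = a • (y - z) ∨ p - z = a • (y' - z)) := by
    intro p hp hpz
    rcases (hrays y hyz).1 hy with ⟨c, hc, h⟩ | ⟨c, hc, h⟩ <;>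
    rcases (hrays y' (hyy ▸ hyz)).1 hy' with ⟨d, hd, h'⟩ | ⟨d, hd, h'⟩
    · exact (same hc hd h h').elim
    · rcases (hrays p hpz).1 hp with ⟨f, hf, h''⟩ | ⟨f, hf, h''⟩
      · exact (ray hc hf h h'' hyz0).imp fun a ha => ⟨ha.1, Or.inl ha.2⟩
      · exact (ray hd hf h' h'' hyz0').imp fun a ha => ⟨ha.1, Or.inr ha.2⟩
    · rcases (hrays p hpz).1 hp with ⟨f, hf, h''⟩ | ⟨f, hf, h''⟩
      · exact (ray hd hf h' h'' hyz0').imp fun a ha => ⟨ha.1, Or.inr ha.2⟩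
      · exact (ray hc hf h h'' hyz0).imp fun a ha => ⟨ha.1, Or.inl ha.2⟩
    · exact (same hc hd h h').elim
  set u := y - z with hu
  set u' := y' - z with hu'
  set v := b - z with hv
  have n1 : ‖u‖ = ‖v‖ := by rw [← dist_eq_norm, ← dist_eq_norm, hbz]
  have n2 : ‖u'‖ = ‖v‖ := by rw [← dist_eq_norm, ← dist_eq_norm, hbz, hyy]
  have hv0 : v ≠ 0 := by
    intro h
    rw [h, norm_zero, norm_eq_zero, hu, sub_eq_zero] at n1
    exact hby ((sub_eq_zero.1 h).trans n1.symm)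
  have main : ∀ x ∈ Q.bd, dist x z = dist y z → v ≠ -(x - z) → (∀ r ∈ Ioc (0 : ℝ) 1, ∀ a : ℝ,
      0 ≤ a → (1 - r) • (x - z) + r • v ≠ a • u ∧ (1 - r) • (x - z) + r • v ≠ a • u') →
      segment ℝ x b ⊆ Q.region ∧ dist x b < 2 * dist y z := by
    intro x hx hxz hvx h
    constructor
    · set S : Set Plane := AffineMap.lineMap x b '' Ioc (0 : ℝ) 1 with hS
      have hconn : IsPreconnected S :=
        isPreconnected_Ioc.image _ AffineMap.lineMap_continuous.continuousOn
      have hsub := Q.subset_region_of_isPreconnected hconn (by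
        rw [Set.disjoint_left]
        rintro _ ⟨r, hr, rfl⟩ hp
        have hball : AffineMap.lineMap x b r ∈ Metric.ball z ε :=
          (convex_ball z ε).lineMap_mem (by rw [Metric.mem_ball, hxz]; exact hyz)
            (by rw [Metric.mem_ball, hbz]; exact hyz) ⟨hr.1.le, hr.2⟩
        obtain ⟨a, ha, hpa⟩ := hbd _ hp hball
        have e : (AffineMap.lineMap x b r : Plane) - z = (1 - r) • (x - z) + r • v := by
          rw [AffineMap.lineMap_apply_module, hv]; module
        rw [e] at hpa
        exact hpa.elim (h r hr a ha).1 (h r hr a ha).2)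
        ⟨1, by simp, AffineMap.lineMap_apply_one _ _⟩ hb
      rw [segment_eq_image_lineMap]
      rintro _ ⟨r, hr, rfl⟩
      rcases hr.1.eq_or_lt with rfl | hr0
      · rw [AffineMap.lineMap_apply_zero]; exact Q.bd_subset_region hx
      · exact hsub ⟨r, ⟨hr0, hr.2⟩, rfl⟩
    · have n3 : ‖x - z‖ = ‖-v‖ := by rw [norm_neg, ← n1, ← dist_eq_norm, ← dist_eq_norm, hxz]
      have hns : ¬ SameRay ℝ (x - z) (-v) := by
        rw [sameRay_iff_of_norm_eq n3]
        intro h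
        exact hvx (by rw [h, neg_neg])
      have := norm_add_lt_of_not_sameRay hns
      rw [← n3, ← dist_eq_norm, hxz] at this
      have e : x - z + -v = x - b := by rw [hv]; abel
      rw [e, ← dist_eq_norm] at this
      linarith
  rcases exists_forall_combination_ne n1 n2 hv0 (fun h => hne (sub_left_injective h))
    (fun h => hby (sub_left_injective h)) (fun h => hby' (sub_left_injective h)) with h | h
  · exact Or.inl (main y hy rfl h.1 h.2)
  · exact Or.inr (main y' hy' hyy h.1 h.2)

/-- Only two edges of a polygon pass through a vertex. -/
theorem DirectedEdge.edge_eq_or_of_mem {N : ℕ} {F : Fin N → SimplePolygon} {d e f : DirectedEdge F}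
    (he : e.frag = d.frag) (hf : f.frag = d.frag) (hne : d.edge ≠ e.edge) {z : Plane}
    (hv : z ∈ range (F d.frag).poly.vertices) (hd : z ∈ segment ℝ d.src d.tgt)
    (he' : z ∈ segment ℝ e.src e.tgt) (hf' : z ∈ segment ℝ f.src f.tgt) :
    f.edge = d.edge ∨ f.edge = e.edge := by
  rw [segment_eq_edgeSet] at hd he' hf'
  obtain ⟨i, k, b⟩ := d
  obtain ⟨i', k', b'⟩ := e
  obtain ⟨i'', k'', b''⟩ := f
  simp only at he hf hv hd he' hf'
  subst he hf
  obtain ⟨m, rfl⟩ := hv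
  simp only [edge] at hne ⊢
  rcases (F i'').eq_or_of_vertex_mem_edgeSet hd with rfl | rfl <;>
  rcases (F i'').eq_or_of_vertex_mem_edgeSet he' with rfl | rfl <;>
  rcases (F i'').eq_or_of_vertex_mem_edgeSet hf' with rfl | rfl <;> simp at hne ⊢

/-! ### Nearby points of a fragment that are glued to each other -/

namespace Portalgon

variable {P : Portalgon}

/-- If a portal glues the two edges at a vertex to each other, then the vertex is glued to no other
point. -/
theorem eq_of_proj_eq_of_portal {d e : P.DEdge} (hde : s(d, e) ∈ P.portals) (hf : e.frag = d.frag)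
    {t₀ : ℝ} (ht₀ : t₀ ∈ Icc (0 : ℝ) 1)
    (hz : (AffineMap.lineMap e.src e.tgt t₀ : Plane) = AffineMap.lineMap d.src d.tgt t₀)
    (hv : AffineMap.lineMap d.src d.tgt t₀ ∈ range (P.fragment d.frag).poly.vertices)
    {x y : P.Points} (hxy : P.proj x = P.proj y)
    (hx : x.1 = d.frag ∧ (x.2 : Plane) = AffineMap.lineMap d.src d.tgt t₀) :
    y.1 = d.frag ∧ (y.2 : Plane) = AffineMap.lineMap d.src d.tgt t₀ := by
  have step : ∀ x y : P.Points, P.Corresponding x y →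
      (x.1 = d.frag ∧ (x.2 : Plane) = AffineMap.lineMap d.src d.tgt t₀) →
      y.1 = d.frag ∧ (y.2 : Plane) = AffineMap.lineMap d.src d.tgt t₀ := by
    rintro x y ⟨d', e', hde', t, ht, ⟨hx1, hx2⟩, ⟨hy1, hy2⟩⟩ ⟨hx3, hx4⟩
    have hmem : ∀ (f : P.DEdge) {t : ℝ}, t ∈ Icc (0 : ℝ) 1 →
        AffineMap.lineMap f.src f.tgt t ∈ segment ℝ f.src f.tgt := fun f t ht => by
      rw [segment_eq_image_lineMap]; exact ⟨t, ht, rfl⟩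
    -- Any portal that moves this vertex uses `d` or `e`, so it is the given one, which maps the
    -- vertex to itself.
    have h1 := DirectedEdge.edge_eq_or_of_mem hf (hx1.symm.trans hx3)
      (P.portal_distinct d e hde) hv (hmem d ht₀) (hz ▸ hmem e ht₀)
      (by rw [← hx4, hx2]; exact hmem d' ht)
    have h2 : s(d', e') = s(d, e) := by
      rcases h1 with h1 | h1
      · exact P.portal_unique _ hde' _ hde d' (Sym2.mem_mk_left _ _) d (Sym2.mem_mk_left _ _) h1
      · exact P.portal_unique _ hde' _ hde d' (Sym2.mem_mk_left _ _) e (Sym2.mem_mk_right _ _) h1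
    rcases Sym2.eq_iff.1 h2 with ⟨rfl, rfl⟩ | ⟨rfl, rfl⟩
    · have : t = t₀ := AffineMap.lineMap_injective ℝ d'.src_ne_tgt (hx2.symm.trans hx4)
      subst this
      exact ⟨hy1.trans hf, hy2.trans hz⟩
    · have : t = t₀ := AffineMap.lineMap_injective ℝ d'.src_ne_tgt
        ((hx2.symm.trans hx4).trans hz.symm)
      subst this
      exact ⟨hy1, hy2⟩
  have main : ∀ x y, Relation.EqvGen P.Corresponding x y →
      ((x.1 = d.frag ∧ (x.2 : Plane) = AffineMap.lineMap d.src d.tgt t₀) ↔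
      (y.1 = d.frag ∧ (y.2 : Plane) = AffineMap.lineMap d.src d.tgt t₀)) := by
    intro x y h
    induction h with
    | rel x y h => exact ⟨step x y h, step y x (P.corresponding_symm h)⟩
    | refl x => exact Iff.rfl
    | symm x y _ ih => exact ih.symm
    | trans x y z _ _ ih1 ih2 => exact ih1.trans ih2
  exact (main x y (Quot.eqvGen_exact hxy)).1 hx

/-- Equally close points near `z` are only glued to each other if `z` is a vertex whose two edges
are glued to each other. -/
theorem exists_radius_of_pt_eq {i : Fin P.N} {z : Plane} (hz : z ∈ (P.fragment i).region) :
    ∃ ε > 0, ∀ y hy y' hy', dist y z < ε → dist y' z = dist y z → y ≠ y' →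
      P.pt i y hy = P.pt i y' hy' → y ∈ (P.fragment i).bd ∧ y' ∈ (P.fragment i).bd ∧
        z ∈ (P.fragment i).bd ∧ ∀ k p hp, P.pt k p hp = P.pt i z hz → k = i ∧ p = z := by
  obtain ⟨ε₁, hε₁, h1⟩ := exists_ball_disjoint_of_finite
    (fun d : P.DEdge => segment ℝ d.src d.tgt)
    (fun d => by rw [DirectedEdge.segment_eq_edgeSet]; exact SimplePolygon.isClosed_edgeSet _ _) z
  obtain ⟨ε₂, hε₂, h2⟩ := exists_ball_disjoint_of_finite
    (fun m => {(P.fragment i).poly m}) (fun _ => isClosed_singleton) z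
  obtain ⟨ε₃, hε₃, h3⟩ := exists_ball_disjoint_of_finite
    (fun d : P.DEdge => {(AffineMap.lineMap d.src d.tgt (1 / 2 : ℝ) : Plane)})
    (fun _ => isClosed_singleton) z
  refine ⟨min ε₁ (min ε₂ ε₃), lt_min hε₁ (lt_min hε₂ hε₃), fun y hy y' hy' hyz hyy hne heq => ?_⟩
  have hyz' : dist y' z < min ε₁ (min ε₂ ε₃) := hyy ▸ hyz
  rw [lt_min_iff, lt_min_iff] at hyz hyz'
  have hver : ∀ p, dist p z < ε₂ → p ∈ range (P.fragment i).poly.vertices → p = z := by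
    rintro _ hp ⟨m, rfl⟩
    by_contra h
    exact h2 m (fun h' => h h'.symm) _ hp rfl
  rcases eq_or_corresponding_of_proj_eq heq with h | h | h
  · exact absurd (by simpa using h) hne
  · obtain ⟨d, e, hde, t, ht, ⟨hd, hyd⟩, ⟨he, hye⟩⟩ := h
    simp only at hd he hyd hye
    subst hd
    have hmd : y ∈ segment ℝ d.src d.tgt := by
      rw [segment_eq_image_lineMap]; exact ⟨t, ht, hyd.symm⟩
    have hme : y' ∈ segment ℝ e.src e.tgt := by
      rw [segment_eq_image_lineMap]; exact ⟨t, ht, hye.symm⟩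
    have hzd : z ∈ segment ℝ d.src d.tgt := by_contra fun h => h1 d h y hyz.1 hmd
    have hze : z ∈ segment ℝ e.src e.tgt := by_contra fun h => h1 e h y' hyz'.1 hme
    have hzv : z ∈ range (P.fragment d.frag).poly.vertices := by
      by_contra h
      exact P.portal_distinct d e hde (DirectedEdge.edge_eq_of_mem he hzd hze h)
    refine ⟨d.segment_subset_bd hmd, he ▸ e.segment_subset_bd hme, d.segment_subset_bd hzd, ?_⟩
    have fin : ∀ t₀ : ℝ, t₀ ∈ Icc (0 : ℝ) 1 → z = AffineMap.lineMap d.src d.tgt t₀ →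
        z = AffineMap.lineMap e.src e.tgt t₀ → ∀ k p hp, P.pt k p hp = P.pt d.frag z hz →
          k = d.frag ∧ p = z := by
      intro t₀ ht₀ hz1 hz2 k p hp hpz
      have := eq_of_proj_eq_of_portal hde he.symm ht₀ (hz2.symm.trans hz1) (hz1 ▸ hzv)
        (x := ⟨d.frag, z, hz⟩) (y := ⟨k, p, hp⟩) hpz.symm ⟨rfl, hz1⟩
      exact ⟨this.1, this.2.trans hz1.symm⟩
    have hlen := P.portal_length d e hde
    have hpos : 0 < dist d.src d.tgt := dist_pos.2 d.src_ne_tgt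
    -- If the portal matched the end of `d` at `z` with the far end of `e`, equal distances from `z`
    -- would force `t = 1 / 2`. The radius `ε₃` keeps midpoints of edges away from `z`.
    have half : ∀ f : P.DEdge, t = 1 / 2 → dist (AffineMap.lineMap f.src f.tgt t) z < ε₃ →
        z = f.src ∨ z = f.tgt → False := by
      rintro f rfl hlt h
      refine h3 f ?_ _ hlt rfl
      rw [mem_singleton_iff]
      have hne := f.src_ne_tgt
      rcases h with rfl | rfl
      · intro h
        have := congrArg (dist f.src) h
        rw [dist_self, dist_left_lineMap] at this
        exact hne (by simpa using this)
      · intro h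
        have := congrArg (dist · f.tgt) h
        simp only [dist_self, dist_lineMap_right] at this
        exact hne (by norm_num at this; exact this)
    rcases DirectedEdge.eq_src_or_eq_tgt hzd hzv with hs | hs <;>
      rcases DirectedEdge.eq_src_or_eq_tgt hze (he ▸ hzv) with hs' | hs'
    · exact fin 0 (by simp) (by simpa using hs) (by simpa using hs')
    · exfalso
      refine half d ?_ (hyd ▸ hyz.2.2) (Or.inl hs)
      rw [hyd, hye] at hyy
      nth_rw 1 [hs'] at hyy
      rw [hs, dist_lineMap_left, dist_lineMap_right, ← hlen, Real.norm_of_nonneg ht.1,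
        Real.norm_of_nonneg (by linarith [ht.2])] at hyy
      have := mul_right_cancel₀ hpos.ne' hyy
      linarith
    · exfalso
      refine half d ?_ (hyd ▸ hyz.2.2) (Or.inr hs)
      rw [hyd, hye] at hyy
      nth_rw 1 [hs'] at hyy
      rw [hs, dist_lineMap_left, dist_lineMap_right, ← hlen, Real.norm_of_nonneg ht.1,
        Real.norm_of_nonneg (by linarith [ht.2])] at hyy
      have := mul_right_cancel₀ hpos.ne' hyy
      linarith
    · exact fin 1 (by simp) (by simpa using hs) (by simpa using hs')
  · exact absurd ((hver y hyz.2.1 h.1).trans (hver y' hyz'.2.1 h.2).symm) hne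

end Portalgon
-- Folds occur only at the ends, and the count of components
namespace Portalgon
namespace IsTriangulationVia

variable {P P' : Portalgon} {parent : Fin P'.N → Fin P.N} (hT : P.IsTriangulationVia P' parent)
  {i : Fin P.N} {s t : P'.Surface} {π : Path s t} (hπ : P'.IsShortest π)

include hπ

/-- A shortest path folds at a point only if it starts or ends there. -/
theorem level_of_isFold {z : Plane} (hz : z ∈ hT.pathTrace i π)
    (hf : IsFold (hT.pathTrace i π) (hT.level i s) z) :
    (hT.level i s z = 0 ∨ hT.level i s z = arc π 1) ∧
      ∀ p ∈ hT.pathTrace i π, hT.level i s p = hT.level i s z → p = z := by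
  obtain ⟨ε₁, hε₁, h1⟩ := exists_radius_of_pt_eq hz.1
  obtain ⟨ε₂, hε₂, h2⟩ := hT.locallyStraight hπ z hz
  set φ := hT.level i s with hφ
  have fold : ∀ ε > 0, ∃ y ∈ hT.pathTrace i π, ∃ y' ∈ hT.pathTrace i π, dist y z < ε ∧
      dist y' z = dist y z ∧ y ≠ y' ∧ φ y = φ y' ∧ y ∈ (P.fragment i).bd ∧
      y' ∈ (P.fragment i).bd ∧ z ∈ (P.fragment i).bd ∧ |φ y - φ z| = dist y z ∧
      ∀ k p hp, P.pt k p hp = P.pt i z hz.1 → k = i ∧ p = z := by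
    intro ε hε
    obtain ⟨y, hy, y', hy', d1, d2, hne, he⟩ := hf (min ε (min ε₁ ε₂))
      (lt_min hε (lt_min hε₁ hε₂))
    rw [lt_min_iff, lt_min_iff] at d1 d2
    have e1 := (h2 y hy d1.2.2).1
    have e2 := (h2 y' hy' d2.2.2).1
    have hd : dist y' z = dist y z := by rw [← e1, ← e2, he]
    obtain ⟨hb, hb', hbz, hcl⟩ := h1 y hy.1 y' hy'.1 d1.2.1 hd hne (hT.pt_eq_of_level_eq hπ hy hy' he)
    exact ⟨y, hy, y', hy', d1.1, hd, hne, he, hb, hb', hbz, e1, hcl⟩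
  have hcl : ∀ k p hp, P.pt k p hp = P.pt i z hz.1 → k = i ∧ p = z := by
    obtain ⟨y, hy, y', hy', -, -, -, -, -, -, -, -, hcl⟩ := fold 1 one_pos
    exact hcl
  have hzbd : z ∈ (P.fragment i).bd := by
    obtain ⟨y, hy, y', hy', -, -, -, -, -, -, hbz, -, -⟩ := fold 1 one_pos
    exact hbz
  refine ⟨?_, fun p hp hpz => (hcl i p hp.1 (hT.pt_eq_of_level_eq hπ hp hz hpz)).2⟩
  -- Suppose that the path passes through `z`. Take two points `y`, `y'` of equal level on the two
  -- edges at `z`, and let `b` be the point of the path on the other side of `z` at the same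
  -- distance. Since `z` has no further copies, `b` is in the same fragment. One of the segments
  -- from `y` and `y'` to `b` stays in the fragment and is shorter than the way along the path
  -- through `z`, which contradicts minimality.
  by_contra! hno
  have hzL := hT.level_mem_Icc hπ hz
  have hpos : 0 < φ z := lt_of_le_of_ne hzL.1 hno.1.symm
  have hlt : φ z < arc π 1 := lt_of_le_of_ne hzL.2 hno.2
  obtain ⟨δ, hδ, hnear⟩ := hπ.exists_near_segment hT.convex_region hzL
  obtain ⟨ε₃, hε₃, hshort⟩ := (P.fragment i).exists_segment_subset hzbd
  obtain ⟨y, hy, y', hy', hyz, hyy, hne, he, hb, hb', -, hd, -⟩ :=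
    fold (min δ (min ε₃ (min (φ z) (arc π 1 - φ z))))
      (lt_min hδ (lt_min hε₃ (lt_min hpos (sub_pos.2 hlt))))
  rw [lt_min_iff, lt_min_iff, lt_min_iff] at hyz
  have hyz0 : 0 < dist y z := dist_pos.2 fun h => by
    subst h
    rw [dist_self, dist_eq_zero] at hyy
    exact hne hyy.symm
  have hrefl : |2 * φ z - φ y - φ z| = dist y z := by
    rw [← hd, ← abs_neg]; congr 1; ring
  have hmem : 2 * φ z - φ y ∈ Icc 0 (arc π 1) := by
    have := abs_le.1 hd.le
    exact ⟨by linarith, by linarith⟩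
  obtain ⟨k, x, b, hxb, hseg⟩ := hnear _ hmem (by rw [hrefl]; exact hyz.1)
  obtain ⟨h0, u₀, hu₀, e0, e0'⟩ := hseg 0 (by simp)
  obtain ⟨h1', u₁, hu₁, e1, e1'⟩ := hseg 1 (by simp)
  simp only [AffineMap.lineMap_apply_zero, AffineMap.lineMap_apply_one] at h0 h1' e0 e1
  obtain ⟨hzr, v₀, hv₀, hz1, hz2⟩ := hT.exists_of_mem_pathTrace hz
  have hpar := hcl (parent k) x (hT.region_subset k h0) (by
    rw [← hT.incl_pt k x h0, e0, ← hT.incl_cut (P.pt i z hzr), hz1]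
    congr 1
    refine hπ.extend_eq_of_arc_eq hT.convex_region hu₀ hv₀ ?_
    rw [e0', ← hz2]
    ring)
  obtain ⟨hk, rfl⟩ := hpar
  have hbr : b ∈ (P.fragment i).region := hk ▸ hT.region_subset k h1'
  obtain ⟨hbA, hbφ⟩ := hT.mem_pathTrace_of_eq (hx := hbr) (v := u₁)
    (by rw [hT.cut_pt hk h1', e1])
  have hbφ' : φ b = 2 * φ x - φ y := by rw [hφ, hbφ, e1']; ring
  have hdiff : |φ y - φ b| = 2 * dist y x := by
    rw [hbφ', ← hd, show φ y - (2 * φ x - φ y) = 2 * (φ y - φ x) by ring, abs_mul]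
    norm_num
  have hby : ∀ p, φ p = φ y → b ≠ p := by
    rintro p hp rfl
    rw [hp, sub_self, abs_zero] at hdiff
    linarith
  rcases hshort y hb y' hb' b hbr hyz.2.1 hyy (by rw [dist_comm, hxb, hrefl]) hne (hby y rfl)
    (hby y' he.symm) with ⟨hs, hlt⟩ | ⟨hs, hlt⟩
  · have := hT.abs_level_sub_le hπ hy hbA hs
    rw [← hφ, hdiff] at this
    linarith
  · have := hT.abs_level_sub_le hπ hy' hbA hs
    rw [← hφ, ← he, hdiff] at this
    linarith

include hT in
-- Representatives of `h + 1` components are moved into the trace of a truncated path, where they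
-- are shown to be in different components. Fixing finitely many representatives in advance is
-- essential, because the truncation depends on their levels.
theorem card_connectedComponents_trace_le {h : ℕ} (hP : P.IsHappy h) (j : Fin P'.N) :
    ENat.card (ConnectedComponents (P'.trace j π)) ≤ h := by
  by_contra! hcard
  have hsucc : ((h + 1 : ℕ) : ℕ∞) ≤ (univ : Set (ConnectedComponents (P'.trace j π))).encard := by
    rw [encard_univ]
    exact_mod_cast Order.add_one_le_of_lt hcard
  obtain ⟨K, -, hK⟩ := exists_subset_encard_eq hsucc
  have : Finite K := finite_of_encard_eq_coe hK
  have hrep : ∀ k : K, ∃ x : P'.trace j π, ConnectedComponents.mk x = (k : ConnectedComponents _) :=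
    fun k => Quot.exists_rep _
  choose x hx using hrep
  set p : K → Plane := fun k => ((x k : (P'.fragment j).region) : Plane) with hp
  have hpT : ∀ k, p k ∈ (P'.fragment j).region := fun k => (x k).1.2
  have hsegT : ∀ k l, segment ℝ (p k) (p l) ⊆ (P'.fragment j).region := fun k l =>
    (hT.convex_region j).segment_subset (hpT k) (hpT l)
  have hpA : ∀ k, p k ∈ hT.pathTrace (parent j) π := fun k =>
    ⟨hT.region_subset j (hpT k), by rw [hT.cut_pt rfl (hpT k)]; exact (x k).2⟩
  obtain ⟨α, β, hα, hαβ, hβ, p', hp', hsep⟩ := (hT.locallyStraight hπ).exists_truncation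
    (hπ.arc_mem_Icc ⟨zero_le_one, le_rfl⟩).1 (fun z hz => hT.level_mem_Icc hπ hz)
    (fun z hz hf => hT.level_of_isFold hπ hz hf) hpA
    (fun k l => hT.abs_level_sub_le hπ (hpA k) (hpA l) ((hsegT k l).trans (hT.region_subset j)))
  have hcont := hπ.continuousOn_arc hT.convex_region
  obtain ⟨u, hu, hau⟩ := intermediate_value_Icc zero_le_one hcont
    (show α ∈ Icc (arc π 0) (arc π 1) from ⟨by rwa [arc_zero], hαβ.trans hβ⟩)
  obtain ⟨v, hv, hav⟩ := intermediate_value_Icc hu.2 (hcont.mono (Icc_subset_Icc_left hu.1))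
    (show β ∈ Icc (arc π u) (arc π 1) from ⟨by rwa [hau], hβ⟩)
  have hv' : v ∈ Icc (0 : ℝ) 1 := ⟨hu.1.trans hv.1, hv.2⟩
  -- `u` and `v` are times at which the path has the levels `α` and `β`, so the trace of `ρ` in the
  -- fragment is the part of the trace of π between these levels.
  set ρ := (π.subpath ⟨u, hu⟩ ⟨v, hv'⟩).map hT.continuous_incl with hρ
  have hρs : P.IsShortest ρ := hT.isShortest_map_subpath hπ hv.1
  have hmem : ∀ y : (P.fragment (parent j)).region, y ∈ P.trace (parent j) ρ ↔
      (y : Plane) ∈ hT.pathTrace (parent j) π ∩ hT.level (parent j) s ⁻¹' Icc α β := by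
    intro y
    have hrange : range (π.subpath ⟨u, hu⟩ ⟨v, hv'⟩) = π '' Icc ⟨u, hu⟩ ⟨v, hv'⟩ :=
      Path.range_subpath_of_le _ _ _ hv.1
    constructor
    · rintro ⟨r, hr⟩
      obtain ⟨w, hw, hwr⟩ : π.subpath ⟨u, hu⟩ ⟨v, hv'⟩ r ∈ π '' Icc ⟨u, hu⟩ ⟨v, hv'⟩ :=
        hrange ▸ mem_range_self r
      have hy : hT.cut (P.pt (parent j) y y.2) = π.extend w := by
        rw [Path.extend_apply _ w.2]
        refine Eq.trans (congrArg hT.cut hr.symm) ?_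
        exact (hT.cut_incl _).trans hwr.symm
      obtain ⟨h1, h2⟩ := hT.mem_pathTrace_of_eq hy
      refine ⟨h1, ?_⟩
      rw [mem_preimage, h2, ← hau, ← hav]
      exact ⟨hπ.monotoneOn_arc hu w.2 hw.1, hπ.monotoneOn_arc w.2 hv' hw.2⟩
    · rintro ⟨h1, h2⟩
      obtain ⟨hy, w, hw, e1, e2⟩ := hT.exists_of_mem_pathTrace h1
      rw [mem_preimage, e2, ← hau, ← hav] at h2
      obtain ⟨r, hr, hrw⟩ := intermediate_value_Icc hv.1
        (hcont.mono (Icc_subset_Icc hu.1 hv.2)) h2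
      have hr' : r ∈ Icc (0 : ℝ) 1 := ⟨hu.1.trans hr.1, hr.2.trans hv.2⟩
      have hmem : π ⟨r, hr'⟩ ∈ range (π.subpath ⟨u, hu⟩ ⟨v, hv'⟩) := by
        rw [hrange]; exact ⟨_, hr, rfl⟩
      obtain ⟨q, hq⟩ := hmem
      refine ⟨q, (congrArg hT.incl hq).trans ?_⟩
      rw [← Path.extend_apply π hr', hπ.extend_eq_of_arc_eq hT.convex_region hr' hw hrw, ← e1,
        hT.incl_cut]
      rfl
  have hle : ENat.card (ConnectedComponents (P.trace (parent j) ρ)) ≤ h :=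
    le_trans (le_trans (le_iSup₂_of_le _ _ (le_iSup₂_of_le
      (f := fun π _ => ENat.card (ConnectedComponents (P.trace (parent j) π))) ρ hρs le_rfl))
      (le_iSup P.fragmentHappiness (parent j))) hP
  set x' : K → P.trace (parent j) ρ := fun k => ⟨⟨p' k, (hp' k).1.1⟩, (hmem _).2 (hp' k)⟩ with hx'
  have hinj : Function.Injective fun k => (ConnectedComponents.mk (x' k)) := by
    intro k l hkl
    have hkl' : connectedComponent (x' k) = connectedComponent (x' l) :=
      ConnectedComponents.coe_eq_coe.1 hkl
    -- A common component yields a connected set between the cuts that contains `p' k` and `p' l`,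
    -- so the segment from `p k` to `p l` is in the trace of π. It also lies in the triangle, so it
    -- joins the two representatives inside the trace in the triangle.
    have hseg := hsep k l ⟨(fun y : P.trace (parent j) ρ => (y.1 : Plane)) ''
      connectedComponent (x' k), ?_, ?_, ⟨x' k, mem_connectedComponent, rfl⟩,
      ⟨x' l, hkl' ▸ mem_connectedComponent, rfl⟩⟩
    · have hpre : IsPreconnected ((fun y : P'.trace j π => (y.1 : Plane)) ⁻¹'
          segment ℝ (p k) (p l)) := by
        have hind : Topology.IsInducing fun y : P'.trace j π => (y.1 : Plane) :=
          Topology.IsInducing.subtypeVal.comp Topology.IsInducing.subtypeVal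
        rw [← hind.isPreconnected_image, image_preimage_eq_of_subset]
        · exact (convex_segment _ _).isPreconnected
        · intro z hz
          have hzT := hsegT k l hz
          have hzA := (hseg hz).2
          rw [hT.cut_pt rfl hzT] at hzA
          exact ⟨⟨⟨z, hzT⟩, hzA⟩, rfl⟩
      have := hpre.subset_connectedComponent (x := x k)
        (show p k ∈ segment ℝ (p k) (p l) from left_mem_segment ℝ _ _)
        (show p l ∈ segment ℝ (p k) (p l) from right_mem_segment ℝ _ _)
      have := ConnectedComponents.coe_eq_coe'.2 this
      rw [hx, hx] at this
      exact Subtype.ext this.symm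
    · rintro _ ⟨y, -, rfl⟩
      exact (hmem _).1 y.2
    · exact isPreconnected_connectedComponent.image _ (by fun_prop)
  have hcK := ENat.card_le_card_of_injective hinj
  have : ((h + 1 : ℕ) : ℕ∞) ≤ h := hK ▸ hcK.trans hle
  exact absurd (ENat.natCast_le_natCast.1 this) (by omega)

end IsTriangulationVia
end Portalgon

theorem mainTheorem8 (P P' : Portalgon) (h : ℕ) (hP : P.IsHappy h)
    (hT : P.IsTriangulation P') : P'.IsHappy h := by
  obtain ⟨parent, hT⟩ := hT
  exact iSup_le fun j => iSup₂_le fun s t => iSup₂_le fun π hπ =>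
    hT.card_connectedComponents_trace_le hπ hP j
end
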